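/- Let $S$ be a compact connected $2$-orbifold with nonempty boundary, whose only singularities are finitely many interior cone points; that is, its underlying surface is a sphere with finitely many handles or finitely many crosscaps and with at least one hole, and each cone point has an order $k\ge 2$. Suppose that the underlying surface of $S$ is not a disk. Then there is a $4$-sheeted orbifold cover $p:\hat S\to S$, with $\hat S$ compact, such that for every boundary component $\gamma$ of $S$ the preimage $p^{-1}(\gamma)$ is the union of exactly two boundary components $\hat\gamma_0\neq\hat\gamma_1$ of $\hat S$, and each restriction $p:\hat\gamma_i\to\gamma$ is a double ($2$-sheeted) cover. If moreover the underlying surface of $S$ is not an annulus, then $\hat S$ can be chosen connected. Here an $n$-sheeted orbifold cover (not required to be connected) is a continuous map which is a covering map over the points that are not cone points and which, at a point $y$ over a cone point of order $k$, has the form $z\mapsto z^{k/l}$ in local coordinates, where $l\mid k$ is the order of $y$ (with $l=1$ if $y$ is not a cone point); the sheets over each point, counted with the multiplicities $k/l$, are $n$ in number. -/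

import Mathlib

open Set Topology

universe u

/-! ### Compact surfaces with nonempty boundary -/

/-- The rectangle `[0, 2N+1] × [0,1]`, thought of as a disk whose boundary carries the `N` disjoint
arcs `[2i+1, 2i+2] × {1}`, where `i < N`. -/
def ArcRectangle (N : ℕ) : Type :=
  ↥(Icc (0 : ℝ) (2 * N + 1) ×ˢ Icc (0 : ℝ) 1)

instance (N : ℕ) : TopologicalSpace (ArcRectangle N) :=
  inferInstanceAs (TopologicalSpace ↥(Icc (0 : ℝ) (2 * N + 1) ×ˢ Icc (0 : ℝ) 1))

/-- The gluing of the arcs of the rectangle prescribed by a word `w`, in which every label occurs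
twice. The `i`-th arc carries the `i`-th letter of `w`: a label and a direction. Two different arcs
with the same label are identified so that their directions agree. -/
def ArcGlue (w : List (ℕ × Bool)) (p q : ArcRectangle w.length) : Prop :=
  ∃ i j : Fin w.length, i ≠ j ∧ (w.get i).1 = (w.get j).1 ∧ ∃ t ∈ Icc (0 : ℝ) 1,
    p.1 = (2 * (i : ℝ) + 1 + t, 1) ∧
    q.1 = (2 * (j : ℝ) + 1 + (if (w.get i).2 = (w.get j).2 then t else 1 - t), 1)

/-- The disk with disjoint boundary arcs identified in pairs according to `w`, with the quotient
topology. -/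
def ArcSurface (w : List (ℕ × Bool)) : Type :=
  Quot (ArcGlue w)

instance (w : List (ℕ × Bool)) : TopologicalSpace (ArcSurface w) :=
  inferInstanceAs (TopologicalSpace (Quot (ArcGlue w)))

/-- The word `∏ [aⱼ, bⱼ] ∏ cₖ cₖ⁻¹` (`true`) or `∏ aⱼ² ∏ cₖ cₖ⁻¹` (`false`), with `j < g` and
`k < m - 1`. A factor `[a, b]` is a handle, `a²` is a crosscap, and `c c⁻¹` is a further hole. -/
def surfaceWord : Bool → ℕ → ℕ → List (ℕ × Bool)
  | true, g, m =>
      (List.range g).flatMap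
        (fun j => [(2 * j, true), (2 * j + 1, true), (2 * j, false), (2 * j + 1, false)]) ++
      (List.range (m - 1)).flatMap (fun k => [(2 * g + k, true), (2 * g + k, false)])
  | false, g, m =>
      (List.range g).flatMap (fun j => [(j, true), (j, true)]) ++
      (List.range (m - 1)).flatMap (fun k => [(g + k, true), (g + k, false)])

/-- For `m ≥ 1`: the sphere with `g` handles (`orientable = true`) or `g` crosscaps
(`orientable = false`), and with `m` open disks removed. -/
def StandardSurface (orientable : Bool) (g m : ℕ) : Type :=
  ArcSurface (surfaceWord orientable g m)

instance (o : Bool) (g m : ℕ) : TopologicalSpace (StandardSurface o g m) :=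
  inferInstanceAs (TopologicalSpace (ArcSurface (surfaceWord o g m)))

/-- The boundary of a surface: the points without a Euclidean neighbourhood. -/
def surfaceBoundary (X : Type*) [TopologicalSpace X] : Set X :=
  {x | ¬ ∃ e : OpenPartialHomeomorph X ℂ, x ∈ e.source}

/-- The boundary components of a surface. -/
def boundaryComponents (X : Type*) [TopologicalSpace X] : Set (Set X) :=
  {γ | ∃ x ∈ surfaceBoundary X, γ = connectedComponentIn (surfaceBoundary X) x}

/-! ### Orbifolds and their coverings -/

/-- A compact connected 2-orbifold with nonempty boundary: a compact connected surface with
nonempty boundary (a sphere with handles or crosscaps, and with at least one hole), with finitely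
many interior cone points. The order of a point is `1` unless the point is a cone point. -/
structure BorderedOrbifold where
  carrier : Type u
  [top : TopologicalSpace carrier]
  exists_homeo : ∃ (orientable : Bool) (g m : ℕ), 0 < m ∧
    Nonempty (carrier ≃ₜ StandardSurface orientable g m)
  order : carrier → ℕ
  order_pos : ∀ x, 0 < order x
  finite_cone : {x | 1 < order x}.Finite
  order_boundary : ∀ x ∈ surfaceBoundary carrier, order x = 1

attribute [instance] BorderedOrbifold.top

namespace BorderedOrbifold

/-- The underlying surface is a disk. -/
def IsDisk (S : BorderedOrbifold.{u}) : Prop :=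
  Nonempty (S.carrier ≃ₜ Metric.closedBall (0 : ℂ) 1)

/-- The underlying surface is an annulus, that is, a sphere with two holes. -/
def IsAnnulus (S : BorderedOrbifold.{u}) : Prop :=
  Nonempty (S.carrier ≃ₜ StandardSurface true 0 2)

/-- An orbifold covering of `S` with `n` sheets, not necessarily connected, by a compact
2-orbifold. Over the points of order `1` it is a covering of spaces. At a point `y` over a cone
point of order `k`, it is `z ↦ z ^ d` in suitable local coordinates, where `y` has order `k / d`;
that is, it is the quotient map from the quotient of a disk by the rotation group of order `k / d`
to the quotient by the rotation group of order `k`. The sheets are counted with the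
multiplicities `d`. -/
structure Covering (S : BorderedOrbifold.{u}) (n : ℕ) where
  total : Type u
  [top : TopologicalSpace total]
  [t2 : T2Space total]
  [compact : CompactSpace total]
  order : total → ℕ
  proj : total → S.carrier
  continuous_proj : Continuous proj
  order_dvd : ∀ y, order y ∣ S.order (proj y)
  isCoveringMapOn : IsCoveringMapOn proj {x | S.order x = 1}
  local_model : ∀ y, 1 < S.order (proj y) →
    ∃ (e : OpenPartialHomeomorph total ℂ) (e' : OpenPartialHomeomorph S.carrier ℂ),
      y ∈ e.source ∧ MapsTo proj e.source e'.source ∧ e y = 0 ∧ e' (proj y) = 0 ∧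
      ∀ z ∈ e.source, e' (proj z) = e z ^ (S.order (proj y) / order y)
  finite_fiber : ∀ x, (proj ⁻¹' {x}).Finite
  sheets : ∀ x, ∑ᶠ y ∈ proj ⁻¹' {x}, S.order x / order y = n

attribute [instance] Covering.top Covering.t2 Covering.compact

end BorderedOrbifold

/-- `f` maps `A` into `B`, and its restriction `A → B` is a covering map with two sheets. -/
def IsDoubleCoverOn {Y X : Type*} [TopologicalSpace Y] [TopologicalSpace X] (f : Y → X)
    (A : Set Y) (B : Set X) : Prop :=
  ∃ h : MapsTo f A B, IsCoveringMap h.restrict ∧ ∀ b : B, Nat.card (h.restrict ⁻¹' {b}) = 2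

/-! A continuous nowhere vanishing function defines a double cover by its square roots. This cover
is trivial over a set on which the function has a continuous root, and over a preconnected set
without such a root it is preconnected (`isPreconnected_rootCover`). The four-sheeted cover is a
tower of two such covers: the roots `z` of a function `F` on the surface, then the roots of a
function `h` of the pairs `(x, z)`. The tower is unbranched and the orders of points are pulled
back, so the cone points play no further role (`exists_covering_four`).

Over a boundary component `γ` the preimage consists of two double covers if exactly one storey is
nontrivial there: either `F` has no root on `γ` and `h` has one on the double cover of `γ`, or `F`
has a root on `γ` and `h` has none on either of the two lifts. This is `SplitsOver`, and
`exists_boundaryComponents_of_splitsOver` draws the conclusion. The total space is connected if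
neither storey has a global root.

On the glued rectangle, suitable functions are built from `gapExp`, which turns once along chosen
segments (gaps) between consecutive arcs of the upper side. It is `1` on all arcs and therefore
descends to the surface. A turn in the gap of a small hole is seen by that hole, and by the outer
boundary curve along the bottom side, so on the outer curve only the parity of the number of such
gaps matters. Let there be `M + 1` boundary components.

If `M ≥ 2`, then `F` turns around hole `0` and `h` around an even number of holes, including all the
others. If `M = 1`, then `F` turns around both boundary curves; `h` is `1` for the annulus and
otherwise turns in a handle or crosscap. If `M = 0`, then `F` turns in the first handle or crosscap
and has a root on the boundary curve, and `h` has to be nontrivial on both lifts. For a crosscap `h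
= z` works: the tower adjoins a fourth root, and the square of a generator of the cyclic group of
order four is a fixed-point-free involution. For a handle no abelian monodromy can work, since the
boundary is a product of commutators; `handleTwist` turns on one sheet of the first cover only,
which makes the monodromy dihedral of order eight, where a commutator can be the central involution.

The boundary of the model has to be found first, because it is defined by the absence of charts. A
chart coordinate that vanishes at a point has no root on a punctured neighbourhood, whereas a root
exists near a point of an unglued edge (`surfacePt_mem_surfaceBoundary`). The components are then
found by following the gluing along the boundary (`eq_of_chain`) and separated by bump functions. -/

/-! ### Square roots and root covers -/

/-- The function `k` has a continuous square root on `B`. -/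
def HasRootOn {Y : Type*} [TopologicalSpace Y] (B : Set Y) (k : Y → ℂ) : Prop :=
  ∃ r : Y → ℂ, ContinuousOn r B ∧ ∀ b ∈ B, r b ^ 2 = k b

/-- The square roots of the values of `k` on `B`. -/
def rootCover {Y : Type*} (B : Set Y) (k : Y → ℂ) : Set (Y × ℂ) :=
  {p | p.1 ∈ B ∧ p.2 ^ 2 = k p.1}

section RootCover

theorem eq_or_eq_neg_of_mem_rootCover {Y : Type*} {B : Set Y} {k : Y → ℂ} {b : Y} {z z' : ℂ}
    (h : (b, z) ∈ rootCover B k)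
    (h' : (b, z') ∈ rootCover B k) : z = z' ∨ z = -z' :=
  sq_eq_sq_iff_eq_or_eq_neg.1 (h.2.trans h'.2.symm)

variable {Y : Type*} [TopologicalSpace Y] {B : Set Y} {k : Y → ℂ}

theorem HasRootOn.mono {A : Set Y} (h : HasRootOn B k) (hA : A ⊆ B) : HasRootOn A k :=
  h.imp fun _ hr => ⟨hr.1.mono hA, fun b hb => hr.2 b (hA hb)⟩

/-- Near `b₀` the quotient `k b / k b₀` stays in the slit plane, where the principal logarithm is
continuous; half of the logarithm gives the root. -/
theorem exists_local_root (hk : ContinuousOn k B) {b₀ : Y} (hb₀ : b₀ ∈ B) (h0 : k b₀ ≠ 0)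
    {z₀ : ℂ} (hz₀ : z₀ ^ 2 = k b₀) :
    ∃ (r : Y → ℂ) (U : Set Y), IsOpen U ∧ b₀ ∈ U ∧ ContinuousOn r (B ∩ U) ∧ r b₀ = z₀ ∧
      ∀ b ∈ B ∩ U, r b ^ 2 = k b ∧ r b ≠ 0 := by
  have hq : ContinuousOn (fun b => k b / k b₀) B := hk.div_const _
  obtain ⟨U, hU, hUB⟩ := (continuousOn_iff'.1 hq) Complex.slitPlane Complex.isOpen_slitPlane
  have key : ∀ b, b ∈ B → b ∈ U → k b / k b₀ ∈ Complex.slitPlane := fun b hb hbU =>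
    ((Set.ext_iff.1 hUB b).2 ⟨hbU, hb⟩).1
  have hz0 : z₀ ≠ 0 := by rintro rfl; simp at hz₀; exact h0 hz₀.symm
  refine ⟨fun b => z₀ * Complex.exp (Complex.log (k b / k b₀) / 2), U, hU, ?_, ?_, ?_, ?_⟩
  · refine ((Set.ext_iff.1 hUB b₀).1 ⟨?_, hb₀⟩).1
    simp [div_self h0]
  · refine continuousOn_const.mul (Complex.continuous_exp.comp_continuousOn
      (ContinuousOn.div_const (ContinuousOn.clog (hq.mono inter_subset_left) ?_) _))
    exact fun b hb => key b hb.1 hb.2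
  · simp [div_self h0]
  · intro b hb
    have hs := key b hb.1 hb.2
    refine ⟨?_, mul_ne_zero hz0 (Complex.exp_ne_zero _)⟩
    rw [mul_pow, ← Complex.exp_nat_mul, hz₀]
    have : ((2 : ℕ) : ℂ) * (Complex.log (k b / k b₀) / 2) = Complex.log (k b / k b₀) := by
      push_cast; ring
    rw [this, Complex.exp_log (Complex.slitPlane_ne_zero hs)]
    field_simp

/-- A clopen set `s` of roots contains none, one or both points of each fibre `{z, -z}`, and this
number is locally constant, hence constant. If it is one, the selected root is a continuous root of
`k`, against `hn`; otherwise `s` is empty or everything. -/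
theorem isPreconnected_rootCover (hB : IsPreconnected B) (hk : ContinuousOn k B)
    (h0 : ∀ b ∈ B, k b ≠ 0) (hn : ¬ HasRootOn B k) : IsPreconnected (rootCover B k) := by
  rw [isPreconnected_iff_preconnectedSpace, preconnectedSpace_iff_clopen]
  intro s hs
  have : PreconnectedSpace B := isPreconnected_iff_preconnectedSpace.1 hB
  set P : Y → ℂ → Prop := fun b z => ∃ h : (b, z) ∈ rootCover B k, ⟨(b, z), h⟩ ∈ s with hP
  -- A local root through `z₀` stays in `s` or stays outside `s`, since both `s` and its complement
  -- are open.
  have loc : ∀ b₀ ∈ B, ∀ z₀, z₀ ^ 2 = k b₀ → ∃ r : Y → ℂ, ContinuousWithinAt r B b₀ ∧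
      r b₀ = z₀ ∧ ∀ᶠ b in 𝓝[B] b₀, (b, r b) ∈ rootCover B k ∧ (P b (r b) ↔ P b₀ z₀) := by
    intro b₀ hb₀ z₀ hz₀
    obtain ⟨r, U, hU, hbU, hrc, hr0, hr⟩ := exists_local_root hk hb₀ (h0 _ hb₀) hz₀
    have hUn : U ∈ 𝓝 b₀ := hU.mem_nhds hbU
    have hrc' : ContinuousWithinAt r B b₀ :=
      (continuousWithinAt_inter hUn).1 (hrc b₀ ⟨hb₀, hbU⟩)
    refine ⟨r, hrc', hr0, ?_⟩
    have hpair : Filter.Tendsto (fun b => (b, r b)) (𝓝[B] b₀) (𝓝 (b₀, z₀)) := by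
      rw [← hr0]; exact (continuousWithinAt_id.prodMk hrc')
    have hmem : ∀ᶠ b in 𝓝[B] b₀, (b, r b) ∈ rootCover B k := by
      filter_upwards [self_mem_nhdsWithin, mem_nhdsWithin_of_mem_nhds hUn] with b hb hb'
      exact ⟨hb, (hr b ⟨hb, hb'⟩).1⟩
    obtain ⟨O, hO, hOs⟩ := isOpen_induced_iff.1 hs.2
    obtain ⟨O', hO', hOs'⟩ := isOpen_induced_iff.1 hs.1.isOpen_compl
    have h00 : (b₀, z₀) ∈ rootCover B k := ⟨hb₀, hz₀⟩
    by_cases hin : (⟨(b₀, z₀), h00⟩ : rootCover B k) ∈ s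
    · have : (b₀, z₀) ∈ O := by rw [← hOs] at hin; exact hin
      filter_upwards [hmem, hpair.eventually (hO.mem_nhds this)] with b hb hbO
      refine ⟨hb, iff_of_true ⟨hb, ?_⟩ ⟨h00, hin⟩⟩
      rw [← hOs]; exact hbO
    · have : (b₀, z₀) ∈ O' := by
        have h' : (⟨(b₀, z₀), h00⟩ : rootCover B k) ∈ sᶜ := hin
        rw [← hOs'] at h'; exact h'
      filter_upwards [hmem, hpair.eventually (hO'.mem_nhds this)] with b hb hbO
      refine ⟨hb, iff_of_false ?_ fun h => hin h.2⟩
      rintro ⟨h, hs'⟩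
      have h' : (⟨(b, r b), h⟩ : rootCover B k) ∈ sᶜ := by rw [← hOs']; exact hbO
      exact h' hs'
  have ex : ∀ b ∈ B, ∃ z, z ^ 2 = k b := fun b _ => IsSquare.exists_sq (k b) (by
    obtain ⟨z, hz⟩ := IsAlgClosed.exists_pow_nat_eq (k b) (n := 2) (by norm_num)
    exact ⟨z, by rw [← hz, sq]⟩) |>.imp fun _ h => h.symm
  have neg : ∀ {b z}, (b, z) ∈ rootCover B k → (b, -z) ∈ rootCover B k := fun h =>
    ⟨h.1, by simpa using h.2⟩
  -- both a function of the fibre and its value at a root are locally constant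
  have locF : ∀ Q : Prop → Prop → Prop, (∀ p q, Q p q ↔ Q q p) →
      IsLocallyConstant fun b : B => ∃ z, (b.1, z) ∈ rootCover B k ∧ Q (P b z) (P b (-z)) := by
    intro Q hQ
    have val : ∀ b z, (b, z) ∈ rootCover B k →
        ((∃ z, (b, z) ∈ rootCover B k ∧ Q (P b z) (P b (-z))) ↔ Q (P b z) (P b (-z))) := by
      intro b z hz
      refine ⟨?_, fun h => ⟨z, hz, h⟩⟩
      rintro ⟨z', hz', h⟩
      rcases eq_or_eq_neg_of_mem_rootCover hz' hz with rfl | rfl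
      · exact h
      · rw [neg_neg] at h; exact (hQ _ _).1 h
    refine (IsLocallyConstant.iff_eventually_eq _).2 fun b₀ => ?_
    obtain ⟨z₀, hz₀⟩ := ex b₀ b₀.2
    obtain ⟨r', hrc', hr0', hr'⟩ := loc b₀ b₀.2 (-z₀) (by simpa using hz₀)
    obtain ⟨r, hrc, hr0, hr⟩ := loc b₀ b₀.2 z₀ hz₀
    have hz0 : z₀ ≠ 0 := by rintro rfl; simp at hz₀; exact h0 _ b₀.2 hz₀.symm
    have hne : ∀ᶠ b in 𝓝[B] b₀.1, r b ≠ r' b := by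
      refine (hrc.tendsto.prodMk_nhds hrc'.tendsto).eventually
        (p := fun q : ℂ × ℂ => q.1 ≠ q.2) ?_
      refine (isOpen_ne_fun continuous_fst continuous_snd).mem_nhds ?_
      simp only [mem_ofPred_eq, hr0, hr0']
      exact fun h => hz0 (self_eq_neg.1 h)
    have := (hr.and (hr'.and hne))
    rw [nhdsWithin_eq_map_subtype_coe b₀.2, Filter.eventually_map] at this
    filter_upwards [this] with b ⟨h1, h2, h3⟩
    have hrn : r' b = - r b := by
      rcases eq_or_eq_neg_of_mem_rootCover h2.1 h1.1 with h | h
      · exact absurd h.symm h3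
      · exact h
    rw [hrn] at h2
    apply propext
    rw [val _ _ h1.1, val _ z₀ ⟨b₀.2, hz₀⟩, propext h1.2, propext h2.2]
  by_cases hne : Nonempty B
  swap
  · left
    ext ⟨⟨b, z⟩, h⟩
    exact (hne ⟨⟨b, h.1⟩⟩).elim
  -- A symmetric `Q` does not depend on which root of the fibre comes first. It is used for "exactly
  -- one root lies in `s`" and then for "both roots lie in `s`".
  have dich : ∀ Q : Prop → Prop → Prop, (∀ p q, Q p q ↔ Q q p) →
      (∀ b z, (b, z) ∈ rootCover B k → Q (P b z) (P b (-z))) ∨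
      (∀ b z, (b, z) ∈ rootCover B k → ¬ Q (P b z) (P b (-z))) := by
    intro Q hQ
    obtain ⟨b₀⟩ := hne
    by_cases h : ∃ z, (b₀.1, z) ∈ rootCover B k ∧ Q (P b₀ z) (P b₀ (-z))
    · left
      intro b z hz
      have := (locF Q hQ).apply_eq_of_preconnectedSpace b₀ ⟨b, hz.1⟩
      obtain ⟨z', hz', h'⟩ := this.mp h
      rcases eq_or_eq_neg_of_mem_rootCover hz' hz with rfl | rfl
      · exact h'
      · rw [neg_neg] at h'; exact (hQ _ _).1 h'
    · right
      intro b z hz h'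
      exact h (((locF Q hQ).apply_eq_of_preconnectedSpace b₀ ⟨b, hz.1⟩).mpr ⟨z, hz, h'⟩)
  have hPs : ∀ b z (h : (b, z) ∈ rootCover B k), P b z ↔ ⟨(b, z), h⟩ ∈ s :=
    fun b z h => ⟨fun h' => h'.2, fun h' => ⟨h, h'⟩⟩
  rcases dich (fun p q => ¬ (p ↔ q)) (by tauto) with h | h
  · exfalso
    apply hn
    have : ∀ b : B, ∃ z, P b z := by
      intro b
      obtain ⟨z, hz⟩ := ex b b.2
      have := h b z ⟨b.2, hz⟩
      by_cases h1 : P b z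
      · exact ⟨_, h1⟩
      · exact ⟨-z, by tauto⟩
    choose z hz using this
    classical
    refine ⟨fun b => if hb : b ∈ B then z ⟨b, hb⟩ else 0, ?_, ?_⟩
    · intro b₀ hb₀
      obtain ⟨r, hrc, hr0, hr⟩ := loc b₀ hb₀ (z ⟨b₀, hb₀⟩) (hz ⟨b₀, hb₀⟩).1.2
      refine hrc.congr_of_eventuallyEq ?_ ?_
      · filter_upwards [hr, self_mem_nhdsWithin] with b h1 hb
        simp only [hb, dif_pos]
        have h2 : P b (r b) := h1.2.2 (hz ⟨b₀, hb₀⟩)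
        have h3 : P b (z ⟨b, hb⟩) := hz ⟨b, hb⟩
        rcases eq_or_eq_neg_of_mem_rootCover h3.1 h1.1 with h4 | h4
        · exact h4
        · exfalso
          rw [h4] at h3
          exact h b _ h1.1 (iff_of_true h2 h3)
      · simp only [hb₀, dif_pos, hr0]
    · intro b hb
      simp only [hb, dif_pos]
      exact (hz ⟨b, hb⟩).1.2
  rcases dich (fun p q => p ∧ q) (by tauto) with h' | h'
  · right
    ext ⟨⟨b, z⟩, hz⟩
    simpa using (hPs b z hz).1 (h' b z hz).1
  · left
    ext ⟨⟨b, z⟩, hz⟩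
    simp only [mem_empty_iff_false, iff_false, ← hPs b z hz]
    have h1 := h b z hz
    have h2 := h' b z hz
    tauto

end RootCover

/-! ### Coverings from local sections -/

/-- The index of the section through `e` is locally constant: each of its finitely many level sets
is the coincidence set of `s i ∘ f` and the identity, which is closed because `E` is Hausdorff. -/
theorem isCoveringMap_of_sections {E X ι : Type*} [TopologicalSpace E] [TopologicalSpace X]
    [T2Space E] [Finite ι] {f : E → X} (hf : Continuous f)
    (h : ∀ x, ∃ U : Set X, IsOpen U ∧ x ∈ U ∧ ∃ s : ι → U → E, (∀ i, Continuous (s i)) ∧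
      (∀ i b, f (s i b) = b) ∧ (∀ b i j, s i b = s j b → i = j) ∧
      ∀ e (he : f e ∈ U), ∃ i, s i ⟨f e, he⟩ = e) :
    IsCoveringMap f ∧ ∀ x, Nat.card (f ⁻¹' {x}) = Nat.card ι := by
  let _ : TopologicalSpace ι := ⊥
  have : DiscreteTopology ι := ⟨rfl⟩
  refine ⟨fun x => ?_, fun x => ?_⟩
  · obtain ⟨U, hU, hxU, s, hsc, hs, hinj, hsurj⟩ := h x
    choose idx hidx using hsurj
    refine IsEvenlyCovered.to_isEvenlyCovered_preimage (I := ι)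
      ⟨inferInstance, U, hxU, hU, hU.preimage hf, ?_⟩
    have hidxc : Continuous fun e : f ⁻¹' U => idx e.1 e.2 := by
      have hcl : ∀ i, IsClosed ((fun e : f ⁻¹' U => idx e.1 e.2) ⁻¹' {i}) := by
        intro i
        have : (fun e : f ⁻¹' U => idx e.1 e.2) ⁻¹' {i} =
            {e : f ⁻¹' U | s i ⟨f e.1, e.2⟩ = e.1} := by
          ext e
          constructor
          · intro he
            have he' : idx e.1 e.2 = i := he
            have := hidx e.1 e.2
            rwa [he'] at this
          · intro he
            exact hinj _ _ _ ((hidx e.1 e.2).trans he.symm)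
        rw [this]
        exact isClosed_eq ((hsc i).comp (by fun_prop)) continuous_subtype_val
      have hcl' : ∀ A : Set ι, IsClosed ((fun e : f ⁻¹' U => idx e.1 e.2) ⁻¹' A) := by
        intro A
        have : (fun e : f ⁻¹' U => idx e.1 e.2) ⁻¹' A =
            ⋃ i ∈ A, (fun e : f ⁻¹' U => idx e.1 e.2) ⁻¹' {i} := by ext; simp
        rw [this]
        exact (Set.toFinite A).isClosed_biUnion fun i _ => hcl i
      exact continuous_iff_isClosed.2 fun A _ => hcl' A
    refine ⟨{ toFun := fun e => (⟨f e.1, e.2⟩, idx e.1 e.2)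
              invFun := fun p => ⟨s p.2 p.1, by
                rw [mem_preimage, hs]; exact p.1.2⟩
              left_inv := fun e => Subtype.ext (hidx e.1 e.2)
              right_inv := ?_
              continuous_toFun := ?_
              continuous_invFun := ?_ }, fun e => rfl⟩
    · rintro ⟨b, i⟩
      have hb : (⟨f (s i b), by rw [hs]; exact b.2⟩ : U) = b := Subtype.ext (hs i b)
      refine Prod.ext hb ?_
      refine hinj b _ _ ?_
      have := hidx (s i b) (by rw [hs]; exact b.2)
      rwa [hb] at this
    · exact ((hf.comp continuous_subtype_val).subtype_mk _).prodMk hidxc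
    · refine Continuous.subtype_mk ?_ _
      exact continuous_prod_of_discrete_right.2 hsc
  · obtain ⟨U, hU, hxU, s, hsc, hs, hinj, hsurj⟩ := h x
    refine (Nat.card_eq_of_bijective (fun i : ι => (⟨s i ⟨x, hxU⟩, hs i _⟩ : f ⁻¹' {x}))
      ⟨fun i j hij => hinj _ _ _ (Subtype.ext_iff.1 hij), ?_⟩).symm
    rintro ⟨e, rfl⟩
    obtain ⟨i, hi⟩ := hsurj e hxU
    exact ⟨i, Subtype.ext hi⟩

/-- The two local roots of `k`, carried over by `j`, are local sections of `range j → γ`. In the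
applications `range j` is one half of the preimage of `γ` in the tower. -/
theorem isPreconnected_and_isDoubleCoverOn_range {E X : Type*} [TopologicalSpace E]
    [TopologicalSpace X] [T2Space E] {f : E → X} (hf : Continuous f) {γ : Set X} {k : X → ℂ}
    (hγ : IsPreconnected γ) (hk : ContinuousOn k γ) (h0 : ∀ x ∈ γ, k x ≠ 0)
    (hn : ¬ HasRootOn γ k) {j : rootCover γ k → E} (hj : Continuous j)
    (hinj : Function.Injective j) (hfj : ∀ p, f (j p) = p.1.1) :
    IsPreconnected (range j) ∧ IsDoubleCoverOn f (range j) γ := by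
  have hc : PreconnectedSpace (rootCover γ k) :=
    isPreconnected_iff_preconnectedSpace.1 (isPreconnected_rootCover hγ hk h0 hn)
  refine ⟨isPreconnected_range hj, ?_⟩
  have hm : MapsTo f (range j) γ := by
    rintro _ ⟨p, rfl⟩
    rw [hfj]; exact p.2.1
  refine ⟨hm, ?_⟩
  have := isCoveringMap_of_sections (ι := Bool) (f := hm.restrict) (hf.continuousOn.mapsToRestrict hm) ?_
  · simpa using this
  rintro ⟨x, hx⟩
  obtain ⟨z, hz⟩ := IsAlgClosed.exists_pow_nat_eq (k x) (n := 2) (by norm_num)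
  obtain ⟨r, U, hU, hxU, hrc, -, hr⟩ := exists_local_root hk hx (h0 x hx) hz
  have hmem : ∀ b : ((↑) : γ → X) ⁻¹' U, ∀ i : Bool,
      ((b.1.1, if i then r b.1.1 else - r b.1.1) : X × ℂ) ∈ rootCover γ k := fun b i =>
    ⟨b.1.2, by cases i <;> simpa using (hr b.1.1 ⟨b.1.2, b.2⟩).1⟩
  refine ⟨((↑) : γ → X) ⁻¹' U, hU.preimage continuous_subtype_val, hxU,
    fun i b => ⟨j ⟨_, hmem b i⟩, mem_range_self _⟩, ?_, ?_, ?_, ?_⟩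
  · intro i
    refine Continuous.subtype_mk (hj.comp (Continuous.subtype_mk ?_ _)) _
    have : Continuous fun b : ((↑) : γ → X) ⁻¹' U => r b.1.1 :=
      hrc.comp_continuous (by fun_prop) fun b => ⟨b.1.2, b.2⟩
    cases i
    · simpa using (continuous_subtype_val.comp continuous_subtype_val).prodMk this.neg
    · simpa using (continuous_subtype_val.comp continuous_subtype_val).prodMk this
  · intro i b
    apply Subtype.ext
    exact hfj _
  · intro b i i' h
    have h1 := hinj (Subtype.ext_iff.1 h)
    have h2 : (if i then r b.1.1 else - r b.1.1) = if i' then r b.1.1 else - r b.1.1 :=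
      congrArg (fun q => q.1.2) h1
    have h3 := (hr b.1.1 ⟨b.1.2, b.2⟩).2
    cases i <;> cases i' <;> simp_all [self_eq_neg, neg_eq_self]
  · rintro ⟨_, ⟨p, rfl⟩⟩ he
    have hpU : p.1.1 ∈ U := by
      have : f (j p) ∈ U := he
      rwa [hfj] at this
    have hp1 := hr p.1.1 ⟨p.2.1, hpU⟩
    rcases eq_or_eq_neg_of_mem_rootCover (b := p.1.1) (z := p.1.2) (z' := r p.1.1) p.2
      ⟨p.2.1, hp1.1⟩ with h | h
    · refine ⟨true, Subtype.ext (congrArg j (Subtype.ext (Prod.ext (hfj p) ?_)))⟩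
      change r (f (j p)) = _
      rw [hfj, ← h]
    · refine ⟨false, Subtype.ext (congrArg j (Subtype.ext (Prod.ext (hfj p) ?_)))⟩
      change - r (f (j p)) = _
      rw [hfj, ← h]

/-! ### The boundary and local homeomorphisms -/

section Boundary

variable {X Y : Type*} [TopologicalSpace X] [TopologicalSpace Y]

theorem IsLocalHomeomorph.mem_surfaceBoundary_iff {f : Y → X} (hf : IsLocalHomeomorph f) {y : Y} :
    f y ∈ surfaceBoundary X ↔ y ∈ surfaceBoundary Y := by
  obtain ⟨φ, hy, rfl⟩ := hf y
  refine not_congr ⟨?_, ?_⟩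
  · rintro ⟨e, he⟩
    exact ⟨φ.trans e, by simpa using ⟨hy, he⟩⟩
  · rintro ⟨e, he⟩
    exact ⟨φ.symm.trans e, by simpa [hy] using he⟩

/-- The boundary component through a point of `A` projects into `γ`, so `g` takes only the values
`1` and `-1` on it; being connected it cannot pass from `A` to `A'`. -/
theorem IsLocalHomeomorph.mem_boundaryComponents {f : Y → X} (hf : IsLocalHomeomorph f)
    {γ : Set X} (hγ : γ ∈ boundaryComponents X) {A A' : Set Y} (hA : IsPreconnected A)
    (hne : A.Nonempty) (hU : f ⁻¹' γ = A ∪ A') {g : Y → ℂ} (hg : ContinuousOn g (f ⁻¹' γ))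
    (h1 : ∀ y ∈ A, g y = 1) (h2 : ∀ y ∈ A', g y = -1) : A ∈ boundaryComponents Y := by
  obtain ⟨x, hx, rfl⟩ := hγ
  obtain ⟨y, hy⟩ := hne
  have hsub : connectedComponentIn (surfaceBoundary X) x ⊆ surfaceBoundary X :=
    connectedComponentIn_subset _ _
  have hyf : f y ∈ connectedComponentIn (surfaceBoundary X) x := by
    rw [← mem_preimage, hU]; exact Or.inl hy
  have hAb : A ⊆ surfaceBoundary Y := fun a ha => by
    rw [← hf.mem_surfaceBoundary_iff]
    apply hsub
    rw [← mem_preimage, hU]; exact Or.inl ha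
  refine ⟨y, hAb hy, Subset.antisymm (hA.subset_connectedComponentIn hy hAb) ?_⟩
  set C := connectedComponentIn (surfaceBoundary Y) y with hC
  have hyC : y ∈ C := mem_connectedComponentIn (hAb hy)
  have hCf : C ⊆ f ⁻¹' connectedComponentIn (surfaceBoundary X) x := by
    rw [← image_subset_iff, connectedComponentIn_eq hyf]
    refine (isPreconnected_connectedComponentIn.image _ hf.continuous.continuousOn)
      |>.subset_connectedComponentIn (mem_image_of_mem _ hyC) ?_
    rintro _ ⟨c, hc, rfl⟩
    exact hf.mem_surfaceBoundary_iff.2 (connectedComponentIn_subset _ _ hc)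
  obtain ⟨v, -, hv⟩ := isPreconnected_connectedComponentIn.eqOn_const_of_mapsTo
    (T := ({1, -1} : Set ℂ)) (Set.toFinite _).isDiscrete (hg.mono hCf) (fun c hc => by
      have : c ∈ A ∪ A' := hU ▸ hCf hc
      rcases this with h | h
      · simp [h1 c h]
      · simp [h2 c h]) ⟨1, by simp⟩
  have hv1 : v = 1 := (hv hyC).symm.trans (h1 y hy)
  intro c hc
  have : c ∈ A ∪ A' := hU ▸ hCf hc
  rcases this with h | h
  · exact h
  · have h3 := (hv hc).symm.trans (h2 c h)
    norm_num [hv1] at h3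

end Boundary

theorem isCompact_rootCover {Y : Type*} [TopologicalSpace Y] [T2Space Y] {B : Set Y}
    (hB : IsCompact B) {k : Y → ℂ} (hk : Continuous k) : IsCompact (rootCover B k) := by
  obtain ⟨R, hR⟩ := hB.exists_bound_of_continuousOn hk.continuousOn
  have hcl : IsClosed {p : Y × ℂ | p.2 ^ 2 = k p.1} := isClosed_eq (by fun_prop) (by fun_prop)
  -- From `‖z‖ ^ 2 ≤ R` follows `‖z‖ ≤ R + 1`, whether or not `‖z‖` exceeds `1`.
  refine ((hB.prod (isCompact_closedBall (0 : ℂ) (R + 1))).inter_right hcl).of_isClosed_subset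
    ((hB.isClosed.preimage continuous_fst).inter hcl) ?_
  rintro ⟨y, z⟩ ⟨hy, hz⟩
  refine ⟨⟨hy, ?_⟩, hz⟩
  have h1 := hR y hy
  dsimp only at hy hz
  rw [← hz, norm_pow] at h1
  simp only [mem_closedBall_iff_norm, sub_zero]
  nlinarith [norm_nonneg z]

/-! ### Iterated double covers -/

section IteratedCover

variable {X : Type*} [TopologicalSpace X] {F : X → ℂ} {h : X × ℂ → ℂ}

/-- The double cover by the roots of `h` of the double cover of `X` by the roots of `F`. -/
abbrev IteratedCover (F : X → ℂ) (h : X × ℂ → ℂ) : Type _ :=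
  ↥(rootCover (rootCover univ F) h)

/-- The projection of the iterated double cover. -/
def iteratedProj (F : X → ℂ) (h : X × ℂ → ℂ) (y : IteratedCover F h) : X := y.1.1.1

theorem continuous_iteratedProj : Continuous (iteratedProj F h) :=
  continuous_fst.comp (continuous_fst.comp continuous_subtype_val)

/-- The sign `1` or `-1`. -/
def boolSign (b : Bool) : ℂ := if b then 1 else -1

@[simp] theorem boolSign_sq (b : Bool) : boolSign b ^ 2 = 1 := by cases b <;> simp [boolSign]

theorem boolSign_ne_zero (b : Bool) : boolSign b ≠ 0 := by cases b <;> simp [boolSign]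

theorem boolSign_injective : Function.Injective boolSign := by
  intro a b h
  cases a <;> cases b <;> simp_all [boolSign, self_eq_neg, neg_eq_self]

theorem exists_boolSign_mul {z w : ℂ} (h : z ^ 2 = w ^ 2) : ∃ b, boolSign b * w = z := by
  rcases sq_eq_sq_iff_eq_or_eq_neg.1 h with h | h
  · exact ⟨true, by simp [boolSign, h]⟩
  · exact ⟨false, by simp [boolSign, h]⟩

/-- The four local sections come from the two signs of a root `r` of `F` and the two signs of a root
`R a` of `h` on the sheet `boolSign a * r`; the second root has to be chosen for each sheet
separately. -/
theorem isCoveringMap_iteratedProj [T2Space X] (hF : Continuous F) (hF0 : ∀ x, F x ≠ 0)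
    (hh : Continuous h) (hh0 : ∀ p ∈ rootCover univ F, h p ≠ 0) :
    IsCoveringMap (iteratedProj F h) ∧
      ∀ x, Nat.card (iteratedProj F h ⁻¹' {x}) = 4 := by
  have := isCoveringMap_of_sections (ι := Bool × Bool) (continuous_iteratedProj (F := F) (h := h)) ?_
  · simpa using this
  intro x
  obtain ⟨z, hz⟩ := IsAlgClosed.exists_pow_nat_eq (F x) (n := 2) (by norm_num)
  obtain ⟨r, U, hU, hxU, hrc, -, hr⟩ :=
    exists_local_root hF.continuousOn (mem_univ x) (hF0 x) hz
  rw [univ_inter] at hrc hr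
  have hmem : ∀ a, ∀ b ∈ U, (b, boolSign a * r b) ∈ rootCover univ F := fun a b hb =>
    ⟨mem_univ _, by simp [mul_pow, (hr b hb).1]⟩
  have : ∀ a : Bool, ∃ (R : X → ℂ) (V : Set X), IsOpen V ∧ x ∈ V ∧ ContinuousOn R (U ∩ V) ∧
      ∀ b ∈ U ∩ V, R b ^ 2 = h (b, boolSign a * r b) ∧ R b ≠ 0 := by
    intro a
    obtain ⟨w, hw⟩ := IsAlgClosed.exists_pow_nat_eq (h (x, boolSign a * r x)) (n := 2) (by norm_num)
    obtain ⟨R, V, hV, hxV, hRc, -, hR⟩ := exists_local_root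
      (k := fun b => h (b, boolSign a * r b)) (B := U) (b₀ := x)
      (hh.comp_continuousOn (continuousOn_id.prodMk (continuousOn_const.mul hrc))) hxU
      (hh0 _ (hmem a x hxU)) hw
    exact ⟨R, V, hV, hxV, hRc, hR⟩
  choose R V hV hxV hRc hR using this
  have hW : ∀ a, ∀ b ∈ U ∩ ⋂ a, V a, b ∈ U ∩ V a := fun a b hb =>
    ⟨hb.1, mem_iInter.1 hb.2 a⟩
  refine ⟨U ∩ ⋂ a, V a, hU.inter (isOpen_iInter_of_finite hV), ⟨hxU, mem_iInter.2 hxV⟩,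
    fun i b => ⟨((b.1, boolSign i.1 * r b.1), boolSign i.2 * R i.1 b.1),
      hmem _ _ b.2.1, ?_⟩, ?_, ?_, ?_, ?_⟩
  · simp [mul_pow, (hR i.1 b.1 (hW _ _ b.2)).1]
  · intro i
    refine Continuous.subtype_mk ((continuous_subtype_val.prodMk (continuous_const.mul ?_)).prodMk
      (continuous_const.mul ?_)) _
    · exact hrc.comp_continuous continuous_subtype_val fun b => b.2.1
    · exact (hRc i.1).comp_continuous continuous_subtype_val fun b => hW _ _ b.2
  · intro i b
    rfl
  · intro b i i' hii
    have h1 := congrArg (fun q : IteratedCover F h => q.1.1.2) hii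
    have h2 := congrArg (fun q : IteratedCover F h => q.1.2) hii
    dsimp only at h1 h2
    have h3 := boolSign_injective (mul_right_cancel₀ (hr b.1 b.2.1).2 h1)
    rw [h3] at h2
    exact Prod.ext h3 (boolSign_injective (mul_right_cancel₀ (hR i'.1 b.1 (hW _ _ b.2)).2 h2))
  · rintro ⟨⟨⟨b, z⟩, w⟩, hb1, hb2⟩ hb
    change b ∈ _ at hb
    have e1 := hb1.2
    dsimp only at hb1 hb2 e1
    obtain ⟨a, ha⟩ := exists_boolSign_mul (e1.trans (hr b hb.1).1.symm)
    subst ha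
    obtain ⟨a', ha'⟩ := exists_boolSign_mul (hb2.trans (hR a b (hW _ _ hb)).1.symm)
    subst ha'
    exact ⟨(a, a'), rfl⟩

theorem preconnectedSpace_iteratedCover [PreconnectedSpace X] (hF : Continuous F)
    (hF0 : ∀ x, F x ≠ 0) (hh : Continuous h) (hh0 : ∀ p ∈ rootCover univ F, h p ≠ 0)
    (hn : ¬ HasRootOn univ F) (hn' : ¬ HasRootOn (rootCover univ F) h) :
    PreconnectedSpace (IteratedCover F h) :=
  isPreconnected_iff_preconnectedSpace.1 <| isPreconnected_rootCover
    (isPreconnected_rootCover isPreconnected_univ hF.continuousOn (fun x _ => hF0 x) hn)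
    hh.continuousOn hh0 hn'

/-- The conditions on the functions `F` and `h` under which the preimage of `γ` in the iterated
double cover consists of two double covers of `γ`. -/
def SplitsOver (F : X → ℂ) (h : X × ℂ → ℂ) (γ : Set X) : Prop :=
  (¬ HasRootOn γ F ∧ HasRootOn (rootCover γ F) h) ∨
  ∃ u : X → ℂ, ContinuousOn u γ ∧ (∀ x ∈ γ, u x ^ 2 = F x) ∧
    ∀ b, ¬ HasRootOn γ fun x => h (x, boolSign b * u x)

/-- In the first case the halves of the preimage are `w = u` and `w = -u`, where `u` is the root of
`h` over the connected double cover of `γ`, and `w / u` separates them. In the second case they lie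
over the lifts `z = u` and `z = -u`, separated by `z / u`. -/
theorem exists_boundaryComponents_of_splitsOver [T2Space X] (hF : Continuous F)
    (hF0 : ∀ x, F x ≠ 0) (hh : Continuous h) (hh0 : ∀ p ∈ rootCover univ F, h p ≠ 0)
    {γ : Set X} (hγ : γ ∈ boundaryComponents X) (hs : SplitsOver F h γ) :
    ∃ γ₀ ∈ boundaryComponents (IteratedCover F h), ∃ γ₁ ∈ boundaryComponents (IteratedCover F h),
      γ₀ ≠ γ₁ ∧ iteratedProj F h ⁻¹' γ = γ₀ ∪ γ₁ ∧
      IsDoubleCoverOn (iteratedProj F h) γ₀ γ ∧ IsDoubleCoverOn (iteratedProj F h) γ₁ γ := by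
  have hloc := (isCoveringMap_iteratedProj hF hF0 hh hh0).1.isLocalHomeomorph
  have hpre : IsPreconnected γ := by
    obtain ⟨x, -, rfl⟩ := hγ
    exact isPreconnected_connectedComponentIn
  obtain ⟨x₀, hx₀⟩ : γ.Nonempty := by
    obtain ⟨x, hx, rfl⟩ := hγ
    exact ⟨x, mem_connectedComponentIn hx⟩
  suffices ∃ (A : Bool → Set (IteratedCover F h)) (g : IteratedCover F h → ℂ),
      (∀ b, IsPreconnected (A b) ∧ IsDoubleCoverOn (iteratedProj F h) (A b) γ) ∧
      (∀ b, (A b).Nonempty) ∧ iteratedProj F h ⁻¹' γ = A true ∪ A false ∧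
      ContinuousOn g (iteratedProj F h ⁻¹' γ) ∧ ∀ b, ∀ y ∈ A b, g y = boolSign b by
    obtain ⟨A, g, hA, hne, hU, hg, hgA⟩ := this
    refine ⟨A true, ?_, A false, ?_, ?_, hU, (hA _).2, (hA _).2⟩
    · exact hloc.mem_boundaryComponents hγ (hA _).1 (hne _) hU hg
        (fun y hy => by simpa [boolSign] using hgA _ y hy)
        (fun y hy => by simpa [boolSign] using hgA _ y hy)
    · exact hloc.mem_boundaryComponents hγ (hA _).1 (hne _) (hU.trans (union_comm _ _)) hg.neg
        (fun y hy => by simp [boolSign, hgA _ y hy])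
        (fun y hy => by simp [boolSign, hgA _ y hy])
    · intro he
      obtain ⟨y, hy⟩ := hne true
      have h1 := hgA _ y hy
      rw [he] at hy
      exact absurd (boolSign_injective (h1.symm.trans (hgA _ y hy))) (by simp)
  rcases hs with ⟨hn, u, hu, hu2⟩ | ⟨u, hu, hu2, hn⟩
  · have hsub : ∀ p, p ∈ rootCover γ F → p ∈ rootCover univ F := fun p hp => ⟨mem_univ _, hp.2⟩
    have hu0 : ∀ p ∈ rootCover γ F, u p ≠ 0 := by
      intro p hp h'
      have := hu2 p hp
      rw [h'] at this
      exact hh0 p (hsub p hp) (by rw [← this]; simp)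
    let j : Bool → rootCover γ F → IteratedCover F h := fun b p =>
      ⟨(p.1, boolSign b * u p.1), hsub _ p.2, by simp [mul_pow, hu2 p.1 p.2]⟩
    have hfib : ∀ y : IteratedCover F h, iteratedProj F h y ∈ γ → y.1.1 ∈ rootCover γ F :=
      fun y hy => ⟨hy, y.2.1.2⟩
    refine ⟨fun b => range (j b), fun y => y.1.2 / u y.1.1, fun b => ?_, fun b => ?_, ?_, ?_, ?_⟩
    · refine isPreconnected_and_isDoubleCoverOn_range continuous_iteratedProj hpre
        hF.continuousOn (fun x _ => hF0 x) hn (Continuous.subtype_mk ?_ _) ?_ fun p => rfl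
      · exact continuous_subtype_val.prodMk (continuous_const.mul
          (hu.comp_continuous continuous_subtype_val fun p => p.2))
      · intro p q hpq
        exact Subtype.ext (congrArg (fun y : IteratedCover F h => y.1.1) hpq)
    · obtain ⟨z, hz⟩ := IsAlgClosed.exists_pow_nat_eq (F x₀) (n := 2) (by norm_num)
      exact ⟨_, mem_range_self ⟨(x₀, z), hx₀, hz⟩⟩
    · ext y
      constructor
      · intro hy
        have hy' := hfib y hy
        obtain ⟨b, hb⟩ := exists_boolSign_mul (y.2.2.trans (hu2 _ hy').symm)
        have : y ∈ range (j b) := ⟨⟨y.1.1, hy'⟩, Subtype.ext (Prod.ext rfl hb)⟩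
        cases b
        · exact Or.inr this
        · exact Or.inl this
      · rintro (⟨p, rfl⟩ | ⟨p, rfl⟩) <;> exact p.2.1
    · refine ContinuousOn.div (by fun_prop) (hu.comp (by fun_prop) fun y hy => hfib y hy)
        fun y hy => hu0 _ (hfib y hy)
    · rintro b _ ⟨p, rfl⟩
      exact mul_div_cancel_right₀ _ (hu0 _ p.2)
  · have hu0 : ∀ x ∈ γ, u x ≠ 0 := by
      intro x hx h'
      have := hu2 x hx
      rw [h'] at this
      exact hF0 x (by rw [← this]; simp)
    have hroot : ∀ b, ∀ x ∈ γ, (x, boolSign b * u x) ∈ rootCover univ F := fun b x hx =>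
      ⟨mem_univ _, by simp [mul_pow, hu2 x hx]⟩
    let j : ∀ b : Bool, rootCover γ (fun x => h (x, boolSign b * u x)) → IteratedCover F h :=
      fun b p => ⟨((p.1.1, boolSign b * u p.1.1), p.1.2), hroot b _ p.2.1, p.2.2⟩
    refine ⟨fun b => range (j b), fun y => y.1.1.2 / u y.1.1.1, fun b => ?_, fun b => ?_,
      ?_, ?_, ?_⟩
    · refine isPreconnected_and_isDoubleCoverOn_range continuous_iteratedProj hpre
        (k := fun x => h (x, boolSign b * u x))
        (hh.comp_continuousOn (continuousOn_id.prodMk (continuousOn_const.mul hu)))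
        (fun x hx => hh0 _ (hroot b x hx)) (hn b) (Continuous.subtype_mk ?_ _) ?_ fun p => rfl
      · refine Continuous.prodMk (Continuous.prodMk (by fun_prop) (continuous_const.mul ?_))
          (by fun_prop)
        exact hu.comp_continuous (by fun_prop) fun p => p.2.1
      · intro p q hpq
        exact Subtype.ext (Prod.ext
          (congrArg (fun y : IteratedCover F h => y.1.1.1) hpq)
          (congrArg (fun y : IteratedCover F h => y.1.2) hpq))
    · obtain ⟨w, hw⟩ := IsAlgClosed.exists_pow_nat_eq (h (x₀, boolSign b * u x₀)) (n := 2)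
        (by norm_num)
      exact ⟨_, mem_range_self ⟨(x₀, w), hx₀, hw⟩⟩
    · ext y
      constructor
      · intro hy
        obtain ⟨b, hb⟩ := exists_boolSign_mul (y.2.1.2.trans (hu2 _ hy).symm)
        have : y ∈ range (j b) := by
          refine ⟨⟨(y.1.1.1, y.1.2), hy, ?_⟩, Subtype.ext (Prod.ext (Prod.ext rfl hb) rfl)⟩
          dsimp only
          have := y.2.2
          rw [this]
          exact congrArg h (Prod.ext rfl hb.symm)
        cases b
        · exact Or.inr this
        · exact Or.inl this
      · rintro (⟨p, rfl⟩ | ⟨p, rfl⟩) <;> exact p.2.1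
    · refine ContinuousOn.div (by fun_prop) (hu.comp (by fun_prop [iteratedProj]) fun y hy => hy)
        fun y hy => hu0 _ hy
    · rintro b _ ⟨p, rfl⟩
      exact mul_div_cancel_right₀ _ (hu0 _ p.2.1)

end IteratedCover

/-! ### The tower as an unbranched orbifold cover. -/

namespace BorderedOrbifold

/-- The iterated double cover as a covering of the orbifold, unbranched over the cone points. -/
theorem exists_covering_four (S : BorderedOrbifold.{u}) [T2Space S.carrier]
    [CompactSpace S.carrier] {F : S.carrier → ℂ} {h : S.carrier × ℂ → ℂ} (hF : Continuous F)
    (hF0 : ∀ x, F x ≠ 0) (hh : Continuous h) (hh0 : ∀ p ∈ rootCover univ F, h p ≠ 0) :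
    ∃ C : S.Covering 4,
      (ConnectedSpace S.carrier → ¬ HasRootOn univ F → ¬ HasRootOn (rootCover univ F) h →
        ConnectedSpace C.total) ∧
      ∀ γ ∈ boundaryComponents S.carrier, SplitsOver F h γ →
        ∃ γ₀ ∈ boundaryComponents C.total, ∃ γ₁ ∈ boundaryComponents C.total,
          γ₀ ≠ γ₁ ∧ C.proj ⁻¹' γ = γ₀ ∪ γ₁ ∧
          IsDoubleCoverOn C.proj γ₀ γ ∧ IsDoubleCoverOn C.proj γ₁ γ := by
  obtain ⟨hcov, hcard⟩ := isCoveringMap_iteratedProj hF hF0 hh hh0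
  have : CompactSpace (IteratedCover F h) := isCompact_iff_compactSpace.1
    (isCompact_rootCover (isCompact_rootCover isCompact_univ hF) hh)
  refine ⟨{ total := IteratedCover F h
            order := fun y => S.order (iteratedProj F h y)
            proj := iteratedProj F h
            continuous_proj := continuous_iteratedProj
            order_dvd := fun y => dvd_rfl
            isCoveringMapOn := hcov.isCoveringMapOn.mono (subset_univ _)
            local_model := ?_
            finite_fiber := ?_
            sheets := ?_ }, fun hc hn hn' => ?_, fun γ hγ hs =>
    exists_boundaryComponents_of_splitsOver hF hF0 hh hh0 hγ hs⟩
  · intro y hy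
    have hb : iteratedProj F h y ∉ surfaceBoundary S.carrier := fun hb =>
      hy.ne' (S.order_boundary _ hb)
    obtain ⟨e₀, he₀⟩ := not_not.1 hb
    obtain ⟨φ, hφ, hφe⟩ := hcov.isLocalHomeomorph y
    -- A cone point is interior, so it has a chart, here translated to have value `0` at the cone
    -- point. Upstairs the chart is its pullback; the orders agree, so the exponent of the local
    -- model is `1`.
    let e' := e₀.trans (Homeomorph.addRight (-e₀ (iteratedProj F h y))).toOpenPartialHomeomorph
    have hs : e'.source = e₀.source := by simp [e']
    refine ⟨φ.trans e', e', ?_, ?_, ?_, ?_, ?_⟩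
    · rw [OpenPartialHomeomorph.trans_source]
      exact ⟨hφ, by rw [hs, mem_preimage, ← hφe]; exact he₀⟩
    · intro z hz
      rw [OpenPartialHomeomorph.trans_source] at hz
      rw [hφe]; exact hz.2
    · simp [e', ← hφe]
    · simp [e']
    · intro z hz
      rw [Nat.div_self (by omega), pow_one, OpenPartialHomeomorph.coe_trans φ, ← hφe,
        Function.comp_apply]
  · intro x
    apply Set.finite_coe_iff.1
    exact Nat.finite_of_card_ne_zero (by rw [hcard]; norm_num)
  · intro x
    rw [finsum_mem_congr (g := fun _ => 1) rfl (fun y hy => by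
      rw [show iteratedProj F h y = x from hy, Nat.div_self (S.order_pos x)]), finsum_one,
      ← Nat.card_coe_set_eq, hcard]
  · have := preconnectedSpace_iteratedCover hF hF0 hh hh0 hn hn'
    obtain ⟨x⟩ := hc.toNonempty
    obtain ⟨⟨y⟩, -⟩ := Nat.card_ne_zero.1 (show Nat.card (iteratedProj F h ⁻¹' {x}) ≠ 0 by
      rw [hcard]; norm_num)
    exact { toPreconnectedSpace := this, toNonempty := ⟨y.1⟩ }

end BorderedOrbifold

/-! ### The glued rectangle -/

/-- The rectangle underlying `ArcRectangle N`, as a set. -/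
def arcRect (N : ℕ) : Set (ℝ × ℝ) := Icc (0 : ℝ) (2 * N + 1) ×ˢ Icc (0 : ℝ) 1

theorem mem_arcRect {N : ℕ} {q : ℝ × ℝ} :
    q ∈ arcRect N ↔ (0 ≤ q.1 ∧ q.1 ≤ 2 * N + 1) ∧ 0 ≤ q.2 ∧ q.2 ≤ 1 := Iff.rfl

instance (N : ℕ) : CompactSpace (ArcRectangle N) :=
  isCompact_iff_compactSpace.1 (isCompact_Icc.prod isCompact_Icc)

instance (N : ℕ) : T2Space (ArcRectangle N) :=
  inferInstanceAs (T2Space ↥(Icc (0 : ℝ) (2 * N + 1) ×ˢ Icc (0 : ℝ) 1))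

/-- A point of the rectangle. -/
def ArcRectangle.ofMem {N : ℕ} (q : ℝ × ℝ) (hq : q ∈ arcRect N) : ArcRectangle N := ⟨q, hq⟩

theorem ArcRectangle.ext {N : ℕ} {p q : ArcRectangle N} (h : p.1 = q.1) : p = q := Subtype.ext h

theorem ArcRectangle.mem {N : ℕ} (p : ArcRectangle N) : p.1 ∈ arcRect N := p.2

theorem ArcRectangle.continuous_ofMem {N : ℕ} {Z : Type*} [TopologicalSpace Z] {f : Z → ℝ × ℝ}
    (hf : Continuous f) (h : ∀ z, f z ∈ arcRect N) :
    Continuous fun z => ArcRectangle.ofMem (f z) (h z) :=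
  Continuous.subtype_mk hf h

/-- The quotient map of the rectangle to the glued rectangle. -/
def surfaceMk (w : List (ℕ × Bool)) : ArcRectangle w.length → ArcSurface w := Quot.mk _

theorem isQuotientMap_surfaceMk (w : List (ℕ × Bool)) : IsQuotientMap (surfaceMk w) :=
  isQuotientMap_quot_mk

/-- The nearest point of the rectangle. -/
noncomputable def rectClamp (N : ℕ) (q : ℝ × ℝ) : ArcRectangle N :=
  ⟨(max 0 (min (2 * N + 1) q.1), max 0 (min 1 q.2)),
    ⟨⟨le_max_left _ _, max_le (by positivity) (min_le_left _ _)⟩,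
      ⟨le_max_left _ _, max_le (by positivity) (min_le_left _ _)⟩⟩⟩

theorem rectClamp_of_mem {N : ℕ} {q : ℝ × ℝ} (hq : q ∈ arcRect N) : rectClamp N q = .ofMem q hq := by
  obtain ⟨⟨h1, h2⟩, h3, h4⟩ := hq
  apply ArcRectangle.ext
  simp [rectClamp, ArcRectangle.ofMem, h1, h2, h3, h4]

theorem continuous_rectClamp (N : ℕ) : Continuous (rectClamp N) :=
  Continuous.subtype_mk (by fun_prop) _

/-- The point of the glued rectangle that is represented by a point of the plane. -/
noncomputable def surfacePt (w : List (ℕ × Bool)) (q : ℝ × ℝ) : ArcSurface w :=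
  surfaceMk w (rectClamp w.length q)

theorem surfacePt_of_mem {w : List (ℕ × Bool)} {q : ℝ × ℝ} (hq : q ∈ arcRect w.length) :
    surfacePt w q = surfaceMk w (.ofMem q hq) :=
  congrArg _ (rectClamp_of_mem hq)

theorem surfaceMk_eq {w : List (ℕ × Bool)} (q : ArcRectangle w.length) :
    surfaceMk w q = surfacePt w q.1 :=
  (surfacePt_of_mem q.mem).symm

theorem continuous_surfacePt (w : List (ℕ × Bool)) : Continuous (surfacePt w) :=
  (isQuotientMap_surfaceMk w).continuous.comp (continuous_rectClamp _)

theorem exists_surfacePt {w : List (ℕ × Bool)} (x : ArcSurface w) :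
    ∃ q ∈ arcRect w.length, surfacePt w q = x := by
  obtain ⟨q, rfl⟩ := Quot.exists_rep x
  exact ⟨q.1, q.2, (surfaceMk_eq q).symm⟩

/-- The point with parameter `t` of the `i`-th arc. -/
def arcPt (i : ℕ) (t : ℝ) : ℝ × ℝ := (2 * i + 1 + t, 1)

theorem continuous_arcPt (i : ℕ) : Continuous (arcPt i) := by unfold arcPt; fun_prop

theorem arcPt_mem {N i : ℕ} (hi : i < N) {t : ℝ} (ht : t ∈ Icc (0 : ℝ) 1) : arcPt i t ∈ arcRect N := by
  have : (i : ℝ) + 1 ≤ N := by exact_mod_cast hi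
  have : (0 : ℝ) ≤ i := by positivity
  obtain ⟨h1, h2⟩ := ht
  refine ⟨⟨?_, ?_⟩, ?_, ?_⟩ <;> simp only [arcPt] <;> linarith

theorem nat_eq_of_abs_sub_lt {i j : ℕ} (h : |(i : ℝ) - j| < 1) : i = j := by
  have h' : |(i : ℤ) - j| < 1 := by exact_mod_cast h
  rw [Int.abs_lt_one_iff] at h'
  omega

theorem arcPt_inj {i j : ℕ} {t s : ℝ} (ht : t ∈ Icc (0 : ℝ) 1) (hs : s ∈ Icc (0 : ℝ) 1)
    (h : arcPt i t = arcPt j s) : i = j ∧ t = s := by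
  obtain ⟨h1, h2⟩ := ht
  obtain ⟨h3, h4⟩ := hs
  have h5 : 2 * (i : ℝ) + 1 + t = 2 * j + 1 + s := congrArg Prod.fst h
  have : i = j := nat_eq_of_abs_sub_lt (by rw [abs_lt]; constructor <;> linarith)
  subst this
  exact ⟨rfl, by linarith⟩

/-- The parameter `t` or `1 - t`. -/
noncomputable def flipPar (d : Bool) (t : ℝ) : ℝ := if d then t else 1 - t

@[simp] theorem flipPar_flipPar (d : Bool) (t : ℝ) : flipPar d (flipPar d t) = t := by
  cases d <;> simp [flipPar]

theorem flipPar_mem {d : Bool} {t : ℝ} (ht : t ∈ Icc (0 : ℝ) 1) : flipPar d t ∈ Icc (0 : ℝ) 1 := by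
  obtain ⟨h1, h2⟩ := ht
  cases d <;> constructor <;> simp [flipPar, h1, h2]

theorem flipPar_mem_Ioo {d : Bool} {t : ℝ} (ht : t ∈ Ioo (0 : ℝ) 1) :
    flipPar d t ∈ Ioo (0 : ℝ) 1 := by
  obtain ⟨h1, h2⟩ := ht
  cases d <;> simp [flipPar, h1, h2]

theorem continuous_flipPar (d : Bool) : Continuous (flipPar d) := by
  cases d
  · exact continuous_const.sub continuous_id
  · exact continuous_id

theorem abs_flipPar_sub (d : Bool) (t s : ℝ) : |flipPar d t - flipPar d s| = |t - s| := by
  cases d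
  · simp only [flipPar, Bool.false_eq_true, if_false]
    rw [abs_sub_comm]; congr 1; ring
  · simp [flipPar]

/-- Every label occurs exactly twice in `w`, the letters at `i` and `σ i` carry the same label, and
they have the same direction if and only if `d i`. -/
structure WordPairing (w : List (ℕ × Bool)) (σ : ℕ → ℕ) (d : ℕ → Bool) : Prop where
  lt : ∀ i < w.length, σ i < w.length
  invol : ∀ i < w.length, σ (σ i) = i
  dir : ∀ i < w.length, d (σ i) = d i
  label_iff : ∀ i j (hi : i < w.length) (hj : j < w.length),
    (i ≠ j ∧ w[i].1 = w[j].1) ↔ j = σ i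
  dir_iff : ∀ i (hi : i < w.length) (hj : σ i < w.length), w[i].2 = w[σ i].2 ↔ d i = true

/-- The points `p` and `q` are identified with each other. -/
def ArcGlued (N : ℕ) (σ : ℕ → ℕ) (d : ℕ → Bool) (p q : ℝ × ℝ) : Prop :=
  ∃ i < N, ∃ t ∈ Icc (0 : ℝ) 1, p = arcPt i t ∧ q = arcPt (σ i) (flipPar (d i) t)

/-! ### The gluing as a pairing of arcs. -/

namespace WordPairing

variable {w : List (ℕ × Bool)} {σ : ℕ → ℕ} {d : ℕ → Bool}

theorem ne (H : WordPairing w σ d) {i : ℕ} (hi : i < w.length) : i ≠ σ i :=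
  ((H.label_iff i (σ i) hi (H.lt i hi)).2 rfl).1

theorem arcGlue_iff (H : WordPairing w σ d) (p q : ArcRectangle w.length) :
    ArcGlue w p q ↔ ArcGlued w.length σ d p.1 q.1 := by
  constructor
  · rintro ⟨i, j, hij, hl, t, ht, hp, hq⟩
    have hj : (j : ℕ) = σ i := (H.label_iff i j i.2 j.2).1
      ⟨fun h => hij (Fin.ext h), by simpa using hl⟩
    obtain ⟨j, hj'⟩ := j
    subst hj
    refine ⟨i, i.2, t, ht, hp, hq.trans ?_⟩
    have := H.dir_iff i i.2 hj'
    simp only [List.get_eq_getElem, this]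
    rfl
  · rintro ⟨i, hi, t, ht, hp, hq⟩
    obtain ⟨h1, h2⟩ := (H.label_iff i (σ i) hi (H.lt i hi)).2 rfl
    refine ⟨⟨i, hi⟩, ⟨σ i, H.lt i hi⟩, fun h => h1 (congrArg Fin.val h), by simpa using h2,
      t, ht, hp, hq.trans ?_⟩
    have := H.dir_iff i hi (H.lt i hi)
    simp only [List.get_eq_getElem, this]
    rfl

theorem glued_symm (H : WordPairing w σ d) {p q : ℝ × ℝ} (h : ArcGlued w.length σ d p q) :
    ArcGlued w.length σ d q p := by
  obtain ⟨i, hi, t, ht, rfl, rfl⟩ := h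
  exact ⟨σ i, H.lt i hi, _, flipPar_mem ht, rfl, by rw [H.invol i hi, H.dir i hi]; simp⟩

theorem glued_trans (H : WordPairing w σ d) {p q r : ℝ × ℝ} (h : ArcGlued w.length σ d p q)
    (h' : ArcGlued w.length σ d q r) : p = r := by
  obtain ⟨i, hi, t, ht, rfl, rfl⟩ := h
  obtain ⟨j, hj, s, hs, hq, rfl⟩ := h'
  obtain ⟨rfl, rfl⟩ := arcPt_inj (flipPar_mem ht) hs hq
  rw [H.invol i hi, H.dir i hi]; simp

/-- The arcs are disjoint and each has a single partner, so gluing twice leads back to the start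
(`glued_trans`), and the generated equivalence relation only adds equality. -/
theorem surfacePt_eq_iff (H : WordPairing w σ d) {p q : ℝ × ℝ} (hp : p ∈ arcRect w.length)
    (hq : q ∈ arcRect w.length) :
    surfacePt w p = surfacePt w q ↔ p = q ∨ ArcGlued w.length σ d p q := by
  rw [surfacePt_of_mem hp, surfacePt_of_mem hq]
  constructor
  · intro h
    have h' := Quot.eqvGen_exact h
    have key : ∀ a b : ArcRectangle w.length, Relation.EqvGen (ArcGlue w) a b →
        a.1 = b.1 ∨ ArcGlued w.length σ d a.1 b.1 := by
      intro a b hab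
      induction hab with
      | rel a b h => exact Or.inr ((H.arcGlue_iff a b).1 h)
      | refl a => exact Or.inl rfl
      | symm a b _ ih => exact ih.imp Eq.symm H.glued_symm
      | trans a b c _ _ ih1 ih2 =>
        rcases ih1 with h1 | h1
        · rw [h1]; exact ih2
        · rcases ih2 with h2 | h2
          · rw [← h2]; exact Or.inr h1
          · exact Or.inl (H.glued_trans h1 h2)
    exact key _ _ h'
  · rintro (rfl | h)
    · rfl
    · exact Quot.sound ((H.arcGlue_iff ⟨p, hp⟩ ⟨q, hq⟩).2 h)

theorem surfacePt_arcPt (H : WordPairing w σ d) {i : ℕ} (hi : i < w.length) {t : ℝ}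
    (ht : t ∈ Icc (0 : ℝ) 1) :
    surfacePt w (arcPt i t) = surfacePt w (arcPt (σ i) (flipPar (d i) t)) :=
  (H.surfacePt_eq_iff (arcPt_mem hi ht) (arcPt_mem (H.lt i hi) (flipPar_mem ht))).2
    (Or.inr ⟨i, hi, t, ht, rfl, rfl⟩)

end WordPairing

/-! ### Separation and connectedness of the glued rectangle. -/

theorem t2Space_of_isClosedMap {X Y : Type*} [TopologicalSpace X] [TopologicalSpace Y] [T2Space X]
    [CompactSpace X] {f : X → Y} (hf : Continuous f) (hs : Function.Surjective f)
    (hc : IsClosedMap f) : T2Space Y := by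
  refine ⟨fun x y hxy => ?_⟩
  have hcl : ∀ y : Y, IsClosed (f ⁻¹' {y}) := fun y => by
    obtain ⟨x, rfl⟩ := hs y
    refine IsClosed.preimage hf ?_
    simpa using hc _ (isClosed_singleton (x := x))
  have hd : Disjoint (f ⁻¹' {x}) (f ⁻¹' {y}) := Disjoint.preimage f (by simpa using hxy)
  obtain ⟨U, V, hU, hV, hxU, hyV, hUV⟩ := normal_separation (hcl x) (hcl y) hd
  refine ⟨(f '' Uᶜ)ᶜ, (f '' Vᶜ)ᶜ, (hc _ hU.isClosed_compl).isOpen_compl,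
    (hc _ hV.isClosed_compl).isOpen_compl, ?_, ?_, ?_⟩
  · rintro ⟨z, hz, rfl⟩; exact hz (hxU rfl)
  · rintro ⟨z, hz, rfl⟩; exact hz (hyV rfl)
  · rw [Set.disjoint_left]
    intro z hz hz'
    obtain ⟨z, rfl⟩ := hs z
    have h1 : z ∈ U := by by_contra h; exact hz ⟨z, h, rfl⟩
    have h2 : z ∈ V := by by_contra h; exact hz' ⟨z, h, rfl⟩
    exact Set.disjoint_left.1 hUV h1 h2

namespace WordPairing

variable {w : List (ℕ × Bool)} {σ : ℕ → ℕ} {d : ℕ → Bool}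

/-- Saturating a closed set adds to it finitely many compact sets, the copies on the partner arcs of
its traces on the arcs. Hence the quotient map is closed. -/
theorem t2Space (H : WordPairing w σ d) : T2Space (ArcSurface w) := by
  refine t2Space_of_isClosedMap (isQuotientMap_surfaceMk w).continuous
    (isQuotientMap_surfaceMk w).surjective fun C hC => ?_
  refine (isQuotientMap_surfaceMk w).isClosed_preimage.1 ?_
  have key : surfaceMk w ⁻¹' (surfaceMk w '' C) =
      C ∪ ⋃ i : Fin w.length, (fun t : Icc (0 : ℝ) 1 => ArcRectangle.ofMem
        (arcPt (σ i) (flipPar (d i) t)) (arcPt_mem (H.lt i i.2) (flipPar_mem t.2))) ''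
        ((fun t : Icc (0 : ℝ) 1 => ArcRectangle.ofMem (arcPt i t) (arcPt_mem i.2 t.2)) ⁻¹' C) := by
    ext q
    constructor
    · rintro ⟨p, hp, hpq⟩
      rw [surfaceMk_eq, surfaceMk_eq] at hpq
      rcases (H.surfacePt_eq_iff p.mem q.mem).1 hpq with h | ⟨i, hi, t, ht, h1, h2⟩
      · left; rwa [← ArcRectangle.ext h]
      · right
        rw [mem_iUnion]
        refine ⟨⟨i, hi⟩, ⟨t, ht⟩, ?_, ArcRectangle.ext h2.symm⟩
        have : ArcRectangle.ofMem (arcPt i t) (arcPt_mem hi ht) = p := ArcRectangle.ext h1.symm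
        exact mem_preimage.2 (by rwa [this])
    · rintro (h | h)
      · exact ⟨q, h, rfl⟩
      · rw [mem_iUnion] at h
        obtain ⟨i, t, ht, rfl⟩ := h
        refine ⟨_, ht, Quot.sound ((H.arcGlue_iff _ _).2 ⟨i, i.2, t, t.2, rfl, rfl⟩)⟩
  rw [key]
  refine hC.union (isClosed_iUnion_of_finite fun i => ?_)
  refine (IsCompact.image (IsClosed.isCompact (hC.preimage ?_)) ?_).isClosed
  · exact ArcRectangle.continuous_ofMem ((continuous_arcPt _).comp continuous_subtype_val) _
  · exact ArcRectangle.continuous_ofMem ((continuous_arcPt _).comp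
      ((continuous_flipPar _).comp continuous_subtype_val)) _

end WordPairing

instance (w : List (ℕ × Bool)) : CompactSpace (ArcSurface w) :=
  inferInstanceAs (CompactSpace (Quot (ArcGlue w)))

theorem surfacePt_image_arcRect (w : List (ℕ × Bool)) :
    surfacePt w '' arcRect w.length = univ :=
  eq_univ_of_forall exists_surfacePt

instance (w : List (ℕ × Bool)) : ConnectedSpace (ArcSurface w) := by
  have hc : IsConnected (arcRect w.length) :=
    ⟨⟨(0, 0), by simp [mem_arcRect]; positivity⟩, ((convex_Icc _ _).prod (convex_Icc _ _)).isPreconnected⟩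
  have := hc.image _ (continuous_surfacePt w).continuousOn
  rw [surfacePt_image_arcRect] at this
  exact connectedSpace_iff_univ.2 this

/-- A set of points of the glued rectangle is open if its preimage is the trace of an open set. -/
theorem isOpen_of_surfacePt {w : List (ℕ × Bool)} {A : Set (ArcSurface w)} {O : Set (ℝ × ℝ)}
    (hO : IsOpen O) (h : ∀ q ∈ arcRect w.length, surfacePt w q ∈ A ↔ q ∈ O) : IsOpen A := by
  refine (isQuotientMap_surfaceMk w).isOpen_preimage.1 (isOpen_induced_iff.2 ⟨O, hO, ?_⟩)
  ext q
  rw [mem_preimage, surfaceMk_eq]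
  exact (h q.1 q.mem).symm

/-! ### Interior points -/

theorem exists_chart_of_isOpen_image {X : Type*} [TopologicalSpace X] {V : Set (ℝ × ℝ)}
    (hV : IsOpen V) {g : ℝ × ℝ → X} (hg : ContinuousOn g V) (hinj : InjOn g V)
    (hopen : ∀ W ⊆ V, IsOpen W → IsOpen (g '' W)) {p : ℝ × ℝ} (hp : p ∈ V) :
    ∃ e : OpenPartialHomeomorph X ℂ, g p ∈ e.source := by
  have : Nonempty V := ⟨⟨p, hp⟩⟩
  have hemb : IsOpenEmbedding (fun v : V => g v) := by
    refine IsOpenEmbedding.of_continuous_injective_isOpenMap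
      (hg.comp_continuous continuous_subtype_val fun v => v.2)
      (fun a b hab => Subtype.ext (hinj a.2 b.2 hab)) fun W hW => ?_
    have h1 := hopen (Subtype.val '' W) (by simp) (hV.isOpenMap_subtype_val W hW)
    rwa [image_image] at h1
  refine ⟨(hemb.toOpenPartialHomeomorph _).symm.trans
    ((hV.isOpenEmbedding_subtypeVal.toOpenPartialHomeomorph _).trans
      Complex.equivRealProdCLM.symm.toHomeomorph.toOpenPartialHomeomorph), ?_⟩
  simp only [OpenPartialHomeomorph.trans_source, OpenPartialHomeomorph.symm_source,
    IsOpenEmbedding.toOpenPartialHomeomorph_target, IsOpenEmbedding.toOpenPartialHomeomorph_source,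
    Homeomorph.toOpenPartialHomeomorph_source, preimage_univ, inter_univ]
  exact ⟨⟨p, hp⟩, rfl⟩

/-- The nearest point of the unit interval. -/
noncomputable def unitClamp (s : ℝ) : ℝ := max 0 (min 1 s)

theorem continuous_unitClamp : Continuous unitClamp := by unfold unitClamp; fun_prop

theorem unitClamp_mem (s : ℝ) : unitClamp s ∈ Icc (0 : ℝ) 1 :=
  ⟨le_max_left _ _, max_le (by norm_num) (min_le_left _ _)⟩

theorem unitClamp_of_mem {s : ℝ} (hs : s ∈ Icc (0 : ℝ) 1) : unitClamp s = s := by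
  obtain ⟨h1, h2⟩ := hs
  simp [unitClamp, h1, h2]

theorem unitClamp_of_le {s : ℝ} (hs : s ≤ 0) : unitClamp s = 0 := by
  have : min 1 s ≤ 0 := (min_le_right _ _).trans hs
  simp [unitClamp, this]

theorem unitClamp_of_ge {s : ℝ} (hs : 1 ≤ s) : unitClamp s = 1 := by
  simp [unitClamp, hs]

/-- The points of the rectangle that represent boundary points. -/
def arcEdge (N : ℕ) : Set (ℝ × ℝ) :=
  {q | q ∈ arcRect N ∧ (q.1 = 0 ∨ q.1 = 2 * N + 1 ∨ q.2 = 0 ∨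
    (q.2 = 1 ∧ ∀ i < N, q.1 ∉ Ioo (2 * (i : ℝ) + 1) (2 * i + 2)))}

namespace WordPairing

variable {w : List (ℕ × Bool)} {σ : ℕ → ℕ} {d : ℕ → Bool}

theorem exists_chart_interior (H : WordPairing w σ d) {q : ℝ × ℝ}
    (hq : q ∈ Ioo (0 : ℝ) (2 * w.length + 1) ×ˢ Ioo (0 : ℝ) 1) :
    ∃ e : OpenPartialHomeomorph (ArcSurface w) ℂ, surfacePt w q ∈ e.source := by
  have hsub : Ioo (0 : ℝ) (2 * w.length + 1) ×ˢ Ioo (0 : ℝ) 1 ⊆ arcRect w.length :=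
    prod_mono Ioo_subset_Icc_self Ioo_subset_Icc_self
  have heq : ∀ p ∈ Ioo (0 : ℝ) (2 * w.length + 1) ×ˢ Ioo (0 : ℝ) 1, ∀ q ∈ arcRect w.length,
      surfacePt w p = surfacePt w q → p = q := by
    intro p hp q hq h
    rcases (H.surfacePt_eq_iff (hsub hp) hq).1 h with h | ⟨i, hi, t, ht, rfl, -⟩
    · exact h
    · exact absurd hp.2.2 (lt_irrefl _)
  refine exists_chart_of_isOpen_image (isOpen_Ioo.prod isOpen_Ioo)
    (continuous_surfacePt w).continuousOn (fun p hp q hq h => heq p hp q (hsub hq) h)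
    (fun W hW hWo => isOpen_of_surfacePt hWo fun q hq => ⟨?_, fun h => ⟨q, h, rfl⟩⟩) hq
  rintro ⟨p, hp, h⟩
  rwa [← heq p (hW hp) q hq h]

/-- The strips below the arcs `i` and `σ i` are laid along the two sides of `(0, 1) × {0}`, the
second one upside down and, if the directions require it, reversed. -/
theorem exists_chart_arc (H : WordPairing w σ d) {i : ℕ} (hi : i < w.length) {t : ℝ}
    (ht : t ∈ Ioo (0 : ℝ) 1) :
    ∃ e : OpenPartialHomeomorph (ArcSurface w) ℂ, surfacePt w (arcPt i t) ∈ e.source := by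
  classical
  -- The clamp makes both branches agree on the whole line `q.2 = 0`, so that `g` is continuous
  -- everywhere; only its values on `V` matter.
  let g : ℝ × ℝ → ArcSurface w := fun q =>
    if q.2 ≤ 0 then surfacePt w (2 * i + 1 + unitClamp q.1, 1 + q.2)
    else surfacePt w (2 * (σ i : ℕ) + 1 + flipPar (d i) (unitClamp q.1), 1 - q.2)
  have hgc : Continuous g := by
    refine Continuous.if_le ((continuous_surfacePt w).comp ?_) ((continuous_surfacePt w).comp ?_)
      continuous_snd continuous_const fun q hq => ?_
    · exact (continuous_const.add (continuous_unitClamp.comp continuous_fst)).prodMk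
        (continuous_const.add continuous_snd)
    · exact (continuous_const.add ((continuous_flipPar _).comp
        (continuous_unitClamp.comp continuous_fst))).prodMk (continuous_const.sub continuous_snd)
    · rw [hq]
      simpa [arcPt] using H.surfacePt_arcPt hi (unitClamp_mem q.1)
  have hσ := H.lt i hi
  have hne := H.ne hi
  have hiN : (i : ℝ) + 1 ≤ w.length := by exact_mod_cast hi
  have hσN : (σ i : ℝ) + 1 ≤ w.length := by exact_mod_cast hσ
  have hi0 : (0 : ℝ) ≤ i := by positivity
  have hσ0 : (0 : ℝ) ≤ (σ i : ℕ) := by positivity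
  let V : Set (ℝ × ℝ) := Ioo (0 : ℝ) 1 ×ˢ Ioo (-1 : ℝ) 1
  have hgV1 : ∀ q ∈ V, q.2 ≤ 0 → g q = surfacePt w (2 * i + 1 + q.1, 1 + q.2) := by
    intro q hq h
    simp only [g, h, if_true, unitClamp_of_mem (Ioo_subset_Icc_self hq.1)]
  have hgV2 : ∀ q ∈ V, 0 ≤ q.2 →
      g q = surfacePt w (2 * (σ i : ℕ) + 1 + flipPar (d i) q.1, 1 - q.2) := by
    intro q hq h
    rcases h.eq_or_lt with h | h
    · rw [hgV1 q hq h.symm.le, ← h]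
      simpa [arcPt] using H.surfacePt_arcPt hi (Ioo_subset_Icc_self hq.1)
    · simp only [g, not_le.2 h, if_false, unitClamp_of_mem (Ioo_subset_Icc_self hq.1)]
  -- the preimages of the two coordinates
  have hpre : ∀ q ∈ V, ∀ p ∈ arcRect w.length, g q = surfacePt w p ↔
      (p.2 > 0 ∧ p = (2 * i + 1 + q.1, 1 + q.2)) ∨
      (p.2 > 0 ∧ p = (2 * (σ i : ℕ) + 1 + flipPar (d i) q.1, 1 - q.2)) := by
    intro q hq p hp
    obtain ⟨⟨hq1, hq2⟩, hq3, hq4⟩ := id hq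
    obtain ⟨hf1, hf2⟩ := flipPar_mem_Ioo (d := d i) hq.1
    constructor
    · intro h
      rcases le_total q.2 0 with h0 | h0
      · rw [hgV1 q hq h0, H.surfacePt_eq_iff ⟨⟨by dsimp only; linarith, by dsimp only; linarith⟩,
          by dsimp only; linarith, by dsimp only; linarith⟩ hp] at h
        rcases h with h | ⟨j, hj, s, hs, h1, h2⟩
        · left
          exact ⟨by rw [← h]; dsimp only; linarith, h.symm⟩
        · right
          have hq20 : q.2 = 0 := by
            have := congrArg Prod.snd h1
            simp only [arcPt] at this; linarith
          have h3 : arcPt i q.1 = arcPt j s := by rw [← h1, hq20]; simp [arcPt]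
          obtain ⟨rfl, rfl⟩ := arcPt_inj (Ioo_subset_Icc_self hq.1) hs h3
          rw [h2, hq20]
          exact ⟨one_pos, by simp [arcPt]⟩
      · rw [hgV2 q hq h0, H.surfacePt_eq_iff ⟨⟨by dsimp only; linarith, by dsimp only; linarith⟩,
          by dsimp only; linarith, by dsimp only; linarith⟩ hp] at h
        rcases h with h | ⟨j, hj, s, hs, h1, h2⟩
        · right
          exact ⟨by rw [← h]; dsimp only; linarith, h.symm⟩
        · left
          have hq20 : q.2 = 0 := by
            have := congrArg Prod.snd h1
            simp only [arcPt] at this; linarith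
          have h3 : arcPt (σ i) (flipPar (d i) q.1) = arcPt j s := by
            rw [← h1, hq20]; simp [arcPt]
          obtain ⟨rfl, rfl⟩ := arcPt_inj ⟨hf1.le, hf2.le⟩ hs h3
          rw [h2, hq20, H.invol i hi, H.dir i hi]
          exact ⟨one_pos, by simp [arcPt]⟩
    · rintro (⟨h0, rfl⟩ | ⟨h0, rfl⟩)
      · exact hgV1 q hq (by have := hp.2.2; dsimp only at this; linarith)
      · exact hgV2 q hq (by have := hp.2.2; dsimp only at this; linarith)
  have hinj : InjOn g V := by
    intro p hp q hq h
    obtain ⟨⟨hp1, hp2⟩, hp3, hp4⟩ := id hp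
    obtain ⟨⟨hq1, hq2⟩, hq3, hq4⟩ := id hq
    obtain ⟨hf1, hf2⟩ := flipPar_mem_Ioo (d := d i) hq.1
    obtain ⟨hf3, hf4⟩ := flipPar_mem_Ioo (d := d i) hp.1
    have hfinj : ∀ a b : ℝ, flipPar (d i) a = flipPar (d i) b → a = b := fun a b h => by
      simpa using congrArg (flipPar (d i)) h
    have hcon : ∀ a b : ℝ, a ∈ Ioo (0 : ℝ) 1 → b ∈ Ioo (0 : ℝ) 1 →
        2 * (i : ℝ) + 1 + a ≠ 2 * (σ i : ℕ) + 1 + b := by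
      rintro a b ⟨ha, ha'⟩ ⟨hb, hb'⟩ h
      exact hne (nat_eq_of_abs_sub_lt (by rw [abs_lt]; constructor <;> linarith))
    rcases le_total q.2 0 with h0 | h0
    · rw [hgV1 q hq h0, hpre p hp _ ⟨⟨by dsimp only; linarith, by dsimp only; linarith⟩,
        by dsimp only; linarith, by dsimp only; linarith⟩, Prod.mk.injEq, Prod.mk.injEq] at h
      rcases h with ⟨-, h1, h2⟩ | ⟨-, h1, h2⟩
      · exact Prod.ext (by linarith) (by linarith)
      · exact absurd h1 (hcon _ _ hq.1 ⟨hf3, hf4⟩)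
    · rw [hgV2 q hq h0, hpre p hp _ ⟨⟨by dsimp only; linarith, by dsimp only; linarith⟩,
        by dsimp only; linarith, by dsimp only; linarith⟩, Prod.mk.injEq, Prod.mk.injEq] at h
      rcases h with ⟨-, h1, h2⟩ | ⟨-, h1, h2⟩
      · exact absurd h1.symm (hcon _ _ hp.1 ⟨hf1, hf2⟩)
      · exact Prod.ext (hfinj _ _ (by linarith)) (by linarith)
  have hmain := exists_chart_of_isOpen_image (V := V) (isOpen_Ioo.prod isOpen_Ioo)
    hgc.continuousOn hinj (fun W hW hWo => ?_) (p := (t, 0)) ⟨ht, by norm_num, by norm_num⟩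
  · rw [hgV1 (t, 0) ⟨ht, by norm_num, by norm_num⟩ le_rfl] at hmain
    simpa [arcPt] using hmain
  · have ho : IsOpen ({p : ℝ × ℝ | 0 < p.2} ∩
        ((fun p : ℝ × ℝ => (p.1 - (2 * i + 1), p.2 - 1)) ⁻¹' W ∪
          (fun p : ℝ × ℝ => (flipPar (d i) (p.1 - (2 * (σ i : ℕ) + 1)), 1 - p.2)) ⁻¹' W)) := by
      refine (isOpen_lt continuous_const continuous_snd).inter ((hWo.preimage (by fun_prop)).union
        (hWo.preimage ?_))
      exact ((continuous_flipPar _).comp (by fun_prop)).prodMk (by fun_prop)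
    refine isOpen_of_surfacePt ho fun p hp => ⟨?_, ?_⟩
    · rintro ⟨q, hq, h⟩
      rcases (hpre q (hW hq) p hp).1 h with ⟨h0, rfl⟩ | ⟨h0, rfl⟩
      · exact ⟨h0, Or.inl (by simpa using hq)⟩
      · exact ⟨h0, Or.inr (by simpa using hq)⟩
    · rintro ⟨h0, h | h⟩
      · exact ⟨_, h, (hpre _ (hW h) p hp).2 (Or.inl ⟨h0, by simp⟩)⟩
      · exact ⟨_, h, (hpre _ (hW h) p hp).2 (Or.inr ⟨h0, by simp⟩)⟩

theorem surfaceBoundary_subset (H : WordPairing w σ d) :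
    surfaceBoundary (ArcSurface w) ⊆ surfacePt w '' arcEdge w.length := by
  intro x hx
  obtain ⟨q, hq, rfl⟩ := exists_surfacePt x
  refine ⟨q, ⟨hq, ?_⟩, rfl⟩
  by_contra! hn
  obtain ⟨h1, h2, h3, h4⟩ := hn
  obtain ⟨⟨a1, a2⟩, a3, a4⟩ := id hq
  apply hx
  by_cases h5 : q.2 = 1
  · obtain ⟨i, hi, hiq⟩ := h4 h5
    have : q = arcPt i (q.1 - (2 * i + 1)) := Prod.ext (by simp [arcPt]) h5
    rw [this]
    exact H.exists_chart_arc hi ⟨by linarith [hiq.1], by linarith [hiq.2]⟩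
  · exact H.exists_chart_interior ⟨⟨lt_of_le_of_ne a1 (Ne.symm h1), lt_of_le_of_ne a2 h2⟩,
      lt_of_le_of_ne a3 (Ne.symm h3), lt_of_le_of_ne a4 h5⟩

end WordPairing

/-! ### Boundary points -/

/-- The exponential of half the angle, normalised at `a`, is another root on the interval. Two roots
on a connected set agree up to sign, and these agree at `a`. All later winding arguments reduce to
this factor between the end points. -/
theorem root_apply_eq {a b : ℝ} (hab : a ≤ b) {v : ℝ → ℂ} (hv : ContinuousOn v (Icc a b))
    {φ : ℝ → ℝ} (hφ : Continuous φ) {c : ℂ} (hc : c ≠ 0)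
    (h : ∀ t ∈ Icc a b, v t ^ 2 = c * Complex.exp (2 * Real.pi * Complex.I * φ t)) :
    v b = v a * Complex.exp (Real.pi * Complex.I * (φ b - φ a)) := by
  have ha : a ∈ Icc a b := ⟨le_rfl, hab⟩
  have hva : v a ≠ 0 := by
    intro h0
    have := h a ha
    rw [h0] at this
    exact mul_ne_zero hc (Complex.exp_ne_zero _) (by rw [← this]; simp)
  have hg : Continuous fun t => v a * Complex.exp (Real.pi * Complex.I * (φ t - φ a)) := by
    fun_prop
  have hsq : EqOn (v ^ 2) ((fun t => v a * Complex.exp (Real.pi * Complex.I * (φ t - φ a))) ^ 2)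
      (Icc a b) := by
    intro t ht
    simp only [Pi.pow_apply, mul_pow, h t ht, h a ha, ← Complex.exp_nat_mul]
    rw [mul_assoc c, ← Complex.exp_add]
    congr 2
    push_cast
    ring
  rcases isPreconnected_Icc.eq_or_eq_neg_of_sq_eq hv hg.continuousOn hsq
    (fun ht => mul_ne_zero hva (Complex.exp_ne_zero _)) with h1 | h1
  · exact h1 ⟨hab, le_rfl⟩
  · have := h1 ha
    simp only [Pi.neg_apply, sub_self, mul_zero, Complex.exp_zero, mul_one] at this
    exact absurd (self_eq_neg.1 this) hva

/-- Around a small circle the coordinate turns once, so a root would return with the opposite sign.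
-/
theorem not_hasRootOn_punctured {X : Type*} [TopologicalSpace X] (e : OpenPartialHomeomorph X ℂ)
    {x : X} {W : Set X} (hW : IsOpen W) (hxW : x ∈ W) (hWe : W ⊆ e.source) :
    ¬ HasRootOn (W \ {x}) fun y => e y - e x := by
  rintro ⟨r, hr, hr2⟩
  have hopen : IsOpen (e '' W) := e.isOpen_image_of_subset_source hW hWe
  obtain ⟨ε, hε, hball⟩ := Metric.isOpen_iff.1 hopen (e x) (mem_image_of_mem _ hxW)
  have hε2 : ((ε / 2 : ℝ) : ℂ) ≠ 0 := by
    simp only [ne_eq, Complex.ofReal_eq_zero]; linarith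
  let p : ℝ → ℂ := fun t => e x + (ε / 2 : ℝ) * Complex.exp (2 * Real.pi * Complex.I * t)
  have hpball : ∀ t, p t ∈ e '' W := fun t => hball (by
    have : ‖Complex.exp (2 * Real.pi * Complex.I * t)‖ = 1 := by
      rw [Complex.norm_exp]; simp
    simp only [p, Metric.mem_ball, dist_eq_norm, add_sub_cancel_left, norm_mul, this, mul_one,
      Complex.norm_real, Real.norm_eq_abs]
    rw [abs_of_pos] <;> linarith)
  have hptarget : ∀ t, p t ∈ e.target := fun t => by
    obtain ⟨y, hy, h⟩ := hpball t
    rw [← h]; exact e.map_source (hWe hy)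
  have hpW : ∀ t, e.symm (p t) ∈ W := fun t => by
    obtain ⟨y, hy, h⟩ := hpball t
    rw [← h, e.left_inv (hWe hy)]; exact hy
  have hpne : ∀ t, e.symm (p t) ≠ x := fun t h => by
    have := e.right_inv (hptarget t)
    rw [h] at this
    simp only [p, left_eq_add] at this
    exact mul_ne_zero hε2 (Complex.exp_ne_zero _) this
  have hpc : Continuous p := by fun_prop
  have key := root_apply_eq (a := 0) (b := 1) (by norm_num) (v := fun t => r (e.symm (p t)))
    (φ := fun t => t) (c := (ε / 2 : ℝ)) ?_ continuous_id hε2 ?_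
  · have h01 : p 1 = p 0 := by simp [p, Complex.exp_two_pi_mul_I]
    simp only [h01, Complex.ofReal_one, Complex.ofReal_zero, sub_zero, mul_one,
      Complex.exp_pi_mul_I] at key
    have h0 : r (e.symm (p 0)) = 0 := self_eq_neg.1 (by simpa using key)
    have := hr2 _ ⟨hpW 0, hpne 0⟩
    simp only [h0, e.right_inv (hptarget 0)] at this
    simp only [p, add_sub_cancel_left] at this
    exact mul_ne_zero hε2 (Complex.exp_ne_zero _) (by rw [← this]; simp)
  · refine hr.comp (e.continuousOn_symm.comp hpc.continuousOn fun t _ => hptarget t)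
      fun t _ => ⟨hpW t, hpne t⟩
  · intro t _
    rw [hr2 _ ⟨hpW t, hpne t⟩]
    simp only [e.right_inv (hptarget t)]
    simp [p]

/-- The contraction to `c` makes `k` homotopic to the constant `k c` through nowhere vanishing
functions. The homotopy lifts through the covering `exp`, and halving the resulting logarithm gives
a root. -/
theorem hasRootOn_of_star {E : Type*} [AddCommGroup E] [Module ℝ E] [TopologicalSpace E]
    [IsTopologicalAddGroup E] [ContinuousSMul ℝ E] {D : Set E} {c : E}
    (hD : ∀ a ∈ D, ∀ t ∈ Icc (0 : ℝ) 1, c + t • (a - c) ∈ D) {k : E → ℂ} (hk : ContinuousOn k D)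
    (h0 : ∀ a ∈ D, k a ≠ 0) : HasRootOn D k := by
  classical
  by_cases hne : D.Nonempty
  swap
  · rw [not_nonempty_iff_eq_empty.1 hne]
    exact ⟨0, by simp, by simp⟩
  obtain ⟨a₀, ha₀⟩ := hne
  have hcD : c ∈ D := by simpa using hD a₀ ha₀ 0 (by simp)
  let H : C(unitInterval × D, {z : ℂ // z ≠ 0}) :=
    ⟨fun p => ⟨k (c + (p.1 : ℝ) • (p.2.1 - c)), h0 _ (hD _ p.2.2 _ p.1.2)⟩, by
      refine Continuous.subtype_mk (hk.comp_continuous ?_ fun p => hD _ p.2.2 _ p.1.2) _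
      fun_prop⟩
  let L := Complex.isCoveringMap_exp.liftHomotopy H (ContinuousMap.const D (Complex.log (k c)))
    (fun a => Subtype.ext (by simp [H, Complex.exp_log (h0 c hcD)]))
  have hL : ∀ a : D, Complex.exp (L (1, a)) = k a := fun a => by
    have := congrFun (Complex.isCoveringMap_exp.liftHomotopy_lifts H
      (ContinuousMap.const D (Complex.log (k c))) (fun a => Subtype.ext (by
        simp [H, Complex.exp_log (h0 c hcD)]))) (1, a)
    have : Complex.exp (L (1, a)) = k (c + ((1 : unitInterval) : ℝ) • (a.1 - c)) :=
      congrArg Subtype.val this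
    simpa only [Set.Icc.coe_one, one_smul, add_sub_cancel] using this
  refine ⟨fun a => if ha : a ∈ D then Complex.exp (L (1, ⟨a, ha⟩) / 2) else 0, ?_, ?_⟩
  · rw [continuousOn_iff_continuous_domRestrict]
    have : (D.domRestrict fun a => if ha : a ∈ D then Complex.exp (L (1, ⟨a, ha⟩) / 2) else 0) =
        fun a : D => Complex.exp (L (1, a) / 2) := by
      ext a; simp [Set.domRestrict]
    rw [this]
    fun_prop
  · intro a ha
    simp only [ha, dif_pos]
    rw [← hL ⟨a, ha⟩, ← Complex.exp_nat_mul]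
    congr 1
    push_cast
    ring

/-- The open square with centre `q` and side `2 * r`. -/
def openBox (r : ℝ) (q : ℝ × ℝ) : Set (ℝ × ℝ) := Ioo (q.1 - r) (q.1 + r) ×ˢ Ioo (q.2 - r) (q.2 + r)

theorem isOpen_openBox (r : ℝ) (q : ℝ × ℝ) : IsOpen (openBox r q) := isOpen_Ioo.prod isOpen_Ioo

theorem mem_openBox_self {r : ℝ} (hr : 0 < r) (q : ℝ × ℝ) : q ∈ openBox r q := by
  refine ⟨⟨?_, ?_⟩, ?_, ?_⟩ <;> linarith

theorem openBox_subset_ball {r : ℝ} (q : ℝ × ℝ) : openBox r q ⊆ Metric.ball q r := by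
  rintro p ⟨⟨h1, h2⟩, h3, h4⟩
  rw [Metric.mem_ball, Prod.dist_eq, max_lt_iff, Real.dist_eq, Real.dist_eq, abs_lt, abs_lt]
  refine ⟨⟨?_, ?_⟩, ?_, ?_⟩ <;> linarith

theorem exists_openBox_subset {O : Set (ℝ × ℝ)} (hO : IsOpen O) {q : ℝ × ℝ} (hq : q ∈ O) :
    ∃ r > 0, ∀ s ≤ r, openBox s q ⊆ O := by
  obtain ⟨r, hr, h⟩ := Metric.isOpen_iff.1 hO q hq
  exact ⟨r, hr, fun s hs => (openBox_subset_ball q).trans ((Metric.ball_subset_ball hs).trans h)⟩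

/-- A segment from an interior point `c` of the convex set `R` to a point of `R` stays in the
interior before its end, so it cannot meet the boundary point `q` on the way: the punctured piece is
star-shaped about `c`. -/
theorem hasRootOn_openBox_diff {R : Set (ℝ × ℝ)} (hR : Convex ℝ R) {q : ℝ × ℝ}
    (hcl : q ∈ closure (interior R)) (hq : q ∉ interior R) {r : ℝ} (hr : 0 < r) {k : ℝ × ℝ → ℂ}
    (hk : ContinuousOn k ((openBox r q ∩ R) \ {q})) (h0 : ∀ a ∈ (openBox r q ∩ R) \ {q}, k a ≠ 0) :
    HasRootOn ((openBox r q ∩ R) \ {q}) k := by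
  obtain ⟨c, hcb, hcR⟩ := mem_closure_iff.1 hcl _ (isOpen_openBox r q) (mem_openBox_self hr q)
  have hbox : Convex ℝ (openBox r q) := (convex_Ioo _ _).prod (convex_Ioo _ _)
  refine hasRootOn_of_star (c := c) ?_ hk h0
  rintro a ⟨⟨hab, haR⟩, haq⟩ t ⟨ht0, ht1⟩
  have hcomb : c + t • (a - c) = (1 - t) • c + t • a := by module
  rw [hcomb]
  refine ⟨⟨hbox hcb hab (by linarith) ht0 (by ring),
    hR (interior_subset hcR) haR (by linarith) ht0 (by ring)⟩, ?_⟩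
  rcases ht1.eq_or_lt with rfl | ht1
  · simpa using haq
  · intro h
    apply hq
    rw [mem_singleton_iff] at h
    rw [← h]
    exact hR.combo_interior_self_mem_interior hcR haR (by linarith) ht0 (by ring)

/-- The function on the glued rectangle given by the values of `f` at the points of the
rectangle. -/
noncomputable def surfaceFun {w : List (ℕ × Bool)} (f : ℝ × ℝ → ℂ) (x : ArcSurface w) : ℂ :=
  f (exists_surfacePt x).choose

namespace WordPairing

variable {w : List (ℕ × Bool)} {σ : ℕ → ℕ} {d : ℕ → Bool}

/-- The representative chosen by `surfaceFun` is either `q` or its partner, so no other values have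
to be compared. -/
theorem surfaceFun_apply (H : WordPairing w σ d) {f : ℝ × ℝ → ℂ} {q : ℝ × ℝ}
    (hq : q ∈ arcRect w.length)
    (hf : ∀ p, ArcGlued w.length σ d p q → f p = f q) :
    surfaceFun f (surfacePt w q) = f q := by
  obtain ⟨h1, h2⟩ := (exists_surfacePt (surfacePt w q)).choose_spec
  rcases (H.surfacePt_eq_iff h1 hq).1 h2 with h | h
  · exact congrArg f h
  · exact hf _ h

/-- Compatibility with the gluing is asked over `A` only, since the roots near a boundary point are
defined on a punctured neighbourhood. -/
theorem continuousOn_surfaceFun (H : WordPairing w σ d) {f : ℝ × ℝ → ℂ} {A : Set (ArcSurface w)}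
    (hA : IsOpen A) (hfc : ContinuousOn f {q | q ∈ arcRect w.length ∧ surfacePt w q ∈ A})
    (hf : ∀ p q, surfacePt w q ∈ A → ArcGlued w.length σ d p q → f p = f q) :
    ContinuousOn (surfaceFun f) A := by
  rw [(isQuotientMap_surfaceMk w).continuousOn_isOpen_iff hA]
  have : ContinuousOn (fun q : ArcRectangle w.length => f q.1) (surfaceMk w ⁻¹' A) := by
    refine hfc.comp (continuous_subtype_val (p := (· ∈ arcRect w.length))).continuousOn
      fun q hq => ⟨q.mem, ?_⟩
    rw [← surfaceMk_eq]; exact hq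
  refine this.congr fun q hq => ?_
  have hq' : surfaceMk w q ∈ A := hq
  rw [Function.comp_apply, surfaceMk_eq]
  rw [surfaceMk_eq] at hq'
  exact H.surfaceFun_apply q.mem fun p hp => hf p q.1 hq' hp

/-- A chart at a boundary point would give a square root of the coordinate near the point. -/
theorem false_of_chart (H : WordPairing w σ d) {Q : Set (ℝ × ℝ)} (hQ : IsOpen Q) {q₀ q₁ : ℝ × ℝ}
    (hq₀ : q₀ ∈ Q) (hq₀R : q₀ ∈ arcRect w.length)
    (hsat : ∀ p q, ArcGlued w.length σ d p q → p ∈ Q → q ∈ Q)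
    (hfib : ∀ q ∈ arcRect w.length, surfacePt w q = surfacePt w q₀ ↔ q = q₀ ∨ q = q₁)
    (e : OpenPartialHomeomorph (ArcSurface w) ℂ)
    (he : ∀ q ∈ Q, q ∈ arcRect w.length → surfacePt w q ∈ e.source) {v : ℝ × ℝ → ℂ}
    (hv : ContinuousOn v ((Q ∩ arcRect w.length) \ {q₀, q₁}))
    (hvg : ∀ p ∈ Q, ∀ q ∈ Q, q ∉ ({q₀, q₁} : Set (ℝ × ℝ)) → ArcGlued w.length σ d p q → v p = v q)
    (hv2 : ∀ q ∈ (Q ∩ arcRect w.length) \ {q₀, q₁},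
      v q ^ 2 = e (surfacePt w q) - e (surfacePt w q₀)) : False := by
  have hW : ∀ q ∈ arcRect w.length, surfacePt w q ∈ surfacePt w '' (Q ∩ arcRect w.length) ↔
      q ∈ Q := by
    refine fun q hq => ⟨?_, fun h => ⟨q, ⟨h, hq⟩, rfl⟩⟩
    rintro ⟨p, ⟨hp, hpR⟩, h⟩
    rcases (H.surfacePt_eq_iff hpR hq).1 h with h | h
    · rwa [← h]
    · exact hsat p q h hp
  have hWo := isOpen_of_surfacePt hQ hW
  have := H.t2Space
  have hAo : IsOpen (surfacePt w '' (Q ∩ arcRect w.length) \ {surfacePt w q₀}) :=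
    hWo.sdiff isClosed_singleton
  have hA : ∀ q ∈ arcRect w.length,
      surfacePt w q ∈ surfacePt w '' (Q ∩ arcRect w.length) \ {surfacePt w q₀} ↔
      q ∈ Q ∧ q ∉ ({q₀, q₁} : Set (ℝ × ℝ)) := fun q hq => by
    rw [mem_sdiff, hW q hq, mem_singleton_iff, hfib q hq]; rfl
  have hglue : ∀ p q, ArcGlued w.length σ d p q →
      p ∈ arcRect w.length ∧ q ∈ arcRect w.length := by
    rintro p q ⟨i, hi, t, ht, rfl, rfl⟩
    exact ⟨arcPt_mem hi ht, arcPt_mem (H.lt i hi) (flipPar_mem ht)⟩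
  have hcomp : ∀ p q, surfacePt w q ∈
      surfacePt w '' (Q ∩ arcRect w.length) \ {surfacePt w q₀} →
      ArcGlued w.length σ d p q → v p = v q := by
    intro p q hq hpq
    obtain ⟨h1, h2⟩ := (hA q (hglue p q hpq).2).1 hq
    exact hvg p (hsat q p (H.glued_symm hpq) h1) q h1 h2 hpq
  refine not_hasRootOn_punctured e (x := surfacePt w q₀) hWo ((hW _ hq₀R).2 hq₀) ?_
    ⟨surfaceFun v, H.continuousOn_surfaceFun hAo (hv.mono ?_) hcomp, ?_⟩
  · rintro _ ⟨q, ⟨h1, h2⟩, rfl⟩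
    exact he q h1 h2
  · rintro q ⟨h1, h2⟩
    obtain ⟨h3, h4⟩ := (hA q h1).1 h2
    exact ⟨⟨h3, h1⟩, h4⟩
  · intro x hx
    obtain ⟨q, hq, rfl⟩ := exists_surfacePt x
    obtain ⟨h3, h4⟩ := (hA q hq).1 hx
    rw [H.surfaceFun_apply hq fun p hp => hcomp p q hx hp]
    exact hv2 q ⟨⟨h3, hq⟩, h4⟩

/-- Away from the arcs a neighbourhood is a single convex piece of the rectangle. At an end of an
arc it consists of two pieces glued along a segment that starts at the point. Each piece, without
the point, carries a root of the chart coordinate; the punctured segment is connected, so the two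
roots agree there up to one sign `ε`, which is absorbed into the second root. The result contradicts
`false_of_chart`. -/
theorem surfacePt_mem_surfaceBoundary (H : WordPairing w σ d) {q₀ : ℝ × ℝ}
    (hq₀ : q₀ ∈ arcEdge w.length) : surfacePt w q₀ ∈ surfaceBoundary (ArcSurface w) := by
  classical
  rintro ⟨e, he⟩
  have hint : interior (arcRect w.length) =
      Ioo (0 : ℝ) (2 * w.length + 1) ×ˢ Ioo (0 : ℝ) 1 := by
    rw [arcRect, interior_prod_eq, interior_Icc, interior_Icc]
  have hN : (0 : ℝ) ≠ 2 * w.length + 1 := by positivity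
  have hclos : arcRect w.length ⊆ closure (interior (arcRect w.length)) := by
    rw [hint, closure_prod_eq, closure_Ioo hN, closure_Ioo (by norm_num)]
    rfl
  have hconv : Convex ℝ (arcRect w.length) := (convex_Icc _ _).prod (convex_Icc _ _)
  have hO : IsOpen (surfacePt w ⁻¹' e.source) := e.open_source.preimage (continuous_surfacePt w)
  set k : ℝ × ℝ → ℂ := fun q => e (surfacePt w q) - e (surfacePt w q₀) with hk
  have hkc : ContinuousOn k (surfacePt w ⁻¹' e.source) :=
    (e.continuousOn.comp (continuous_surfacePt w).continuousOn fun q hq => hq).sub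
      continuousOn_const
  have hk0 : ∀ q ∈ surfacePt w ⁻¹' e.source, surfacePt w q ≠ surfacePt w q₀ → k q ≠ 0 :=
    fun q hq hne h => hne (e.injOn hq he (sub_eq_zero.1 h))
  have hnint : ∀ q, q ∈ arcRect w.length → (q.1 = 0 ∨ q.1 = 2 * w.length + 1 ∨ q.2 = 0 ∨ q.2 = 1) →
      q ∉ interior (arcRect w.length) := by
    intro q _ h hq
    rw [hint] at hq
    obtain ⟨⟨h1, h2⟩, h3, h4⟩ := hq
    rcases h with h | h | h | h <;> linarith
  have hq₀i : q₀ ∉ interior (arcRect w.length) := by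
    refine hnint q₀ hq₀.1 ?_
    rcases hq₀.2 with h | h | h | h
    · exact Or.inl h
    · exact Or.inr (Or.inl h)
    · exact Or.inr (Or.inr (Or.inl h))
    · exact Or.inr (Or.inr (Or.inr h.1))
  by_cases harc : ∃ i < w.length, ∃ t ∈ Icc (0 : ℝ) 1, q₀ = arcPt i t
  · obtain ⟨i, hi, t₀, ht₀, rfl⟩ := harc
    set q₁ := arcPt (σ i) (flipPar (d i) t₀) with hq₁
    -- Inner points of an arc are not in `arcEdge`. At an end, the nearby parameters other than `t₀`
    -- form one interval; at an inner point they would form two, and no common sign could be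
    -- expected.
    have ht₀' : t₀ = 0 ∨ t₀ = 1 := by
      by_contra! hcon
      obtain ⟨h1, h2⟩ := hcon
      have hlt : 0 < t₀ ∧ t₀ < 1 := ⟨lt_of_le_of_ne ht₀.1 (Ne.symm h1), lt_of_le_of_ne ht₀.2 h2⟩
      have hiN : (i : ℝ) + 1 ≤ w.length := by exact_mod_cast hi
      have hi0 : (0 : ℝ) ≤ i := by positivity
      rcases hq₀.2 with h | h | h | h
      · simp only [arcPt] at h; linarith
      · simp only [arcPt] at h; linarith
      · simp [arcPt] at h
      · exact h.2 i hi ⟨by simp only [arcPt]; linarith, by simp only [arcPt]; linarith⟩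
    have hσ := H.lt i hi
    have hne := H.ne hi
    have ht₁ := flipPar_mem (d := d i) ht₀
    have hpt : surfacePt w q₁ = surfacePt w (arcPt i t₀) := (H.surfacePt_arcPt hi ht₀).symm
    have hq₁R : q₁ ∈ arcRect w.length := arcPt_mem hσ ht₁
    have hq₁e : q₁ ∈ surfacePt w ⁻¹' e.source := by rw [mem_preimage, hpt]; exact he
    have hfib : ∀ q ∈ arcRect w.length,
        surfacePt w q = surfacePt w (arcPt i t₀) ↔ q = arcPt i t₀ ∨ q = q₁ := by
      intro q hq
      refine ⟨fun h => ?_, ?_⟩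
      · rcases (H.surfacePt_eq_iff hq₀.1 hq).1 h.symm with h | ⟨j, hj, s, hs, h1, h2⟩
        · exact Or.inl h.symm
        · obtain ⟨rfl, rfl⟩ := arcPt_inj ht₀ hs h1
          exact Or.inr h2
      · rintro (rfl | rfl)
        · rfl
        · exact hpt
    obtain ⟨r₀, hr₀, hb₀⟩ := exists_openBox_subset hO (q := arcPt i t₀) he
    obtain ⟨r₁, hr₁, hb₁⟩ := exists_openBox_subset hO hq₁e
    -- Different arcs are at distance at least `1`; the bound `1 / 4` makes the two boxes disjoint
    -- and lets each meet only its own arc.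
    obtain ⟨r, hr, hrr₀, hrr₁, hr4⟩ : ∃ r > 0, r ≤ r₀ ∧ r ≤ r₁ ∧ r ≤ 1 / 4 :=
      ⟨min (min r₀ r₁) (1 / 4), lt_min (lt_min hr₀ hr₁) (by norm_num),
        (min_le_left _ _).trans (min_le_left _ _), (min_le_left _ _).trans (min_le_right _ _),
        min_le_right _ _⟩
    have hB₀ := hb₀ r hrr₀
    have hB₁ := hb₁ r hrr₁
    -- membership of arc points in the boxes
    have hbox : ∀ a b : ℕ, ∀ s t : ℝ, s ∈ Icc (0 : ℝ) 1 → t ∈ Icc (0 : ℝ) 1 →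
        (arcPt a s ∈ openBox r (arcPt b t) ↔ a = b ∧ |s - t| < r) := by
      rintro a b s t ⟨hs0, hs1⟩ ⟨ht0, ht1⟩
      constructor
      · rintro ⟨⟨h1, h2⟩, -⟩
        simp only [arcPt] at h1 h2
        have hab : a = b := nat_eq_of_abs_sub_lt (by rw [abs_lt]; constructor <;> linarith)
        subst hab
        exact ⟨rfl, by rw [abs_lt]; constructor <;> linarith⟩
      · rintro ⟨rfl, h⟩
        rw [abs_lt] at h
        refine ⟨⟨?_, ?_⟩, ?_, ?_⟩ <;> simp only [arcPt] <;> linarith [h.1, h.2]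
    have hdisj : ∀ q, q ∈ openBox r (arcPt i t₀) → q ∉ openBox r q₁ := by
      rintro q ⟨⟨h1, h2⟩, -⟩ ⟨⟨h3, h4⟩, -⟩
      simp only [hq₁, arcPt] at h1 h2 h3 h4
      apply hne
      have ha := ht₀.1
      have hb := ht₀.2
      have hc := ht₁.1
      have hd := ht₁.2
      refine nat_eq_of_abs_sub_lt (by rw [abs_lt]; constructor <;> linarith)
    have hpair : ∀ p q, ArcGlued w.length σ d p q →
        (p ∈ openBox r (arcPt i t₀) → ∃ s ∈ Icc (0 : ℝ) 1, |s - t₀| < r ∧ p = arcPt i s ∧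
          q = arcPt (σ i) (flipPar (d i) s)) ∧
        (p ∈ openBox r q₁ → ∃ s ∈ Icc (0 : ℝ) 1, |s - t₀| < r ∧ q = arcPt i s ∧
          p = arcPt (σ i) (flipPar (d i) s)) := by
      rintro p q ⟨j, hj, s, hs, rfl, rfl⟩
      refine ⟨fun h => ?_, fun h => ?_⟩
      · obtain ⟨rfl, h'⟩ := (hbox _ _ _ _ hs ht₀).1 h
        exact ⟨s, hs, h', rfl, rfl⟩
      · obtain ⟨rfl, h'⟩ := (hbox _ _ _ _ hs ht₁).1 h
        refine ⟨flipPar (d i) s, flipPar_mem hs, ?_, ?_, ?_⟩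
        · rw [← abs_flipPar_sub (d i)]; simpa using h'
        · rw [H.invol i hi, H.dir i hi]
        · simp
    have hbox' : ∀ s ∈ Icc (0 : ℝ) 1, |s - t₀| < r →
        arcPt (σ i) (flipPar (d i) s) ∈ openBox r q₁ := fun s hs h =>
      (hbox _ _ _ _ (flipPar_mem hs) ht₁).2 ⟨rfl, by rwa [abs_flipPar_sub]⟩
    have hsub₀ : (openBox r (arcPt i t₀) ∩ arcRect w.length) \ {arcPt i t₀} ⊆
        surfacePt w ⁻¹' e.source := fun q hq => hB₀ hq.1.1
    have hsub₁ : (openBox r q₁ ∩ arcRect w.length) \ {q₁} ⊆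
        surfacePt w ⁻¹' e.source := fun q hq => hB₁ hq.1.1
    have hne₀ : ∀ q ∈ (openBox r (arcPt i t₀) ∩ arcRect w.length) \ {arcPt i t₀},
        surfacePt w q ≠ surfacePt w (arcPt i t₀) := by
      rintro q ⟨⟨h1, h2⟩, h3⟩ h
      rcases (hfib q h2).1 h with h | h
      · exact h3 h
      · rw [h] at h1
        exact hdisj _ h1 (mem_openBox_self hr _)
    have hne₁ : ∀ q ∈ (openBox r q₁ ∩ arcRect w.length) \ {q₁},
        surfacePt w q ≠ surfacePt w (arcPt i t₀) := by
      rintro q ⟨⟨h1, h2⟩, h3⟩ h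
      rcases (hfib q h2).1 h with h | h
      · rw [h] at h1
        exact hdisj _ (mem_openBox_self hr _) h1
      · exact h3 h
    obtain ⟨v₀, hv₀c, hv₀⟩ := hasRootOn_openBox_diff hconv (hclos hq₀.1) hq₀i hr
      (hkc.mono hsub₀) fun q hq => hk0 q (hsub₀ hq) (hne₀ q hq)
    obtain ⟨v₁, hv₁c, hv₁⟩ := hasRootOn_openBox_diff hconv (hclos hq₁R)
      (hnint q₁ hq₁R (by simp [hq₁, arcPt])) hr
      (hkc.mono hsub₁) fun q hq => hk0 q (hsub₁ hq) (hne₁ q hq)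
    -- the two roots agree up to a sign along the common arc
    have hseg : ∀ s ∈ Icc (0 : ℝ) 1, |s - t₀| < r → s ≠ t₀ →
        arcPt i s ∈ (openBox r (arcPt i t₀) ∩ arcRect w.length) \ {arcPt i t₀} ∧
        arcPt (σ i) (flipPar (d i) s) ∈ (openBox r q₁ ∩ arcRect w.length) \ {q₁} := by
      intro s hs h hst
      refine ⟨⟨⟨(hbox _ _ _ _ hs ht₀).2 ⟨rfl, h⟩, arcPt_mem hi hs⟩, fun h' => ?_⟩,
        ⟨⟨hbox' s hs h, arcPt_mem hσ (flipPar_mem hs)⟩, fun h' => ?_⟩⟩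
      · exact hst (arcPt_inj hs ht₀ h').2
      · have := (arcPt_inj (flipPar_mem hs) ht₁ h').2
        exact hst (by simpa using congrArg (flipPar (d i)) this)
    obtain ⟨ε, hε, hag⟩ : ∃ ε : ℂ, ε ^ 2 = 1 ∧ ∀ s ∈ Icc (0 : ℝ) 1, |s - t₀| < r → s ≠ t₀ →
        v₀ (arcPt i s) = ε * v₁ (arcPt (σ i) (flipPar (d i) s)) := by
      have hcon : IsPreconnected {s : ℝ | s ∈ Icc (0 : ℝ) 1 ∧ |s - t₀| < r ∧ s ≠ t₀} := by
        rcases ht₀' with rfl | rfl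
        · convert (isPreconnected_Ioo : IsPreconnected (Ioo (0 : ℝ) r)) using 1
          ext s
          simp only [mem_ofPred_eq, sub_zero, abs_lt, mem_Icc, mem_Ioo]
          constructor
          · rintro ⟨⟨h1, h2⟩, ⟨h3, h4⟩, h5⟩
            exact ⟨lt_of_le_of_ne h1 (Ne.symm h5), h4⟩
          · rintro ⟨h1, h2⟩
            exact ⟨⟨h1.le, by linarith⟩, ⟨by linarith, h2⟩, h1.ne'⟩
        · convert (isPreconnected_Ioo : IsPreconnected (Ioo (1 - r : ℝ) 1)) using 1
          ext s
          simp only [mem_ofPred_eq, abs_lt, mem_Icc, mem_Ioo]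
          constructor
          · rintro ⟨⟨h1, h2⟩, ⟨h3, h4⟩, h5⟩
            exact ⟨by linarith, lt_of_le_of_ne h2 h5⟩
          · rintro ⟨h1, h2⟩
            exact ⟨⟨by linarith, h2.le⟩, ⟨by linarith, by linarith⟩, h2.ne⟩
      have hc₀ : ContinuousOn (fun s => v₀ (arcPt i s))
          {s : ℝ | s ∈ Icc (0 : ℝ) 1 ∧ |s - t₀| < r ∧ s ≠ t₀} :=
        hv₀c.comp (continuous_arcPt i).continuousOn fun s hs => (hseg s hs.1 hs.2.1 hs.2.2).1
      have hc₁ : ContinuousOn (fun s => v₁ (arcPt (σ i) (flipPar (d i) s)))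
          {s : ℝ | s ∈ Icc (0 : ℝ) 1 ∧ |s - t₀| < r ∧ s ≠ t₀} :=
        hv₁c.comp ((continuous_arcPt _).comp (continuous_flipPar _)).continuousOn
          fun s hs => (hseg s hs.1 hs.2.1 hs.2.2).2
      rcases hcon.eq_or_eq_neg_of_sq_eq hc₀ hc₁ (fun s hs => by
          obtain ⟨h1, h2⟩ := hseg s hs.1 hs.2.1 hs.2.2
          simp only [Pi.pow_apply, hv₀ _ h1, hv₁ _ h2, hk]
          rw [← H.surfacePt_arcPt hi hs.1]) (fun {s} hs h => by
          obtain ⟨h1, h2⟩ := hseg s hs.1 hs.2.1 hs.2.2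
          have := hv₁ _ h2
          rw [h] at this
          exact hk0 _ (hsub₁ h2) (hne₁ _ h2) (by rw [← this]; simp)) with h | h
      · exact ⟨1, by norm_num, fun s h1 h2 h3 => by simpa using h ⟨h1, h2, h3⟩⟩
      · exact ⟨-1, by norm_num, fun s h1 h2 h3 => by simpa using h ⟨h1, h2, h3⟩⟩
    refine H.false_of_chart (Q := openBox r (arcPt i t₀) ∪ openBox r q₁)
      (v := fun q => if q ∈ openBox r (arcPt i t₀) then v₀ q else ε * v₁ q)
      ((isOpen_openBox _ _).union (isOpen_openBox _ _)) (Or.inl (mem_openBox_self hr _)) hq₀.1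
      ?_ hfib e ?_ ?_ ?_ ?_
    · rintro p q hpq (h | h)
      · obtain ⟨s, hs, hst, -, rfl⟩ := (hpair p q hpq).1 h
        exact Or.inr (hbox' s hs hst)
      · obtain ⟨s, hs, hst, rfl, -⟩ := (hpair p q hpq).2 h
        exact Or.inl ((hbox _ _ _ _ hs ht₀).2 ⟨rfl, hst⟩)
    · rintro q (h | h) -
      · exact hB₀ h
      · exact hB₁ h
    · rintro q ⟨⟨hq, hqR⟩, hqn⟩
      simp only [mem_insert_iff, mem_singleton_iff, not_or] at hqn
      rcases hq with h | h
      · have h1 : ContinuousWithinAt v₀ ((openBox r (arcPt i t₀) ∩ arcRect w.length) \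
            {arcPt i t₀}) q := hv₀c q ⟨⟨h, hqR⟩, hqn.1⟩
        have hn := (isOpen_openBox r (arcPt i t₀)).mem_nhds h
        refine ContinuousWithinAt.congr_of_eventuallyEq (f := v₀) ?_ ?_ (by simp [h])
        · rw [← continuousWithinAt_inter hn]
          exact h1.mono fun p hp => ⟨⟨hp.2, hp.1.1.2⟩, fun h' => hp.1.2 (Or.inl h')⟩
        · filter_upwards [mem_nhdsWithin_of_mem_nhds hn] with p hp
          simp [hp]
      · have h1 : ContinuousWithinAt v₁ ((openBox r q₁ ∩ arcRect w.length) \ {q₁}) q :=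
          hv₁c q ⟨⟨h, hqR⟩, hqn.2⟩
        have hn := (isOpen_openBox r q₁).mem_nhds h
        have hnm : ∀ p ∈ openBox r q₁, p ∉ openBox r (arcPt i t₀) := fun p hp hp' => hdisj p hp' hp
        refine ContinuousWithinAt.congr_of_eventuallyEq (f := fun p => ε * v₁ p) ?_ ?_
          (by simp [hnm q h])
        · rw [← continuousWithinAt_inter hn]
          exact continuousWithinAt_const.mul
            (h1.mono fun p hp => ⟨⟨hp.2, hp.1.1.2⟩, fun h' => hp.1.2 (Or.inr h')⟩)
        · filter_upwards [mem_nhdsWithin_of_mem_nhds hn] with p hp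
          simp [hnm p hp]
    · intro p hp q hq hqn hpq
      simp only [mem_insert_iff, mem_singleton_iff, not_or] at hqn
      have hstep : ∀ s ∈ Icc (0 : ℝ) 1, |s - t₀| < r → s ≠ t₀ →
          (if arcPt i s ∈ openBox r (arcPt i t₀) then v₀ (arcPt i s) else ε * v₁ (arcPt i s)) =
          if arcPt (σ i) (flipPar (d i) s) ∈ openBox r (arcPt i t₀) then
            v₀ (arcPt (σ i) (flipPar (d i) s)) else ε * v₁ (arcPt (σ i) (flipPar (d i) s)) := by
        intro s hs hst hsn
        rw [if_pos ((hbox _ _ _ _ hs ht₀).2 ⟨rfl, hst⟩),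
          if_neg fun h' => hdisj _ h' (hbox' s hs hst)]
        exact hag s hs hst hsn
      rcases hp with h | h
      · obtain ⟨s, hs, hst, rfl, rfl⟩ := (hpair p q hpq).1 h
        exact hstep s hs hst fun h' => hqn.2 (by rw [h'])
      · obtain ⟨s, hs, hst, rfl, rfl⟩ := (hpair p q hpq).2 h
        exact (hstep s hs hst fun h' => hqn.1 (by rw [h'])).symm
    · rintro q ⟨⟨hq, hqR⟩, hqn⟩
      simp only [mem_insert_iff, mem_singleton_iff, not_or] at hqn
      rcases hq with h | h
      · simp only [h, if_true]
        exact hv₀ q ⟨⟨h, hqR⟩, hqn.1⟩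
      · have hnm : q ∉ openBox r (arcPt i t₀) := fun h' => hdisj q h' h
        simp only [hnm, if_false, mul_pow, hε, one_mul]
        exact hv₁ q ⟨⟨h, hqR⟩, hqn.2⟩
  · have hnoarc : ∀ p q, ArcGlued w.length σ d p q →
        p ∈ ⋃ i : Fin w.length, arcPt i '' Icc (0 : ℝ) 1 := by
      rintro p q ⟨i, hi, t, ht, rfl, rfl⟩
      exact mem_iUnion.2 ⟨⟨i, hi⟩, t, ht, rfl⟩
    have harcs : IsClosed (⋃ i : Fin w.length, arcPt i '' Icc (0 : ℝ) 1) :=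
      isClosed_iUnion_of_finite fun i => (isCompact_Icc.image (continuous_arcPt _)).isClosed
    have hq₀n : q₀ ∉ ⋃ i : Fin w.length, arcPt i '' Icc (0 : ℝ) 1 := by
      intro h
      obtain ⟨i, t, ht, h⟩ := mem_iUnion.1 h
      exact harc ⟨i, i.2, t, ht, h.symm⟩
    obtain ⟨r, hr, hb⟩ := exists_openBox_subset (hO.inter harcs.isOpen_compl)
      (q := q₀) ⟨he, hq₀n⟩
    have hB := hb r le_rfl
    have hng : ∀ p q, ArcGlued w.length σ d p q → p ∉ openBox r q₀ := fun p q h hp =>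
      (hB hp).2 (hnoarc p q h)
    -- The point is alone in its fibre; `false_of_chart` is applied with `q₁ = q₀`.
    have hfib : ∀ q ∈ arcRect w.length, surfacePt w q = surfacePt w q₀ ↔ q = q₀ ∨ q = q₀ := by
      intro q hq
      rw [or_self]
      refine ⟨fun h => ?_, fun h => by rw [h]⟩
      rcases (H.surfacePt_eq_iff hq₀.1 hq).1 h.symm with h | h
      · exact h.symm
      · exact absurd (mem_openBox_self hr _) (hng _ _ h)
    have hsub : (openBox r q₀ ∩ arcRect w.length) \ {q₀} ⊆ surfacePt w ⁻¹' e.source :=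
      fun q hq => (hB hq.1.1).1
    obtain ⟨v, hvc, hv⟩ := hasRootOn_openBox_diff hconv (hclos hq₀.1) hq₀i hr
      (hkc.mono hsub) fun q hq => hk0 q (hsub hq) fun h => by
        rcases (hfib q hq.1.2).1 h with h | h <;> exact hq.2 h
    refine H.false_of_chart (Q := openBox r q₀) (v := v) (isOpen_openBox _ _)
      (mem_openBox_self hr _) hq₀.1 (fun p q h hp => absurd hp (hng p q h)) hfib e
      (fun q hq _ => (hB hq).1) ?_ (fun p hp q _ _ h => absurd hp (hng p q h)) ?_
    · simpa using hvc
    · simpa using hv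

theorem surfaceBoundary_eq (H : WordPairing w σ d) :
    surfaceBoundary (ArcSurface w) = surfacePt w '' arcEdge w.length := by
  refine Subset.antisymm H.surfaceBoundary_subset ?_
  rintro _ ⟨q, hq, rfl⟩
  exact H.surfacePt_mem_surfaceBoundary hq

end WordPairing

/-! ### The standard words -/

theorem List.flatMap_range_eq_map_range {α : Type*} {c : ℕ} {f : ℕ → List α} {F : ℕ → α}
    (h : ∀ j, f j = (List.range c).map fun r => F (c * j + r)) (g : ℕ) :
    (List.range g).flatMap f = (List.range (c * g)).map F := by
  induction g with
  | zero => simp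
  | succ g ih =>
    rw [List.range_succ, List.flatMap_append, ih, Nat.mul_succ, List.range_add]
    simp [h]

/-- The number of letters of the standard word that belong to handles or crosscaps. -/
def genusLength (o : Bool) (g : ℕ) : ℕ := if o then 4 * g else 2 * g

/-- The letters of the standard word. -/
def stdLetter (o : Bool) (g i : ℕ) : ℕ × Bool :=
  if i < genusLength o g then
    if o then (2 * (i / 4) + i % 2, decide (i % 4 < 2)) else (i / 2, true)
  else (genusLength o g / 2 + (i - genusLength o g) / 2, decide (i % 2 = 0))

/-- The arc that is identified with the `i`-th arc. -/
def stdPartner (o : Bool) (g i : ℕ) : ℕ :=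
  if o = true ∧ i < genusLength o g then (if i % 4 < 2 then i + 2 else i - 2)
  else (if i % 2 = 0 then i + 1 else i - 1)

/-- Whether the `i`-th arc belongs to a crosscap. -/
def stdDir (o : Bool) (g i : ℕ) : Bool := decide (o = false ∧ i < genusLength o g)

theorem surfaceWord_eq_map (o : Bool) (g m : ℕ) :
    surfaceWord o g m = (List.range (genusLength o g + 2 * (m - 1))).map (stdLetter o g) := by
  have hr4 : List.range 4 = [0, 1, 2, 3] := rfl
  have hr2 : List.range 2 = [0, 1] := rfl
  rw [List.range_add, List.map_append, List.map_map]
  cases o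
  · rw [surfaceWord]
    congr 1
    · rw [List.flatMap_range_eq_map_range (c := 2) (F := fun i => (i / 2, true))]
      · refine List.map_congr_left fun i hi => ?_
        simp only [List.mem_range] at hi
        simp [stdLetter, genusLength, hi]
      · intro j
        simp only [hr2, List.map_cons, List.map_nil, List.cons.injEq, Prod.mk.injEq, and_true]
        omega
    · rw [List.flatMap_range_eq_map_range (c := 2)
        (F := fun i => (g + i / 2, decide (i % 2 = 0)))]
      · refine List.map_congr_left fun i hi => ?_
        simp [stdLetter, genusLength]
      · intro j
        simp only [hr2, List.map_cons, List.map_nil, List.cons.injEq, Prod.mk.injEq, and_true]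
        refine ⟨⟨by omega, ?_⟩, ⟨by omega, ?_⟩⟩
        · symm; simp
        · symm; simp
  · rw [surfaceWord]
    congr 1
    · rw [List.flatMap_range_eq_map_range (c := 4)
        (F := fun i => (2 * (i / 4) + i % 2, decide (i % 4 < 2)))]
      · refine List.map_congr_left fun i hi => ?_
        simp only [List.mem_range] at hi
        simp [stdLetter, genusLength, hi]
      · intro j
        have e0 : (4 * j + 0) % 4 = 0 := by omega
        have e1 : (4 * j + 1) % 4 = 1 := by omega
        have e2 : (4 * j + 2) % 4 = 2 := by omega
        have e3 : (4 * j + 3) % 4 = 3 := by omega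
        simp only [hr4, List.map_cons, List.map_nil, List.cons.injEq, Prod.mk.injEq, and_true,
          e0, e1, e2, e3]
        refine ⟨⟨by omega, by simp⟩, ⟨by omega, by simp⟩, ⟨by omega, by simp⟩, by omega, by simp⟩
    · rw [List.flatMap_range_eq_map_range (c := 2)
        (F := fun i => (2 * g + i / 2, decide (i % 2 = 0)))]
      · refine List.map_congr_left fun i hi => ?_
        have : (4 * g + i) % 2 = i % 2 := by omega
        simp only [stdLetter, genusLength, Function.comp_apply, if_true, Nat.add_sub_cancel_left,
          this]
        rw [if_neg (by omega), show 4 * g / 2 = 2 * g by omega]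
      · intro j
        simp only [hr2, List.map_cons, List.map_nil, List.cons.injEq, Prod.mk.injEq, and_true]
        refine ⟨⟨by omega, ?_⟩, ⟨by omega, ?_⟩⟩
        · symm; simp
        · symm; simp

theorem length_surfaceWord (o : Bool) (g m : ℕ) :
    (surfaceWord o g m).length = genusLength o g + 2 * (m - 1) := by
  simp [surfaceWord_eq_map]

theorem getElem_surfaceWord {o : Bool} {g m i : ℕ} (hi : i < (surfaceWord o g m).length) :
    (surfaceWord o g m)[i] = stdLetter o g i := by
  simp [surfaceWord_eq_map]

theorem genusLength_mod_two (o : Bool) (g : ℕ) : genusLength o g % 2 = 0 := by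
  cases o <;> simp [genusLength] <;> omega

theorem wordPairing_surfaceWord (o : Bool) (g m : ℕ) :
    WordPairing (surfaceWord o g m) (stdPartner o g) (stdDir o g) := by
  have hg := genusLength_mod_two o g
  refine ⟨?_, ?_, ?_, ?_, ?_⟩
  · intro i hi
    rw [length_surfaceWord] at *
    unfold stdPartner
    cases o <;> simp only [genusLength] at * <;> split_ifs <;> simp_all <;> omega
  · intro i hi
    unfold stdPartner
    cases o <;> simp only [genusLength, reduceCtorEq, false_and, if_false, true_and, if_true] at * <;>
      split_ifs <;> omega
  · intro i hi
    unfold stdPartner stdDir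
    cases o <;> simp only [genusLength, reduceCtorEq, false_and, if_false, true_and, if_true,
      decide_eq_decide] at * <;> split_ifs <;> omega
  · intro i j hi hj
    rw [getElem_surfaceWord, getElem_surfaceWord]
    unfold stdPartner stdLetter
    cases o <;> simp only [genusLength, reduceCtorEq, false_and, if_false, true_and, if_true,
      Bool.false_eq_true] at * <;> split_ifs <;> simp only [] <;> omega
  · intro i hi hj
    rw [getElem_surfaceWord, getElem_surfaceWord]
    unfold stdPartner stdLetter stdDir
    cases o <;> simp only [genusLength, reduceCtorEq, false_and, if_false, true_and, if_true,
      Bool.false_eq_true] at * <;> split_ifs <;>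
      simp only [decide_eq_decide, decide_eq_true_eq, true_iff, decide_false, decide_true,
        iff_false, Bool.false_eq_true, Bool.true_eq, true_eq_decide_iff, decide_eq_false_iff_not,
        iff_true] <;> omega

/-! ### The boundary components of the standard surfaces -/

/-- The boundary segment of the `k`-th further hole. -/
def smallEdge (b k : ℕ) : Set (ℝ × ℝ) :=
  {q | q.2 = 1 ∧ q.1 ∈ Icc (2 * ((b : ℝ) + 2 * k + 1)) (2 * ((b : ℝ) + 2 * k + 1) + 1)}

/-- The boundary segments that do not belong to a further hole. -/
def outerEdge (b M : ℕ) : Set (ℝ × ℝ) :=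
  {q | q ∈ arcEdge (b + 2 * M) ∧ ∀ k < M, q ∉ smallEdge b k}

theorem mem_arcEdge_top {N n : ℕ} (hn : n ≤ N) {q : ℝ × ℝ} (h1 : q.2 = 1)
    (h2 : q.1 ∈ Icc (2 * (n : ℝ)) (2 * n + 1)) : q ∈ arcEdge N := by
  have hn' : (n : ℝ) ≤ N := by exact_mod_cast hn
  have h0 : (0 : ℝ) ≤ n := by positivity
  obtain ⟨h3, h4⟩ := h2
  refine ⟨⟨⟨by linarith, by linarith⟩, by rw [h1]; norm_num, h1.le⟩,
    Or.inr (Or.inr (Or.inr ⟨h1, ?_⟩))⟩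
  rintro i hi ⟨h5, h6⟩
  have h7 : (i : ℝ) < n := by linarith
  have h8 : (n : ℝ) < i + 1 := by linarith
  have h9 : i < n := by exact_mod_cast h7
  have h10 : n < i + 1 := by exact_mod_cast h8
  omega

theorem exists_mem_Icc_of_forall_notMem {N : ℕ} {q : ℝ × ℝ} (hq : q ∈ arcRect N)
    (h : ∀ i < N, q.1 ∉ Ioo (2 * (i : ℝ) + 1) (2 * i + 2)) :
    ∃ n ≤ N, q.1 ∈ Icc (2 * (n : ℝ)) (2 * n + 1) := by
  obtain ⟨⟨h2, h3⟩, -⟩ := hq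
  have hf1 := Nat.floor_le (show 0 ≤ q.1 / 2 by linarith)
  have hf2 := Nat.lt_floor_add_one (q.1 / 2)
  have hle : ⌊q.1 / 2⌋₊ ≤ N := by
    have : (⌊q.1 / 2⌋₊ : ℝ) < N + 1 := by linarith
    have : ⌊q.1 / 2⌋₊ < N + 1 := by exact_mod_cast this
    omega
  refine ⟨⌊q.1 / 2⌋₊, hle, by linarith, ?_⟩
  rcases hle.eq_or_lt with he | hlt
  · rw [he]; exact h3
  · by_contra! hcon
    exact h _ hlt ⟨hcon, by linarith⟩

theorem mem_outerEdge_top {b M n : ℕ} (hn : n ≤ b + 2 * M) (hs : ∀ k < M, n ≠ b + 2 * k + 1)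
    {q : ℝ × ℝ} (h1 : q.2 = 1) (h2 : q.1 ∈ Icc (2 * (n : ℝ)) (2 * n + 1)) :
    q ∈ outerEdge b M := by
  refine ⟨mem_arcEdge_top hn h1 h2, ?_⟩
  rintro k hk ⟨-, h3, h4⟩
  apply hs k hk
  apply nat_eq_of_abs_sub_lt
  obtain ⟨h5, h6⟩ := h2
  push_cast
  rw [abs_lt]
  constructor <;> linarith

theorem mem_outerEdge_left {b M : ℕ} {y : ℝ} (hy : y ∈ Icc (0 : ℝ) 1) : ((0 : ℝ), y) ∈ outerEdge b M := by
  refine ⟨⟨⟨⟨le_rfl, by positivity⟩, hy⟩, Or.inl rfl⟩, ?_⟩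
  rintro k hk ⟨-, h3, h4⟩
  have : (0 : ℝ) < 2 * ((b : ℝ) + 2 * k + 1) := by positivity
  dsimp only at h3
  linarith

theorem mem_outerEdge_right {b M : ℕ} {y : ℝ} (hy : y ∈ Icc (0 : ℝ) 1) :
    ((2 * (b + 2 * M : ℕ) + 1 : ℝ), y) ∈ outerEdge b M := by
  refine ⟨⟨⟨⟨by positivity, le_rfl⟩, hy⟩, Or.inr (Or.inl rfl)⟩, ?_⟩
  rintro k hk ⟨-, h3, h4⟩
  have : (k : ℝ) + 1 ≤ M := by exact_mod_cast hk
  push_cast at h4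
  linarith

theorem mem_outerEdge_bottom {b M : ℕ} {x : ℝ} (hx : x ∈ Icc (0 : ℝ) (2 * (b + 2 * M : ℕ) + 1)) :
    (x, (0 : ℝ)) ∈ outerEdge b M := by
  refine ⟨⟨⟨hx, le_rfl, zero_le_one⟩, Or.inr (Or.inr (Or.inl rfl))⟩, ?_⟩
  rintro k hk ⟨h1, -⟩
  simp at h1

theorem outerEdge_cases {b M : ℕ} {q : ℝ × ℝ} (hq : q ∈ outerEdge b M) :
    (q.1 = 0 ∧ q.2 ∈ Icc (0 : ℝ) 1) ∨
    (q.1 = (2 * (b + 2 * M : ℕ) + 1 : ℝ) ∧ q.2 ∈ Icc (0 : ℝ) 1) ∨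
    (q.2 = 0 ∧ q.1 ∈ Icc (0 : ℝ) (2 * (b + 2 * M : ℕ) + 1)) ∨
    (q.2 = 1 ∧ ∃ n ≤ b + 2 * M, (∀ k < M, n ≠ b + 2 * k + 1) ∧
      q.1 ∈ Icc (2 * (n : ℝ)) (2 * n + 1)) := by
  obtain ⟨⟨hq, h⟩, hs⟩ := hq
  rcases h with h | h | h | ⟨h1, h2⟩
  · exact Or.inl ⟨h, hq.2⟩
  · exact Or.inr (Or.inl ⟨h, hq.2⟩)
  · exact Or.inr (Or.inr (Or.inl ⟨h, hq.1⟩))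
  · obtain ⟨n, hn, hnq⟩ := exists_mem_Icc_of_forall_notMem hq h2
    refine Or.inr (Or.inr (Or.inr ⟨h1, n, hn, ?_, hnq⟩))
    rintro k hk rfl
    exact hs k hk ⟨h1, by push_cast at hnq; exact hnq⟩

/-- A function of the end points of the arcs that is compatible with the identifications and takes
the same value at the ends of the boundary segments is constant along the outer boundary
component. -/
theorem eq_of_chain {α : Type*} {o : Bool} {g M s : ℕ} {Φ : ℕ → α}
    (hglue : ∀ i < genusLength o g + 2 * M,
      Φ (2 * i + 1) = Φ (2 * stdPartner o g i + if stdDir o g i then 1 else 2) ∧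
      Φ (2 * i + 2) = Φ (2 * stdPartner o g i + if stdDir o g i then 2 else 1))
    (hgap : ∀ n, s < n → n < genusLength o g + 2 * M → (∀ k < M, n ≠ genusLength o g + 2 * k + 1) →
      Φ (2 * n) = Φ (2 * n + 1))
    (hs : s ≤ genusLength o g) (hs4 : s % 2 = 0 ∧ (o = true → s % 4 = 0)) (i : ℕ) (hi : s ≤ i)
    (hiN : i < genusLength o g + 2 * M) :
    ((i ≤ genusLength o g ∨ i % 2 = 0) → Φ (2 * i + 1) = Φ (2 * s + 1)) ∧
    ((i < genusLength o g ∨ i % 2 = 1) → Φ (2 * i + 2) = Φ (2 * s + 1)) := by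
  have hb2 := genusLength_mod_two o g
  have hb4 : o = true → genusLength o g % 4 = 0 := by
    rintro rfl
    simp [genusLength]
  set b := genusLength o g with hb
  -- the first arc of a block
  have hole : ∀ i, b ≤ i → i % 2 = 0 → i < b + 2 * M → Φ (2 * i + 1) = Φ (2 * i + 4) := by
    intro i h1 h2 h3
    have := (hglue i h3).1
    rwa [stdDir, stdPartner, if_neg (by omega), if_pos h2, decide_eq_false (by omega)] at this
  -- For the word `a a` the gluings and the inner gap lead through the four end points in the order
  -- 1, 3, 2, 4.
  have crosscap : o = false → ∀ i, i < b → i % 2 = 0 →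
      Φ (2 * i + 1) = Φ (2 * i + 2) ∧ Φ (2 * i + 1) = Φ (2 * i + 3) ∧
      Φ (2 * i + 1) = Φ (2 * i + 4) ∨ ¬ s ≤ i := by
    intro ho i h1 h2
    by_cases hsi : s ≤ i
    swap
    · exact Or.inr hsi
    left
    have h3 := hglue i (by omega)
    have hp : stdPartner o g i = i + 1 := by
      rw [stdPartner, if_neg (by simp [ho]), if_pos h2]
    have hd : stdDir o g i = true := by rw [stdDir, decide_eq_true ⟨ho, h1⟩]
    simp only [hp, hd, if_true] at h3
    have h4 := hgap (i + 1) (by omega) (by omega) (fun k _ => by omega)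
    have e1 : 2 * (i + 1) = 2 * i + 2 := by ring
    simp only [e1, add_assoc, Nat.reduceAdd] at h3 h4
    exact ⟨h3.1.trans h4.symm, h3.1, h3.1.trans (h4.symm.trans h3.2)⟩
  -- For the word `a b a⁻¹ b⁻¹` gluings and inner gaps alternate and lead through the eight end
  -- points in the order 1, 6, 7, 4, 5, 2, 3, 8.
  have handle : o = true → ∀ i, i < b → i % 4 = 0 → s ≤ i → ∀ j ≤ 8, 1 ≤ j →
      Φ (2 * i + j) = Φ (2 * i + 1) := by
    intro ho i h1 h2 hsi
    have h3 : i + 3 < b := by have := hb4 ho; omega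
    have hd : ∀ i, stdDir o g i = false := fun i => by rw [stdDir, decide_eq_false (by simp [ho])]
    have hp : ∀ r, r < 4 → stdPartner o g (i + r) = if r < 2 then i + r + 2 else i + r - 2 := by
      intro r hr
      rw [stdPartner, if_pos ⟨ho, by omega⟩]
      have : (i + r) % 4 = r := by omega
      rw [this]
    have g0 := hglue i (by omega)
    have g1 := hglue (i + 1) (by omega)
    have p0 := hp 0 (by omega)
    have p1 := hp 1 (by omega)
    simp only [add_zero, Nat.reduceLT, if_true] at p0 p1
    simp only [hd, p0, p1, Bool.false_eq_true, if_false] at g0 g1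
    have k1 := hgap (i + 1) (by omega) (by omega) (fun k _ => by omega)
    have k2 := hgap (i + 2) (by omega) (by omega) (fun k _ => by omega)
    have k3 := hgap (i + 3) (by omega) (by omega) (fun k _ => by omega)
    have e1 : 2 * (i + 1) = 2 * i + 2 := by ring
    have e2 : 2 * (i + 2) = 2 * i + 4 := by ring
    have e3 : 2 * (i + 3) = 2 * i + 6 := by ring
    simp only [e1, e2, e3, add_assoc, Nat.reduceAdd] at g0 g1 k1 k2 k3
    have f6 : Φ (2 * i + 6) = Φ (2 * i + 1) := g0.1.symm
    have f7 : Φ (2 * i + 7) = Φ (2 * i + 1) := k3.symm.trans f6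
    have f4 : Φ (2 * i + 4) = Φ (2 * i + 1) := g1.2.trans f7
    have f5 : Φ (2 * i + 5) = Φ (2 * i + 1) := k2.symm.trans f4
    have f2 : Φ (2 * i + 2) = Φ (2 * i + 1) := g0.2.trans f5
    have f3 : Φ (2 * i + 3) = Φ (2 * i + 1) := k1.symm.trans f2
    have f8 : Φ (2 * i + 8) = Φ (2 * i + 1) := g1.1.symm.trans f3
    intro j hj hj1
    interval_cases j <;> first | rfl | assumption
  have start : ∀ i, s ≤ i → i < b + 2 * M → i % 2 = 0 →
      (s < i → Φ (2 * (i - 1) + 2) = Φ (2 * s + 1)) → Φ (2 * i + 1) = Φ (2 * s + 1) := by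
    intro i h1 h2 h3 h5
    rcases h1.eq_or_lt with rfl | h1
    · rfl
    · rw [← h5 h1, ← hgap i h1 h2 fun k hk => by omega]
      congr 1
      omega
  induction i using Nat.strong_induction_on with
  | _ i ih =>
  by_cases hib : i < b
  · cases o
    · have hstart : ∀ i', i' ≤ i → s ≤ i' → i' % 2 = 0 →
          Φ (2 * i' + 1) = Φ (2 * s + 1) := fun i' h1 h2 h3 =>
        start i' h2 (by omega) h3 fun h =>
          (ih (i' - 1) (by omega) (by omega) (by omega)).2 (by omega)
      have hc := (crosscap rfl (i - i % 2) (by omega) (by omega)).resolve_right (by omega)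
      have hst := hstart (i - i % 2) (by omega) (by omega) (by omega)
      rcases Nat.mod_two_eq_zero_or_one i with h | h
      · rw [h, Nat.sub_zero] at hc hst
        exact ⟨fun _ => hst, fun _ => hc.1.symm.trans hst⟩
      · have e1 : 2 * i + 1 = 2 * (i - 1) + 3 := by omega
        have e2 : 2 * i + 2 = 2 * (i - 1) + 4 := by omega
        rw [h] at hc hst
        rw [e1, e2]
        exact ⟨fun _ => hc.2.1.symm.trans hst, fun _ => hc.2.2.symm.trans hst⟩
    · have h4 := hb4 rfl
      have hs4' := hs4.2 rfl
      have hst := start (i - i % 4) (by omega) (by omega) (by omega) fun h =>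
        (ih (i - i % 4 - 1) (by omega) (by omega) (by omega)).2 (by omega)
      have hh := handle rfl (i - i % 4) (by omega) (by omega) (by omega)
      have e1 : 2 * i + 1 = 2 * (i - i % 4) + (2 * (i % 4) + 1) := by omega
      have e2 : 2 * i + 2 = 2 * (i - i % 4) + (2 * (i % 4) + 2) := by omega
      rw [e1, e2]
      exact ⟨fun _ => (hh _ (by omega) (by omega)).trans hst,
        fun _ => (hh _ (by omega) (by omega)).trans hst⟩
  -- In a pair of arcs belonging to a hole only the two outer end points lie on the outer curve; the
  -- two inner ones bound the segment of the hole, hence the parity conditions in the conclusion.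
  · have hst := start (i - i % 2) (by omega) (by omega) (by omega) fun h =>
      (ih (i - i % 2 - 1) (by omega) (by omega) (by omega)).2 (by omega)
    have hh := hole (i - i % 2) (by omega) (by omega) (by omega)
    refine ⟨fun h => ?_, fun h => ?_⟩
    · have : i % 2 = 0 := by omega
      rwa [this, Nat.sub_zero] at hst
    · have : i % 2 = 1 := by omega
      rw [this] at hst hh
      have e2 : 2 * i + 2 = 2 * (i - 1) + 4 := by omega
      rw [e2, ← hh, hst]

/-- The point of the standard surface that is represented by a point of the plane. -/
noncomputable abbrev stdPt (o : Bool) (g M : ℕ) (q : ℝ × ℝ) : ArcSurface (surfaceWord o g (M + 1)) :=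
  surfacePt (surfaceWord o g (M + 1)) q

theorem length_surfaceWord_succ (o : Bool) (g M : ℕ) :
    (surfaceWord o g (M + 1)).length = genusLength o g + 2 * M := by
  simp [length_surfaceWord]

/-- The outer boundary component of the standard surface. -/
def outerCurve (o : Bool) (g M : ℕ) : Set (ArcSurface (surfaceWord o g (M + 1))) :=
  stdPt o g M '' outerEdge (genusLength o g) M

/-- The boundary component of the `k`-th further hole of the standard surface. -/
def smallCurve (o : Bool) (g M k : ℕ) : Set (ArcSurface (surfaceWord o g (M + 1))) :=
  stdPt o g M '' smallEdge (genusLength o g) k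

theorem stdPt_glue {o : Bool} {g M i : ℕ} (hi : i < genusLength o g + 2 * M) :
    stdPt o g M ((2 * i + 1 : ℕ), 1) =
      stdPt o g M ((2 * stdPartner o g i + if stdDir o g i then 1 else 2 : ℕ), 1) ∧
    stdPt o g M ((2 * i + 2 : ℕ), 1) =
      stdPt o g M ((2 * stdPartner o g i + if stdDir o g i then 2 else 1 : ℕ), 1) := by
  have H := wordPairing_surfaceWord o g (M + 1)
  rw [← length_surfaceWord_succ] at hi
  have h0 := H.surfacePt_arcPt hi (t := 0) (by simp)
  have h1 := H.surfacePt_arcPt hi (t := 1) (by simp)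
  constructor
  · convert h0 using 2
    · simp [arcPt]
    · unfold arcPt flipPar
      split_ifs <;> push_cast <;> congr 1 <;> ring
  · convert h1 using 2
    · simp only [arcPt]
      push_cast
      congr 1
      ring
    · unfold arcPt flipPar
      split_ifs <;> push_cast <;> congr 1 <;> ring

theorem stdPt_mem_outerCurve {o : Bool} {g M : ℕ} {q : ℝ × ℝ}
    (hq : q ∈ outerEdge (genusLength o g) M) : stdPt o g M q ∈ outerCurve o g M :=
  mem_image_of_mem _ hq

/-- All sides and gaps are connected. The connected component in the outer curve of the point `(n,
1)` is a function of `n` to which `eq_of_chain` applies, so all gaps lie in one component, joined to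
the other three sides at the corners. -/
theorem isPreconnected_outerCurve (o : Bool) (g M : ℕ) : IsPreconnected (outerCurve o g M) := by
  set b := genusLength o g with hb
  have h00 : ((0 : ℝ), (0 : ℝ)) ∈ outerEdge b M := mem_outerEdge_left (by simp)
  set C : ℝ × ℝ → Set (ArcSurface (surfaceWord o g (M + 1))) := fun q =>
    connectedComponentIn (outerCurve o g M) (stdPt o g M q) with hC
  have hseg : ∀ (A : Set (ℝ × ℝ)), IsPreconnected A → A ⊆ outerEdge b M →
      ∀ p ∈ A, ∀ q ∈ A, C p = C q := by
    intro A hA hsub p hp q hq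
    refine connectedComponentIn_eq ?_
    exact (hA.image _ (continuous_surfacePt _).continuousOn).subset_connectedComponentIn
      (mem_image_of_mem _ hp) (image_mono hsub) (mem_image_of_mem _ hq)
  have htop : ∀ n ≤ b + 2 * M, (∀ k < M, n ≠ b + 2 * k + 1) →
      ∀ x ∈ Icc (2 * (n : ℝ)) (2 * n + 1), ∀ y ∈ Icc (2 * (n : ℝ)) (2 * n + 1),
      C (x, 1) = C (y, 1) := by
    intro n hn hs x hx y hy
    refine hseg (Icc (2 * (n : ℝ)) (2 * n + 1) ×ˢ {1})
      (isPreconnected_Icc.prod isPreconnected_singleton) ?_ (x, 1) ⟨hx, rfl⟩ (y, 1) ⟨hy, rfl⟩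
    rintro q ⟨h1, h2⟩
    exact mem_outerEdge_top hn hs h2 h1
  have hleft : ∀ y ∈ Icc (0 : ℝ) 1, C (0, y) = C (0, 0) := by
    intro y hy
    refine hseg ({0} ×ˢ Icc (0 : ℝ) 1)
      (isPreconnected_singleton.prod isPreconnected_Icc) ?_ (0, y) ⟨rfl, hy⟩ (0, 0) ⟨rfl, by simp⟩
    rintro ⟨_, y⟩ ⟨rfl, h2⟩
    exact mem_outerEdge_left h2
  have hbot : ∀ x ∈ Icc (0 : ℝ) (2 * (b + 2 * M : ℕ) + 1), C (x, 0) = C (0, 0) := by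
    intro x hx
    refine hseg (Icc (0 : ℝ) (2 * (b + 2 * M : ℕ) + 1) ×ˢ {0})
      (isPreconnected_Icc.prod isPreconnected_singleton) ?_ (x, 0) ⟨hx, rfl⟩ (0, 0)
      ⟨⟨le_rfl, by positivity⟩, rfl⟩
    rintro ⟨x, _⟩ ⟨h1, rfl⟩
    exact mem_outerEdge_bottom h1
  have hright : ∀ y ∈ Icc (0 : ℝ) 1, C ((2 * (b + 2 * M : ℕ) + 1 : ℝ), y) = C (0, 0) := by
    intro y hy
    rw [← hbot _ ⟨by positivity, le_rfl⟩]
    refine hseg ({(2 * (b + 2 * M : ℕ) + 1 : ℝ)} ×ˢ Icc (0 : ℝ) 1)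
      (isPreconnected_singleton.prod isPreconnected_Icc) ?_ (_, y) ⟨rfl, hy⟩ (_, 0) ⟨rfl, by simp⟩
    rintro ⟨_, y⟩ ⟨rfl, h2⟩
    exact mem_outerEdge_right h2
  have h1 : C ((1 : ℕ), 1) = C (0, 0) := by
    rw [← hleft 1 (by simp)]
    refine htop 0 (by omega) (fun k _ => by omega) _ ?_ _ ?_ <;> norm_num
  have hall : ∀ q ∈ outerEdge b M, C q = C (0, 0) := by
    rintro ⟨x, y⟩ hq
    rcases outerEdge_cases hq with ⟨rfl, h2⟩ | ⟨rfl, h2⟩ | ⟨rfl, h2⟩ | ⟨rfl, n, hn, hs, h2⟩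
    · exact hleft y h2
    · exact hright y h2
    · exact hbot x h2
    · rw [htop n hn hs x h2 (2 * n) ⟨le_rfl, by linarith⟩]
      rcases Nat.eq_zero_or_pos n with rfl | hn0
      · simpa using hleft 1 (by simp)
      · have := (eq_of_chain (o := o) (g := g) (M := M) (s := 0) (Φ := fun n => C ((n : ℝ), 1))
          (fun i hi => ?_) ?_ (by omega) (by omega) (n - 1) (by omega) (by omega)).2 ?_
        · have e : 2 * (n - 1) + 2 = 2 * n := by omega
          rw [e] at this
          push_cast at this
          rw [this, ← h1]
          simp
        · have := stdPt_glue hi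
          exact ⟨congrArg (connectedComponentIn (outerCurve o g M)) this.1,
            congrArg (connectedComponentIn (outerCurve o g M)) this.2⟩
        · intro n _ hn hs
          push_cast
          exact htop n hn.le hs _ ⟨le_rfl, by linarith⟩ _ ⟨by linarith, le_rfl⟩
        -- If the arc `n - 1` is the first of a pair belonging to a hole, then the gap `n` is the
        -- segment of this hole, which `hs` excludes.
        · by_contra hcon
          have hb2 := genusLength_mod_two o g
          exact hs ((n - 1 - b) / 2) (by omega) (by omega)
  have : outerCurve o g M = C (0, 0) := by
    refine Subset.antisymm ?_ (connectedComponentIn_subset _ _)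
    rintro _ ⟨q, hq, rfl⟩
    rw [← hall q hq]
    exact mem_connectedComponentIn (stdPt_mem_outerCurve hq)
  rw [this]
  exact isPreconnected_connectedComponentIn

theorem isPreconnected_smallCurve (o : Bool) (g M k : ℕ) : IsPreconnected (smallCurve o g M k) := by
  refine IsPreconnected.image ?_ _ (continuous_surfacePt _).continuousOn
  convert (isPreconnected_Icc (a := 2 * ((genusLength o g : ℝ) + 2 * k + 1))
    (b := 2 * ((genusLength o g : ℝ) + 2 * k + 1) + 1)).prod (isPreconnected_singleton (x := (1 : ℝ)))
    using 1
  ext q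
  exact and_comm

theorem surfaceBoundary_surfaceWord (o : Bool) (g M : ℕ) :
    surfaceBoundary (ArcSurface (surfaceWord o g (M + 1))) =
      outerCurve o g M ∪ ⋃ k < M, smallCurve o g M k := by
  rw [(wordPairing_surfaceWord o g (M + 1)).surfaceBoundary_eq, length_surfaceWord_succ]
  ext x
  constructor
  · rintro ⟨q, hq, rfl⟩
    by_cases h : ∀ k < M, q ∉ smallEdge (genusLength o g) k
    · exact Or.inl ⟨q, ⟨hq, h⟩, rfl⟩
    · push Not at h
      obtain ⟨k, hk, h⟩ := h
      exact Or.inr (mem_iUnion₂.2 ⟨k, hk, q, h, rfl⟩)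
  · rintro (⟨q, hq, rfl⟩ | h)
    · exact ⟨q, hq.1, rfl⟩
    · obtain ⟨k, hk, q, hq, rfl⟩ := mem_iUnion₂.1 h
      refine ⟨q, mem_arcEdge_top (n := genusLength o g + 2 * k + 1) (by omega) hq.1 ?_, rfl⟩
      push_cast
      exact hq.2

/-- A function that is `1` on the `k`-th hole and `0` on the other boundary components. -/
noncomputable def holeBump (b k : ℕ) (q : ℝ × ℝ) : ℂ :=
  ((q.2 * (unitClamp (q.1 - (2 * ((b : ℝ) + 2 * k) + 1)) -
    unitClamp (q.1 - (2 * ((b : ℝ) + 2 * k) + 3))) : ℝ) : ℂ)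

theorem continuous_holeBump (b k : ℕ) : Continuous (holeBump b k) := by
  have := continuous_unitClamp
  unfold holeBump
  fun_prop

/-- The bump rises along the arc `b + 2 * k` and falls along its partner `b + 2 * k + 1`, which is
glued in the opposite direction, so the values match; on all other arcs it is `0`. -/
theorem holeBump_glued {o : Bool} {g M k : ℕ} {p q : ℝ × ℝ}
    (h : ArcGlued (genusLength o g + 2 * M) (stdPartner o g) (stdDir o g) p q) :
    holeBump (genusLength o g) k p = holeBump (genusLength o g) k q := by
  obtain ⟨i, hi, t, ⟨ht0, ht1⟩, rfl, rfl⟩ := h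
  have hb2 := genusLength_mod_two o g
  set b := genusLength o g with hb
  have hfar : ∀ j : ℕ, ∀ s ∈ Icc (0 : ℝ) 1, j ≠ b + 2 * k → j ≠ b + 2 * k + 1 →
      holeBump b k (arcPt j s) = 0 := by
    rintro j s ⟨hs0, hs1⟩ h1 h2
    simp only [holeBump, arcPt]
    rcases Nat.lt_or_ge j (b + 2 * k) with h | h
    · have : (j : ℝ) + 1 ≤ b + 2 * k := by exact_mod_cast h
      rw [unitClamp_of_le (by linarith), unitClamp_of_le (by linarith)]
      simp
    · have : (b + 2 * k + 2 : ℝ) ≤ j := by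
        have : b + 2 * k + 2 ≤ j := by omega
        exact_mod_cast this
      rw [unitClamp_of_ge (by linarith), unitClamp_of_ge (by linarith)]
      simp
  have hp : ∀ j, b ≤ j → stdPartner o g j = if j % 2 = 0 then j + 1 else j - 1 := fun j hj => by
    rw [stdPartner, if_neg (by omega)]
  have hd : ∀ j, b ≤ j → stdDir o g j = false := fun j hj => by
    rw [stdDir, decide_eq_false (by omega)]
  have h0 : ∀ s ∈ Icc (0 : ℝ) 1, holeBump b k (arcPt (b + 2 * k) s) = s := by
    rintro s ⟨hs0, hs1⟩
    simp only [holeBump, arcPt]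
    push_cast
    rw [unitClamp_of_le (s := _ - (2 * ((b : ℝ) + 2 * k) + 3)) (by linarith),
      unitClamp_of_mem ⟨by linarith, by linarith⟩]
    push_cast; ring
  have h1 : ∀ s ∈ Icc (0 : ℝ) 1, holeBump b k (arcPt (b + 2 * k + 1) s) = (1 - s : ℝ) := by
    rintro s ⟨hs0, hs1⟩
    simp only [holeBump, arcPt]
    push_cast
    rw [unitClamp_of_ge (by linarith), unitClamp_of_mem ⟨by linarith, by linarith⟩]
    push_cast; ring
  by_cases hi0 : i = b + 2 * k
  · have hpi : stdPartner o g i = b + 2 * k + 1 := by rw [hp i (by omega)]; split_ifs <;> omega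
    rw [hpi, hd i (by omega), hi0, h0 t ⟨ht0, ht1⟩, h1 _ (flipPar_mem ⟨ht0, ht1⟩)]
    simp [flipPar]
  by_cases hi1 : i = b + 2 * k + 1
  · have hpi : stdPartner o g i = b + 2 * k := by rw [hp i (by omega)]; split_ifs <;> omega
    rw [hpi, hd i (by omega), hi1, h1 t ⟨ht0, ht1⟩, h0 _ (flipPar_mem ⟨ht0, ht1⟩)]
    simp [flipPar]
  · have H := wordPairing_surfaceWord o g (M + 1)
    have hi' := hi
    rw [hb, ← length_surfaceWord_succ] at hi'
    have hinv := H.invol i hi'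
    rw [hfar i t ⟨ht0, ht1⟩ hi0 hi1, hfar _ _ (flipPar_mem ⟨ht0, ht1⟩)]
    · intro h
      rw [h, hp _ (by omega)] at hinv
      split_ifs at hinv <;> omega
    · intro h
      rw [h, hp _ (by omega)] at hinv
      split_ifs at hinv <;> omega

theorem holeBump_smallEdge {b k l : ℕ} {q : ℝ × ℝ} (hq : q ∈ smallEdge b l) :
    holeBump b k q = if l = k then 1 else 0 := by
  obtain ⟨h1, h2, h3⟩ := hq
  simp only [holeBump, h1, one_mul]
  split_ifs with h
  · subst h
    rw [unitClamp_of_ge (by linarith), unitClamp_of_le (by linarith)]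
    simp
  · rcases Nat.lt_or_gt_of_ne h with h | h
    · have : (l : ℝ) + 1 ≤ k := by exact_mod_cast h
      rw [unitClamp_of_le (by linarith), unitClamp_of_le (by linarith)]
      simp
    · have : (k : ℝ) + 1 ≤ l := by exact_mod_cast h
      rw [unitClamp_of_ge (by linarith), unitClamp_of_ge (by linarith)]
      simp

theorem holeBump_outerEdge {b M k : ℕ} (hk : k < M) {q : ℝ × ℝ} (hq : q ∈ outerEdge b M) :
    holeBump b k q = 0 := by
  have hk' : (k : ℝ) + 1 ≤ M := by exact_mod_cast hk
  have hb0 : (0 : ℝ) ≤ b := by positivity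
  have hk0 : (0 : ℝ) ≤ k := by positivity
  simp only [holeBump]
  rcases outerEdge_cases hq with ⟨h1, -⟩ | ⟨h1, -⟩ | ⟨h1, -⟩ | ⟨-, n, hn, hs, h2, h3⟩
  · rw [h1, unitClamp_of_le (by linarith), unitClamp_of_le (by linarith)]
    simp
  · push_cast at h1
    rw [unitClamp_of_ge (by linarith), unitClamp_of_ge (by linarith)]
    simp
  · simp [h1]
  · rcases Nat.lt_or_gt_of_ne (hs k hk) with h | h
    · have : (n : ℝ) + 1 ≤ b + 2 * k + 1 := by exact_mod_cast h
      rw [unitClamp_of_le (by linarith), unitClamp_of_le (by linarith)]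
      simp
    · have : (b : ℝ) + 2 * k + 1 + 1 ≤ n := by exact_mod_cast h
      rw [unitClamp_of_ge (by linarith), unitClamp_of_ge (by linarith)]
      simp

theorem surfaceFun_stdPt {o : Bool} {g M : ℕ} {f : ℝ × ℝ → ℂ}
    (hf : ∀ p q, ArcGlued (genusLength o g + 2 * M) (stdPartner o g) (stdDir o g) p q → f p = f q)
    {q : ℝ × ℝ} (hq : q ∈ arcRect (genusLength o g + 2 * M)) :
    surfaceFun f (stdPt o g M q) = f q := by
  rw [← length_surfaceWord_succ] at hf hq
  exact (wordPairing_surfaceWord o g (M + 1)).surfaceFun_apply hq fun p => hf p q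

theorem continuous_surfaceFun_std {o : Bool} {g M : ℕ} {f : ℝ × ℝ → ℂ} (hfc : Continuous f)
    (hf : ∀ p q, ArcGlued (genusLength o g + 2 * M) (stdPartner o g) (stdDir o g) p q →
      f p = f q) :
    Continuous (surfaceFun f : ArcSurface (surfaceWord o g (M + 1)) → ℂ) := by
  rw [← length_surfaceWord_succ] at hf
  rw [← continuousOn_univ]
  exact (wordPairing_surfaceWord o g (M + 1)).continuousOn_surfaceFun isOpen_univ
    hfc.continuousOn fun p q _ => hf p q

theorem mem_arcRect_of_mem_smallEdge {b M k : ℕ} (hk : k < M) {q : ℝ × ℝ} (hq : q ∈ smallEdge b k) :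
    q ∈ arcRect (b + 2 * M) := by
  refine (mem_arcEdge_top (n := b + 2 * k + 1) (by omega) hq.1 ?_).1
  push_cast
  exact hq.2

/-- The boundary components of the standard surface. -/
theorem eq_of_mem_boundaryComponents {o : Bool} {g M : ℕ}
    {γ : Set (ArcSurface (surfaceWord o g (M + 1)))} (hγ : γ ∈ boundaryComponents _) :
    γ = outerCurve o g M ∨ ∃ k < M, γ = smallCurve o g M k := by
  obtain ⟨x, hx, rfl⟩ := hγ
  have hB := surfaceBoundary_surfaceWord o g M
  set γ := connectedComponentIn (surfaceBoundary (ArcSurface (surfaceWord o g (M + 1)))) x with hγ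
  have hxγ : x ∈ γ := mem_connectedComponentIn hx
  have hγB : γ ⊆ outerCurve o g M ∪ ⋃ k < M, smallCurve o g M k := by
    rw [← hB]; exact connectedComponentIn_subset _ _
  -- the bump functions are constant on the component
  have hsm : ∀ k < M, ∀ l < M, ∀ y ∈ smallCurve o g M l,
      surfaceFun (holeBump (genusLength o g) k) y = if l = k then 1 else 0 := by
    rintro k hk l hl _ ⟨q, hq, rfl⟩
    rw [surfaceFun_stdPt (fun p q => holeBump_glued) (mem_arcRect_of_mem_smallEdge hl hq)]
    exact holeBump_smallEdge hq
  have hout : ∀ k < M, ∀ y ∈ outerCurve o g M,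
      surfaceFun (holeBump (genusLength o g) k) y = 0 := by
    rintro k hk _ ⟨q, hq, rfl⟩
    rw [surfaceFun_stdPt (fun p q => holeBump_glued) hq.1.1]
    exact holeBump_outerEdge hk hq
  have hconst : ∀ k < M, ∀ y ∈ γ, surfaceFun (holeBump (genusLength o g) k) y =
      surfaceFun (holeBump (genusLength o g) k) x := by
    intro k hk y hy
    obtain ⟨v, -, hv⟩ := isPreconnected_connectedComponentIn.eqOn_const_of_mapsTo
      (T := ({0, 1} : Set ℂ)) (Set.toFinite _).isDiscrete
      (continuous_surfaceFun_std (continuous_holeBump _ k)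
        (fun p q => holeBump_glued)).continuousOn (fun z hz => by
        rcases hγB hz with h | h
        · simp [hout k hk z h]
        · obtain ⟨l, hl, h⟩ := mem_iUnion₂.1 h
          rw [hsm k hk l hl z h]
          split_ifs <;> simp) ⟨0, by simp⟩
    exact (hv hy).trans (hv hxγ).symm
  rcases hγB hxγ with h | h
  · left
    refine Subset.antisymm (fun y hy => ?_) ?_
    · rcases hγB hy with h' | h'
      · exact h'
      · obtain ⟨l, hl, h'⟩ := mem_iUnion₂.1 h'
        have := hconst l hl y hy
        rw [hsm l hl l hl y h', hout l hl x h] at this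
        simp at this
    · refine (isPreconnected_outerCurve o g M).subset_connectedComponentIn h ?_
      rw [hB]; exact subset_union_left
  · right
    obtain ⟨k, hk, h⟩ := mem_iUnion₂.1 h
    refine ⟨k, hk, Subset.antisymm (fun y hy => ?_) ?_⟩
    · have hc := hconst k hk y hy
      rw [hsm k hk k hk x h] at hc
      rcases hγB hy with h' | h'
      · rw [hout k hk y h'] at hc
        simp at hc
      · obtain ⟨l, hl, h'⟩ := mem_iUnion₂.1 h'
        rw [hsm k hk l hl y h'] at hc
        by_cases hlk : l = k
        · rwa [hlk] at h'
        · simp [hlk] at hc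
    · refine (isPreconnected_smallCurve o g M k).subset_connectedComponentIn h ?_
      rw [hB]
      exact fun y hy => Or.inr (mem_iUnion₂.2 ⟨k, hk, hy⟩)

/-! ### Square roots along the boundary -/

section RootPath

variable {X : Type*} [TopologicalSpace X] {γ : Set X} {k v : X → ℂ} {p : ℝ → X} {a b : ℝ}

theorem root_path_apply (hv : ContinuousOn v γ) (hv2 : ∀ x ∈ γ, v x ^ 2 = k x) (hp : Continuous p)
    (hab : a ≤ b) (hmem : ∀ t ∈ Icc a b, p t ∈ γ) {φ : ℝ → ℝ} (hφ : Continuous φ) {c : ℂ}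
    (hc : c ≠ 0)
    (hk : ∀ t ∈ Icc a b, k (p t) = c * Complex.exp (2 * Real.pi * Complex.I * φ t)) :
    v (p b) = v (p a) * Complex.exp (Real.pi * Complex.I * (φ b - φ a)) :=
  root_apply_eq (v := fun t => v (p t)) hab (hv.comp hp.continuousOn hmem) hφ hc fun t ht => by
    rw [hv2 _ (hmem t ht), hk t ht]

theorem root_path_const (hv : ContinuousOn v γ) (hv2 : ∀ x ∈ γ, v x ^ 2 = k x) (hp : Continuous p)
    (hab : a ≤ b) (hmem : ∀ t ∈ Icc a b, p t ∈ γ) {c : ℂ} (hc : c ≠ 0)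
    (hk : ∀ t ∈ Icc a b, k (p t) = c) : v (p b) = v (p a) := by
  simpa using root_path_apply hv hv2 hp hab hmem (φ := fun _ => 0) continuous_const hc
    fun t ht => by simpa using hk t ht

/-- One full turn of `k` multiplies the root by `-1`, although the path is closed. -/
theorem not_hasRootOn_of_loop (hp : Continuous p) (hab : a ≤ b) (hmem : ∀ t ∈ Icc a b, p t ∈ γ)
    (hloop : p a = p b) {φ : ℝ → ℝ} (hφ : Continuous φ)
    (hk : ∀ t ∈ Icc a b, k (p t) = Complex.exp (2 * Real.pi * Complex.I * φ t))
    (h1 : φ b - φ a = 1) : ¬ HasRootOn γ k := by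
  rintro ⟨v, hv, hv2⟩
  have h := root_path_apply hv hv2 hp hab hmem hφ one_ne_zero fun t ht => by rw [hk t ht, one_mul]
  have h1' : ((φ b : ℂ) - φ a) = 1 := by exact_mod_cast h1
  rw [h1', mul_one, Complex.exp_pi_mul_I, ← hloop] at h
  have h0 : v (p a) = 0 := self_eq_neg.1 (by simpa using h)
  have ha : a ∈ Icc a b := ⟨le_rfl, hab⟩
  have := hv2 _ (hmem a ha)
  rw [h0, hk a ha] at this
  exact Complex.exp_ne_zero _ (by rw [← this]; simp)

end RootPath

/-- The sum of the functions that increase from `0` to `1` along `[2 * n, 2 * n + 1]`, where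
`n ∈ J`. -/
noncomputable def gapSum (J : Finset ℕ) (x : ℝ) : ℝ := ∑ n ∈ J, unitClamp (x - 2 * n)

/-- The function on the rectangle that winds once along `[2 * n, 2 * n + 1]` for `n ∈ J`. -/
noncomputable def gapExp (J : Finset ℕ) (q : ℝ × ℝ) : ℂ :=
  Complex.exp (2 * Real.pi * Complex.I * gapSum J q.1)

theorem continuous_gapSum (J : Finset ℕ) : Continuous (gapSum J) := by
  have := continuous_unitClamp
  unfold gapSum
  fun_prop

theorem continuous_gapExp (J : Finset ℕ) : Continuous (gapExp J) := by
  have := continuous_gapSum J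
  unfold gapExp
  fun_prop

theorem gapExp_ne_zero (J : Finset ℕ) (q : ℝ × ℝ) : gapExp J q ≠ 0 := Complex.exp_ne_zero _

theorem gapSum_singleton (n : ℕ) (x : ℝ) : gapSum {n} x = unitClamp (x - 2 * n) := by
  simp [gapSum]

theorem gapSum_zero (J : Finset ℕ) : gapSum J 0 = 0 :=
  Finset.sum_eq_zero fun n _ => unitClamp_of_le (by
    have : (0 : ℝ) ≤ n := by positivity
    linarith)

theorem gapSum_eq_card {J : Finset ℕ} {N : ℕ} (hJ : ∀ n ∈ J, n ≤ N) :
    gapSum J (2 * N + 1) = J.card := by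
  refine (Finset.sum_congr rfl (g := fun _ => (1 : ℝ)) fun n hn => unitClamp_of_ge ?_).trans (by simp)
  have : (n : ℝ) ≤ N := by exact_mod_cast hJ n hn
  linarith

/-- Outside the open gaps every summand of `gapSum` is `0` or `1`, so the sum is an integer. -/
theorem gapExp_eq_one {J : Finset ℕ} {q : ℝ × ℝ}
    (h : ∀ n ∈ J, q.1 ∉ Ioo (2 * (n : ℝ)) (2 * n + 1)) : gapExp J q = 1 := by
  have : gapSum J q.1 = ((∑ n ∈ J, if 2 * (n : ℝ) + 1 ≤ q.1 then 1 else 0 : ℕ) : ℝ) := by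
    rw [gapSum, Nat.cast_sum]
    refine Finset.sum_congr rfl fun n hn => ?_
    split_ifs with h1
    · rw [unitClamp_of_ge (by linarith), Nat.cast_one]
    · rw [unitClamp_of_le, Nat.cast_zero]
      by_contra! h2
      exact h n hn ⟨by linarith, by linarith⟩
  rw [gapExp, this, mul_comm, Complex.ofReal_natCast]
  exact Complex.exp_nat_mul_two_pi_mul_I _

theorem gapExp_eq_one_of_mem {J : Finset ℕ} {q : ℝ × ℝ} {n : ℕ} (hn : n ∉ J)
    (hq : q.1 ∈ Icc (2 * (n : ℝ)) (2 * n + 1)) : gapExp J q = 1 := by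
  refine gapExp_eq_one fun m hm hq' => hn ?_
  have : n = m := nat_eq_of_abs_sub_lt (by
    rw [abs_lt]; constructor <;> linarith [hq.1, hq.2, hq'.1, hq'.2])
  rwa [this]

theorem gapExp_eq_singleton {J : Finset ℕ} {q : ℝ × ℝ} {n : ℕ} (hn : n ∈ J)
    (hq : q.1 ∈ Icc (2 * (n : ℝ)) (2 * n + 1)) : gapExp J q = gapExp {n} q := by
  have h1 : gapExp (J.erase n) q = 1 := gapExp_eq_one_of_mem (Finset.notMem_erase n J) hq
  have h2 : gapSum J q.1 = gapSum {n} q.1 + gapSum (J.erase n) q.1 := by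
    rw [gapSum_singleton]
    exact (Finset.add_sum_erase J (fun n => unitClamp (q.1 - 2 * (n : ℝ))) hn).symm
  rw [gapExp, h2, Complex.ofReal_add, mul_add, Complex.exp_add]
  exact (congrArg _ h1).trans (mul_one _)

theorem gapExp_arcPt (J : Finset ℕ) (i : ℕ) {t : ℝ} (ht : t ∈ Icc (0 : ℝ) 1) :
    gapExp J (arcPt i t) = 1 := by
  refine gapExp_eq_one fun n _ hn => ?_
  obtain ⟨h1, h2⟩ := hn
  obtain ⟨h3, h4⟩ := ht
  simp only [arcPt] at h1 h2
  have h5 : (n : ℝ) < i + 1 := by linarith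
  have h6 : (i : ℝ) < n := by linarith
  have h7 : n < i + 1 := by exact_mod_cast h5
  have h8 : i < n := by exact_mod_cast h6
  omega

theorem gapExp_glued {o : Bool} {g M : ℕ} (J : Finset ℕ) (p q : ℝ × ℝ)
    (h : ArcGlued (genusLength o g + 2 * M) (stdPartner o g) (stdDir o g) p q) :
    gapExp J p = gapExp J q := by
  obtain ⟨i, hi, t, ht, rfl, rfl⟩ := h
  rw [gapExp_arcPt J _ ht, gapExp_arcPt J _ (flipPar_mem ht)]

/-- The function on the standard surface that winds once along `[2 * n, 2 * n + 1]`, where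
`n ∈ J`. -/
noncomputable def gapFun (o : Bool) (g M : ℕ) (J : Finset ℕ) :
    ArcSurface (surfaceWord o g (M + 1)) → ℂ := surfaceFun (gapExp J)

section GapFun

variable {o : Bool} {g M : ℕ} {J : Finset ℕ}

theorem continuous_gapFun : Continuous (gapFun o g M J) :=
  continuous_surfaceFun_std (continuous_gapExp J) (gapExp_glued J)

theorem gapFun_stdPt {q : ℝ × ℝ} (hq : q ∈ arcRect (genusLength o g + 2 * M)) :
    gapFun o g M J (stdPt o g M q) = gapExp J q :=
  surfaceFun_stdPt (gapExp_glued J) hq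

theorem gapFun_ne_zero (x : ArcSurface (surfaceWord o g (M + 1))) : gapFun o g M J x ≠ 0 :=
  gapExp_ne_zero _ _

theorem mem_arcRect_top {N : ℕ} {x : ℝ} (hx : x ∈ Icc (0 : ℝ) (2 * N + 1)) :
    (x, (1 : ℝ)) ∈ arcRect N := ⟨hx, zero_le_one, le_rfl⟩

theorem gapFun_smallCurve_of_notMem {k : ℕ} (hk : k < M) (hJ : genusLength o g + 2 * k + 1 ∉ J)
    {x : ArcSurface (surfaceWord o g (M + 1))} (hx : x ∈ smallCurve o g M k) :
    gapFun o g M J x = 1 := by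
  obtain ⟨q, hq, rfl⟩ := hx
  rw [gapFun_stdPt (mem_arcRect_of_mem_smallEdge hk hq)]
  refine gapExp_eq_one_of_mem hJ ?_
  push_cast
  exact hq.2

theorem gapFun_smallCurve_of_mem {k : ℕ} (hk : k < M) (hJ : genusLength o g + 2 * k + 1 ∈ J)
    {x : ArcSurface (surfaceWord o g (M + 1))} (hx : x ∈ smallCurve o g M k) :
    gapFun o g M J x = gapFun o g M {genusLength o g + 2 * k + 1} x := by
  obtain ⟨q, hq, rfl⟩ := hx
  rw [gapFun_stdPt (mem_arcRect_of_mem_smallEdge hk hq),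
    gapFun_stdPt (mem_arcRect_of_mem_smallEdge hk hq)]
  refine gapExp_eq_singleton hJ ?_
  push_cast
  exact hq.2

/-- A function on the surface that winds along a closed segment of the upper side has no root. -/
theorem not_hasRootOn_gapFun_segment {γ : Set (ArcSurface (surfaceWord o g (M + 1)))} {a b n : ℕ}
    (hab : a ≤ b) (hb : b ≤ 2 * (genusLength o g + 2 * M) + 1)
    (hloop : stdPt o g M ((a : ℝ), 1) = stdPt o g M ((b : ℝ), 1))
    (hmem : ∀ t ∈ Icc (a : ℝ) b, stdPt o g M (t, 1) ∈ γ) (han : a ≤ 2 * n) (hbn : 2 * n + 1 ≤ b)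
    (hJ : ∀ t ∈ Icc (a : ℝ) b, gapExp J (t, 1) = gapExp {n} (t, 1)) :
    ¬ HasRootOn γ (gapFun o g M J) := by
  have hb' : (b : ℝ) ≤ 2 * (genusLength o g + 2 * M : ℕ) + 1 := by exact_mod_cast hb
  refine not_hasRootOn_of_loop (p := fun t => stdPt o g M (t, 1))
    ((continuous_surfacePt _).comp (by fun_prop)) (Nat.cast_le.2 hab) hmem hloop
    (continuous_gapSum {n}) (fun t ht => ?_) ?_
  · have ha : (0 : ℝ) ≤ a := by positivity
    rw [gapFun_stdPt (mem_arcRect_top ⟨by linarith [ht.1], by linarith [ht.2]⟩), hJ t ht]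
    rfl
  · have h1 : (a : ℝ) ≤ 2 * n := by exact_mod_cast han
    have h2 : 2 * (n : ℝ) + 1 ≤ b := by exact_mod_cast hbn
    rw [gapSum_singleton, gapSum_singleton, unitClamp_of_le (s := (a : ℝ) - 2 * n) (by linarith),
      unitClamp_of_ge (by linarith)]
    norm_num

/-- The curve is the gap between the two arcs of the hole, whose ends are glued together; the
function turns once along it. -/
theorem not_hasRootOn_smallCurve {k : ℕ} (hk : k < M) (hJ : genusLength o g + 2 * k + 1 ∈ J) :
    ¬ HasRootOn (smallCurve o g M k) (gapFun o g M J) := by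
  refine not_hasRootOn_gapFun_segment (a := 2 * (genusLength o g + 2 * k) + 2)
    (b := 2 * (genusLength o g + 2 * k) + 3) (n := genusLength o g + 2 * k + 1)
    (by omega) (by omega) ?_ (fun t ht => ?_) (by omega) (by omega) fun t ht => ?_
  · have := (stdPt_glue (o := o) (g := g) (M := M) (i := genusLength o g + 2 * k) (by omega)).2
    have hb2 := genusLength_mod_two o g
    rw [this, stdPartner, if_neg (by omega), if_pos (by omega), stdDir,
      decide_eq_false (by omega)]
    rfl
  · refine mem_image_of_mem _ ⟨rfl, ?_⟩
    push_cast at ht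
    exact ⟨by linarith [ht.1], by linarith [ht.2]⟩
  · refine gapExp_eq_singleton hJ ?_
    push_cast at ht ⊢
    exact ⟨by linarith [ht.1], by linarith [ht.2]⟩

/-- If `k` is constant on the segments of the outer boundary component that follow the point
`2 * s`, then so is a square root of `k`. -/
theorem root_outerCurve_tail {k v : ArcSurface (surfaceWord o g (M + 1)) → ℂ}
    (hv : ContinuousOn v (outerCurve o g M)) (hv2 : ∀ x ∈ outerCurve o g M, v x ^ 2 = k x) {s : ℕ}
    (hs : s ≤ genusLength o g) (hs4 : s % 2 = 0 ∧ (o = true → s % 4 = 0)) {c : ℂ} (hc : c ≠ 0)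
    (htop : ∀ n, s ≤ n → n ≤ genusLength o g + 2 * M →
      (∀ k < M, n ≠ genusLength o g + 2 * k + 1) →
      ∀ x ∈ Icc (2 * (n : ℝ)) (2 * n + 1), k (stdPt o g M (x, 1)) = c)
    (hright : ∀ y ∈ Icc (0 : ℝ) 1,
      k (stdPt o g M ((2 * (genusLength o g + 2 * M : ℕ) + 1 : ℝ), y)) = c) :
    v (stdPt o g M ((2 * (genusLength o g + 2 * M : ℕ) + 1 : ℝ), 0)) =
      v (stdPt o g M ((2 * s : ℕ), 1)) := by
  have hb2 := genusLength_mod_two o g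
  set N := genusLength o g + 2 * M with hN
  have hgap : ∀ n, s ≤ n → n ≤ N → (∀ k < M, n ≠ genusLength o g + 2 * k + 1) →
      v (stdPt o g M ((2 * n : ℕ), 1)) = v (stdPt o g M ((2 * n + 1 : ℕ), 1)) := by
    intro n h1 h2 h3
    have := root_path_const (p := fun t => stdPt o g M (t, 1)) hv hv2
      ((continuous_surfacePt _).comp (by fun_prop)) (a := 2 * n) (b := 2 * n + 1) (by linarith)
      (fun t ht => stdPt_mem_outerCurve (mem_outerEdge_top h2 h3 rfl ht)) hc (htop n h1 h2 h3)
    push_cast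
    exact this.symm
  have hlast : v (stdPt o g M ((2 * s : ℕ), 1)) = v (stdPt o g M ((2 * N : ℕ), 1)) := by
    rcases (show s ≤ N by omega).eq_or_lt with h | h
    · rw [h]
    · rw [hgap s le_rfl h.le fun k hk => by omega]
      have := (eq_of_chain (o := o) (g := g) (M := M) (s := s)
        (Φ := fun n => v (stdPt o g M ((n : ℝ), 1)))
        (fun i hi => ⟨congrArg v (stdPt_glue hi).1, congrArg v (stdPt_glue hi).2⟩)
        (fun n h1 h2 h3 => hgap n h1.le h2.le h3) hs hs4 (N - 1) (by omega) (by omega)).2 (by omega)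
      have e : 2 * (N - 1) + 2 = 2 * N := by omega
      rw [e] at this
      exact this.symm
  rw [hlast, hgap N (by omega) le_rfl fun k hk => by omega]
  have := root_path_const (p := fun t => stdPt o g M (2 * (N : ℕ) + 1, t)) hv hv2
    ((continuous_surfacePt _).comp (by fun_prop)) (a := 0) (b := 1) (by norm_num)
    (fun t ht => stdPt_mem_outerCurve (mem_outerEdge_right ht)) hc hright
  push_cast
  exact this.symm

/-- The left side of the rectangle. -/
theorem root_outerCurve_left {k v : ArcSurface (surfaceWord o g (M + 1)) → ℂ}
    (hv : ContinuousOn v (outerCurve o g M)) (hv2 : ∀ x ∈ outerCurve o g M, v x ^ 2 = k x) {c : ℂ}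
    (hc : c ≠ 0) (hleft : ∀ y ∈ Icc (0 : ℝ) 1, k (stdPt o g M (0, y)) = c) :
    v (stdPt o g M (0, 0)) = v (stdPt o g M (0, 1)) :=
  (root_path_const (p := fun t => stdPt o g M (0, t)) hv hv2
    ((continuous_surfacePt _).comp (by fun_prop)) (a := 0) (b := 1) (by norm_num)
    (fun _ ht => stdPt_mem_outerCurve (mem_outerEdge_left ht)) hc hleft).symm

/-- The bottom side of the rectangle. -/
theorem root_outerCurve_bottom {k v : ArcSurface (surfaceWord o g (M + 1)) → ℂ}
    (hv : ContinuousOn v (outerCurve o g M)) (hv2 : ∀ x ∈ outerCurve o g M, v x ^ 2 = k x) {c : ℂ}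
    (hc : c ≠ 0) {φ : ℝ → ℝ} (hφ : Continuous φ)
    (hbot : ∀ x ∈ Icc (0 : ℝ) (2 * (genusLength o g + 2 * M : ℕ) + 1),
      k (stdPt o g M (x, 0)) = c * Complex.exp (2 * Real.pi * Complex.I * φ x)) :
    v (stdPt o g M ((2 * (genusLength o g + 2 * M : ℕ) + 1 : ℝ), 0)) =
      v (stdPt o g M (0, 0)) * Complex.exp (Real.pi * Complex.I *
        (φ (2 * (genusLength o g + 2 * M : ℕ) + 1) - φ 0)) :=
  root_path_apply (p := fun t => stdPt o g M (t, 0)) hv hv2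
    ((continuous_surfacePt _).comp (by fun_prop)) (by positivity)
    (fun _ ht => stdPt_mem_outerCurve (mem_outerEdge_bottom ht)) hφ hc hbot

theorem gapExp_top_eq_one (hJ : ∀ n ∈ J, ∃ k < M, n = genusLength o g + 2 * k + 1) {n : ℕ}
    (hn : ∀ k < M, n ≠ genusLength o g + 2 * k + 1) {q : ℝ × ℝ}
    (hq : q.1 ∈ Icc (2 * (n : ℝ)) (2 * n + 1)) : gapExp J q = 1 :=
  gapExp_eq_one_of_mem (fun h => by
    obtain ⟨k, hk, rfl⟩ := hJ n h
    exact hn k hk rfl) hq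

theorem exp_pi_mul_natCast (n : ℕ) : Complex.exp (Real.pi * Complex.I * n) = (-1) ^ n := by
  rw [mul_comm, Complex.exp_nat_mul, Complex.exp_pi_mul_I]

/-- The gaps in `J` belong to small holes, so on the upper side the outer curve meets no turn, and a
root has the same value at both bottom corners. Along the bottom side, however, the root is
multiplied by `(-1) ^ J.card`. -/
theorem not_hasRootOn_outerCurve (hJ : ∀ n ∈ J, ∃ k < M, n = genusLength o g + 2 * k + 1)
    (hodd : Odd J.card) : ¬ HasRootOn (outerCurve o g M) (gapFun o g M J) := by
  rintro ⟨v, hv, hv2⟩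
  have hJN : ∀ n ∈ J, n ≤ genusLength o g + 2 * M := by
    intro n hn
    obtain ⟨k, hk, rfl⟩ := hJ n hn
    omega
  have hright : ∀ y ∈ Icc (0 : ℝ) 1,
      gapFun o g M J (stdPt o g M ((2 * (genusLength o g + 2 * M : ℕ) + 1 : ℝ), y)) = 1 := by
    intro y hy
    rw [gapFun_stdPt (mem_outerEdge_right hy).1.1]
    refine gapExp_top_eq_one (M := M) (o := o) (g := g) hJ (n := genusLength o g + 2 * M)
      (fun k _ => by omega) ⟨?_, le_rfl⟩
    dsimp only
    linarith
  have hleft : ∀ y ∈ Icc (0 : ℝ) 1, gapFun o g M J (stdPt o g M (0, y)) = 1 := by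
    intro y hy
    rw [gapFun_stdPt (mem_outerEdge_left hy).1.1, gapExp, gapSum_zero]
    simp
  have h1 := root_outerCurve_tail hv hv2 (s := 0) (by omega) (by omega) one_ne_zero
    (fun n _ hn hs x hx => by
      rw [gapFun_stdPt (mem_outerEdge_top hn hs rfl hx).1.1]
      exact gapExp_top_eq_one (M := M) (o := o) (g := g) hJ hs hx) hright
  have h2 := root_outerCurve_left hv hv2 one_ne_zero hleft
  have h3 := root_outerCurve_bottom hv hv2 one_ne_zero (continuous_gapSum J) fun x hx => by
    rw [gapFun_stdPt (mem_outerEdge_bottom hx).1.1, one_mul]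
    rfl
  rw [gapSum_eq_card hJN, gapSum_zero, h1, h2, Complex.ofReal_zero, sub_zero,
    Complex.ofReal_natCast, exp_pi_mul_natCast, hodd.neg_one_pow] at h3
  simp only [mul_zero, Nat.cast_zero, mul_neg, mul_one] at h3
  have h4 := hv2 _ (stdPt_mem_outerCurve (mem_outerEdge_left (y := 1) (by simp)))
  rw [self_eq_neg.1 h3] at h4
  exact gapFun_ne_zero _ (by rw [← h4]; simp)

theorem hasRootOn_outerCurve (hJ : ∀ n ∈ J, ∃ k < M, n = genusLength o g + 2 * k + 1)
    (heven : Even J.card) : HasRootOn (outerCurve o g M) (gapFun o g M J) := by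
  have hJN : ∀ n ∈ J, n ≤ genusLength o g + 2 * M := by
    intro n hn
    obtain ⟨k, hk, rfl⟩ := hJ n hn
    omega
  -- A linear interpolation in the height between `1` on the upper side and the exponential of half
  -- the angle on the bottom. These agree on the left side, and on the right side because `J.card`
  -- is even. Inside the rectangle `u` need not be a root.
  let u : ℝ × ℝ → ℂ := fun q =>
    q.2 + (1 - q.2) * Complex.exp (Real.pi * Complex.I * gapSum J q.1)
  have hu1 : ∀ q : ℝ × ℝ, q.2 = 1 → u q = 1 := fun q hq => by simp [u, hq]
  have huc : Continuous u := by
    have := continuous_gapSum J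
    fun_prop
  have hug : ∀ p q, ArcGlued (genusLength o g + 2 * M) (stdPartner o g) (stdDir o g) p q →
      u p = u q := by
    rintro _ _ ⟨i, hi, t, ht, rfl, rfl⟩
    rw [hu1 _ rfl, hu1 _ rfl]
  refine ⟨surfaceFun u, (continuous_surfaceFun_std huc hug).continuousOn, ?_⟩
  rintro _ ⟨q, hq, rfl⟩
  rw [surfaceFun_stdPt hug hq.1.1, gapFun_stdPt hq.1.1]
  rcases outerEdge_cases hq with ⟨h1, -⟩ | ⟨h1, -⟩ | ⟨h1, -⟩ | ⟨h1, n, hn, hs, h2⟩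
  · simp [u, gapExp, h1, gapSum_zero]
  · simp only [u, gapExp, h1, gapSum_eq_card hJN]
    rw [Complex.ofReal_natCast, exp_pi_mul_natCast, heven.neg_one_pow, mul_comm (2 * _ * _),
      Complex.exp_nat_mul_two_pi_mul_I]
    ring
  · simp only [u, gapExp, h1]
    rw [Complex.ofReal_zero, zero_add, sub_zero, one_mul, ← Complex.exp_nat_mul]
    congr 1
    push_cast
    ring
  · rw [hu1 q h1, gapExp_top_eq_one hJ hs h2, one_pow]

end GapFun

/-! ### Functions that wind along a handle or a crosscap -/

/-- The function that makes half a turn along `[2 * n, 2 * n + 1]`. -/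
noncomputable def halfTurn (n : ℕ) (x : ℝ) : ℂ :=
  Complex.exp (Real.pi * Complex.I * gapSum {n} x)

theorem continuous_halfTurn (n : ℕ) : Continuous (halfTurn n) := by
  have := continuous_gapSum {n}
  unfold halfTurn
  fun_prop

theorem halfTurn_sq (n : ℕ) (q : ℝ × ℝ) : halfTurn n q.1 ^ 2 = gapExp {n} q := by
  rw [halfTurn, gapExp, ← Complex.exp_nat_mul]
  congr 1
  push_cast
  ring

theorem halfTurn_of_le {n : ℕ} {x : ℝ} (h : x ≤ 2 * n) : halfTurn n x = 1 := by
  rw [halfTurn, gapSum_singleton, unitClamp_of_le (by linarith)]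
  simp

theorem halfTurn_of_ge {n : ℕ} {x : ℝ} (h : 2 * n + 1 ≤ x) : halfTurn n x = -1 := by
  rw [halfTurn, gapSum_singleton, unitClamp_of_ge (by linarith)]
  simp

theorem gapExp_singleton_of_le {n : ℕ} {q : ℝ × ℝ} (h : q.1 ≤ 2 * n) : gapExp {n} q = 1 := by
  rw [← halfTurn_sq, halfTurn_of_le h, one_pow]

theorem gapExp_singleton_of_ge {n : ℕ} {q : ℝ × ℝ} (h : 2 * n + 1 ≤ q.1) : gapExp {n} q = 1 := by
  rw [← halfTurn_sq, halfTurn_of_ge h]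
  norm_num

/-- The profile of `handleRoot` on the upper side. -/
noncomputable def handleProfile (x : ℝ) : ℝ :=
  2 * unitClamp (x - 1) - 2 * unitClamp (x - 3) - 2 * unitClamp (x - 5) + 2 * unitClamp (x - 7)

/-- A root on the boundary of the function that winds along the first handle. -/
noncomputable def handleRoot (q : ℝ × ℝ) : ℂ := q.2 * handleProfile q.1 - halfTurn 2 q.1

/-- The profile of `crosscapRoot` on the upper side. -/
noncomputable def crosscapProfile (x : ℝ) : ℂ :=
  ((2 * unitClamp (x - 1) + 2 * unitClamp (x - 3) - 2 : ℝ) : ℂ) + 2 * halfTurn 1 x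

/-- A root on the boundary of the function that winds along the first crosscap. -/
noncomputable def crosscapRoot (q : ℝ × ℝ) : ℂ := q.2 * crosscapProfile q.1 - halfTurn 1 q.1

theorem continuous_handleRoot : Continuous handleRoot := by
  have := continuous_unitClamp
  have := continuous_halfTurn 2
  unfold handleRoot handleProfile
  fun_prop

theorem continuous_crosscapRoot : Continuous crosscapRoot := by
  have := continuous_unitClamp
  have := continuous_halfTurn 1
  unfold crosscapRoot crosscapProfile
  fun_prop

section HandleRoot

variable {q : ℝ × ℝ}

theorem handleRoot_of_le (h : q.1 ≤ 1) : handleRoot q = -1 := by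
  rw [handleRoot, handleProfile, halfTurn_of_le (by push_cast; linarith),
    unitClamp_of_le (by linarith), unitClamp_of_le (by linarith), unitClamp_of_le (by linarith),
    unitClamp_of_le (by linarith)]
  simp

theorem handleRoot_of_ge (h : 8 ≤ q.1) : handleRoot q = 1 := by
  rw [handleRoot, handleProfile, halfTurn_of_ge (by push_cast; linarith),
    unitClamp_of_ge (by linarith), unitClamp_of_ge (by linarith), unitClamp_of_ge (by linarith),
    unitClamp_of_ge (by linarith)]
  simp

theorem handleRoot_bottom (h : q.2 = 0) : handleRoot q = -halfTurn 2 q.1 := by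
  simp [handleRoot, h]

theorem handleRoot_arc_zero (h : q.1 ∈ Icc (1 : ℝ) 2) (h1 : q.2 = 1) :
    handleRoot q = (2 * q.1 - 3 : ℝ) := by
  obtain ⟨h2, h3⟩ := h
  rw [handleRoot, handleProfile, halfTurn_of_le (by push_cast; linarith), h1,
    unitClamp_of_mem ⟨by linarith, by linarith⟩, unitClamp_of_le (by linarith),
    unitClamp_of_le (by linarith), unitClamp_of_le (by linarith)]
  push_cast
  ring

theorem handleRoot_gap_one (h : q.1 ∈ Icc (2 : ℝ) 3) (h1 : q.2 = 1) : handleRoot q = 1 := by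
  obtain ⟨h2, h3⟩ := h
  rw [handleRoot, handleProfile, halfTurn_of_le (by push_cast; linarith), h1,
    unitClamp_of_ge (by linarith), unitClamp_of_le (by linarith),
    unitClamp_of_le (by linarith), unitClamp_of_le (by linarith)]
  push_cast
  ring

theorem handleRoot_arc_one (h : q.1 ∈ Icc (3 : ℝ) 4) (h1 : q.2 = 1) :
    handleRoot q = (7 - 2 * q.1 : ℝ) := by
  obtain ⟨h2, h3⟩ := h
  rw [handleRoot, handleProfile, halfTurn_of_le (by push_cast; linarith), h1,
    unitClamp_of_ge (by linarith), unitClamp_of_mem ⟨by linarith, by linarith⟩,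
    unitClamp_of_le (by linarith), unitClamp_of_le (by linarith)]
  push_cast
  ring

theorem handleRoot_gap_two (h : q.1 ∈ Icc (4 : ℝ) 5) (h1 : q.2 = 1) :
    handleRoot q = -halfTurn 2 q.1 := by
  obtain ⟨h2, h3⟩ := h
  rw [handleRoot, handleProfile, h1,
    unitClamp_of_ge (by linarith), unitClamp_of_ge (by linarith),
    unitClamp_of_le (by linarith), unitClamp_of_le (by linarith)]
  push_cast
  ring

theorem handleRoot_arc_two (h : q.1 ∈ Icc (5 : ℝ) 6) (h1 : q.2 = 1) :
    handleRoot q = (11 - 2 * q.1 : ℝ) := by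
  obtain ⟨h2, h3⟩ := h
  rw [handleRoot, handleProfile, halfTurn_of_ge (by push_cast; linarith), h1,
    unitClamp_of_ge (by linarith), unitClamp_of_ge (by linarith),
    unitClamp_of_mem ⟨by linarith, by linarith⟩, unitClamp_of_le (by linarith)]
  push_cast
  ring

theorem handleRoot_gap_three (h : q.1 ∈ Icc (6 : ℝ) 7) (h1 : q.2 = 1) : handleRoot q = -1 := by
  obtain ⟨h2, h3⟩ := h
  rw [handleRoot, handleProfile, halfTurn_of_ge (by push_cast; linarith), h1,
    unitClamp_of_ge (by linarith), unitClamp_of_ge (by linarith),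
    unitClamp_of_ge (by linarith), unitClamp_of_le (by linarith)]
  push_cast
  ring

theorem handleRoot_arc_three (h : q.1 ∈ Icc (7 : ℝ) 8) (h1 : q.2 = 1) :
    handleRoot q = (2 * q.1 - 15 : ℝ) := by
  obtain ⟨h2, h3⟩ := h
  rw [handleRoot, handleProfile, halfTurn_of_ge (by push_cast; linarith), h1,
    unitClamp_of_ge (by linarith), unitClamp_of_ge (by linarith),
    unitClamp_of_ge (by linarith), unitClamp_of_mem ⟨by linarith, by linarith⟩]
  push_cast
  ring

theorem crosscapRoot_of_le (h : q.1 ≤ 1) : crosscapRoot q = -1 := by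
  rw [crosscapRoot, crosscapProfile, halfTurn_of_le (by push_cast; linarith),
    unitClamp_of_le (by linarith), unitClamp_of_le (by linarith)]
  push_cast
  ring

theorem crosscapRoot_of_ge (h : 4 ≤ q.1) : crosscapRoot q = 1 := by
  rw [crosscapRoot, crosscapProfile, halfTurn_of_ge (by push_cast; linarith),
    unitClamp_of_ge (by linarith), unitClamp_of_ge (by linarith)]
  push_cast
  ring

theorem crosscapRoot_bottom (h : q.2 = 0) : crosscapRoot q = -halfTurn 1 q.1 := by
  simp [crosscapRoot, h]

theorem crosscapRoot_arc_zero (h : q.1 ∈ Icc (1 : ℝ) 2) (h1 : q.2 = 1) :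
    crosscapRoot q = (2 * q.1 - 3 : ℝ) := by
  obtain ⟨h2, h3⟩ := h
  rw [crosscapRoot, crosscapProfile, halfTurn_of_le (by push_cast; linarith), h1,
    unitClamp_of_mem ⟨by linarith, by linarith⟩, unitClamp_of_le (by linarith)]
  push_cast
  ring

theorem crosscapRoot_gap_one (h : q.1 ∈ Icc (2 : ℝ) 3) (h1 : q.2 = 1) :
    crosscapRoot q = halfTurn 1 q.1 := by
  obtain ⟨h2, h3⟩ := h
  rw [crosscapRoot, crosscapProfile, h1, unitClamp_of_ge (by linarith),
    unitClamp_of_le (by linarith)]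
  push_cast
  ring

theorem crosscapRoot_arc_one (h : q.1 ∈ Icc (3 : ℝ) 4) (h1 : q.2 = 1) :
    crosscapRoot q = (2 * q.1 - 7 : ℝ) := by
  obtain ⟨h2, h3⟩ := h
  rw [crosscapRoot, crosscapProfile, halfTurn_of_ge (by push_cast; linarith), h1,
    unitClamp_of_ge (by linarith), unitClamp_of_mem ⟨by linarith, by linarith⟩]
  push_cast
  ring

end HandleRoot

/-- Since `s` is the beginning of a block, arcs from `s` on have their partners from `s` on as well,
and there `f` is constant. -/
theorem ArcGlued.eq_of_arcs {o : Bool} {g M s : ℕ} {f : ℝ × ℝ → ℂ} {c : ℂ}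
    (hs4 : s % 2 = 0 ∧ (o = true → s % 4 = 0))
    (h0 : ∀ i < s, ∀ t ∈ Icc (0 : ℝ) 1,
      f (arcPt i t) = f (arcPt (stdPartner o g i) (flipPar (stdDir o g i) t)))
    (h1 : ∀ i, s ≤ i → ∀ t ∈ Icc (0 : ℝ) 1, f (arcPt i t) = c) (p q : ℝ × ℝ)
    (h : ArcGlued (genusLength o g + 2 * M) (stdPartner o g) (stdDir o g) p q) : f p = f q := by
  obtain ⟨i, hi, t, ht, rfl, rfl⟩ := h
  rcases lt_or_ge i s with his | his
  · exact h0 i his t ht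
  · rw [h1 i his t ht, h1 _ _ _ (flipPar_mem ht)]
    have hb2 := genusLength_mod_two o g
    have := hs4.1
    have := hs4.2
    unfold stdPartner
    split_ifs with h2 <;> [skip; have := this h2.1; skip; skip] <;> omega

/-- Across the arcs the root is continued linearly between `-1` and `1`: rising on arcs `0` and `3`,
falling on their partners `2` and `1`, which have the opposite direction. Zeros inside the arcs do
no harm, as these are interior points of the surface. -/
theorem handleRoot_glued {g M : ℕ} (hg : 0 < g) (p q : ℝ × ℝ)
    (h : ArcGlued (genusLength true g + 2 * M) (stdPartner true g) (stdDir true g) p q) :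
    handleRoot p = handleRoot q := by
  have hb : 4 ≤ genusLength true g := by simp [genusLength]; omega
  refine ArcGlued.eq_of_arcs (s := 4) (by simp) ?_ (c := 1) ?_ p q h
  · rintro i hi t ⟨h1, h2⟩
    have hd : stdDir true g i = false := by simp [stdDir]
    rw [hd]
    have hp : stdPartner true g i = if i < 2 then i + 2 else i - 2 := by
      rw [stdPartner, if_pos ⟨rfl, by omega⟩, Nat.mod_eq_of_lt hi]
    rw [hp]
    simp only [flipPar, arcPt, Bool.false_eq_true, if_false]
    interval_cases i <;> norm_num
    · rw [handleRoot_arc_zero ⟨by linarith, by linarith⟩ rfl,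
        handleRoot_arc_two ⟨by dsimp only; linarith, by dsimp only; linarith⟩ rfl]
      push_cast; ring
    · rw [handleRoot_arc_one ⟨by dsimp only; linarith, by dsimp only; linarith⟩ rfl,
        handleRoot_arc_three ⟨by dsimp only; linarith, by dsimp only; linarith⟩ rfl]
      push_cast; ring
    · rw [handleRoot_arc_two ⟨by dsimp only; linarith, by dsimp only; linarith⟩ rfl,
        handleRoot_arc_zero ⟨by dsimp only; linarith, by dsimp only; linarith⟩ rfl]
      push_cast; ring
    · rw [handleRoot_arc_three ⟨by dsimp only; linarith, by dsimp only; linarith⟩ rfl,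
        handleRoot_arc_one ⟨by dsimp only; linarith, by dsimp only; linarith⟩ rfl]
      push_cast; ring
  · rintro i hi t ⟨h1, h2⟩
    have : (4 : ℝ) ≤ i := by exact_mod_cast hi
    exact handleRoot_of_ge (by simp only [arcPt]; linarith)

/-- Arcs `0` and `1` are glued in the same direction, and the root rises linearly from `-1` to `1`
along both. -/
theorem crosscapRoot_glued {g M : ℕ} (hg : 0 < g) (p q : ℝ × ℝ)
    (h : ArcGlued (genusLength false g + 2 * M) (stdPartner false g) (stdDir false g) p q) :
    crosscapRoot p = crosscapRoot q := by
  have hb : 2 ≤ genusLength false g := by simp [genusLength]; omega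
  refine ArcGlued.eq_of_arcs (s := 2) (by simp) ?_ (c := 1) ?_ p q h
  · rintro i hi t ⟨h1, h2⟩
    have hd : stdDir false g i = true := by simp [stdDir]; omega
    have hp : stdPartner false g i = if i = 0 then 1 else 0 := by
      rw [stdPartner, if_neg (by simp)]
      split_ifs <;> omega
    rw [hd, hp]
    simp only [flipPar, arcPt, if_true]
    interval_cases i <;> norm_num
    · rw [crosscapRoot_arc_zero ⟨by linarith, by linarith⟩ rfl,
        crosscapRoot_arc_one ⟨by dsimp only; linarith, by dsimp only; linarith⟩ rfl]
      push_cast; ring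
    · rw [crosscapRoot_arc_one ⟨by dsimp only; linarith, by dsimp only; linarith⟩ rfl,
        crosscapRoot_arc_zero ⟨by dsimp only; linarith, by dsimp only; linarith⟩ rfl]
      push_cast; ring
  · rintro i hi t ⟨h1, h2⟩
    have : (2 : ℝ) ≤ i := by exact_mod_cast hi
    exact crosscapRoot_of_ge (by simp only [arcPt]; linarith)

/-- The outer curve meets the turn of the function twice, on gap `2` and on the bottom side, so a
root can close up. The gluing dictates its signs: `-1` before the handle, then `1` on gap `1`, half
a turn from `-1` to `1` on gap `2`, `-1` on gap `3`, and `1` after the handle. -/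
theorem handleRoot_sq {g M : ℕ} (hg : 0 < g) {q : ℝ × ℝ}
    (hq : q ∈ outerEdge (genusLength true g) M) : handleRoot q ^ 2 = gapExp {2} q := by
  have hb : (4 : ℝ) ≤ genusLength true g := by
    have : 4 ≤ genusLength true g := by simp [genusLength]; omega
    exact_mod_cast this
  have hM : (0 : ℝ) ≤ M := by positivity
  rcases outerEdge_cases hq with ⟨h1, -⟩ | ⟨h1, -⟩ | ⟨h1, -⟩ | ⟨h1, n, hn, hs, h2⟩
  · rw [handleRoot_of_le (by linarith), gapExp_singleton_of_le (by push_cast; linarith)]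
    norm_num
  · push_cast at h1
    rw [handleRoot_of_ge (by linarith), gapExp_singleton_of_ge (by push_cast; linarith)]
    norm_num
  · rw [handleRoot_bottom h1, neg_sq, halfTurn_sq]
  · rcases lt_or_ge n 4 with hn4 | hn4
    · obtain ⟨h3, h4⟩ := h2
      interval_cases n <;> push_cast at h3 h4
      · rw [handleRoot_of_le (by linarith), gapExp_singleton_of_le (by push_cast; linarith)]
        norm_num
      · rw [handleRoot_gap_one ⟨by linarith, by linarith⟩ h1,
          gapExp_singleton_of_le (by push_cast; linarith)]
        norm_num
      · rw [handleRoot_gap_two ⟨by linarith, by linarith⟩ h1, neg_sq, halfTurn_sq]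
      · rw [handleRoot_gap_three ⟨by linarith, by linarith⟩ h1,
          gapExp_singleton_of_ge (by push_cast; linarith)]
        norm_num
    · have : (4 : ℝ) ≤ n := by exact_mod_cast hn4
      rw [handleRoot_of_ge (by linarith [h2.1]),
        gapExp_singleton_of_ge (by push_cast; linarith [h2.1])]
      norm_num

theorem crosscapRoot_sq {g M : ℕ} (hg : 0 < g) {q : ℝ × ℝ}
    (hq : q ∈ outerEdge (genusLength false g) M) : crosscapRoot q ^ 2 = gapExp {1} q := by
  have hb : (2 : ℝ) ≤ genusLength false g := by
    have : 2 ≤ genusLength false g := by simp [genusLength]; omega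
    exact_mod_cast this
  have hM : (0 : ℝ) ≤ M := by positivity
  rcases outerEdge_cases hq with ⟨h1, -⟩ | ⟨h1, -⟩ | ⟨h1, -⟩ | ⟨h1, n, hn, hs, h2⟩
  · rw [crosscapRoot_of_le (by linarith), gapExp_singleton_of_le (by push_cast; linarith)]
    norm_num
  · push_cast at h1
    rw [crosscapRoot_of_ge (by linarith), gapExp_singleton_of_ge (by push_cast; linarith)]
    norm_num
  · rw [crosscapRoot_bottom h1, neg_sq, halfTurn_sq]
  · rcases lt_or_ge n 2 with hn4 | hn4
    · obtain ⟨h3, h4⟩ := h2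
      interval_cases n <;> push_cast at h3 h4
      · rw [crosscapRoot_of_le (by linarith), gapExp_singleton_of_le (by push_cast; linarith)]
        norm_num
      · rw [crosscapRoot_gap_one ⟨by linarith, by linarith⟩ h1, halfTurn_sq]
    · have : (2 : ℝ) ≤ n := by exact_mod_cast hn4
      rw [crosscapRoot_of_ge (by linarith [h2.1]),
        gapExp_singleton_of_ge (by push_cast; linarith [h2.1])]
      norm_num

/-- The segment along which the first handle or crosscap has a winding function. -/
def turnGap (o : Bool) : ℕ := if o then 2 else 1

/-- A loop in the first handle or crosscap. -/
def turnLoop (o : Bool) (g M : ℕ) : Set (ArcSurface (surfaceWord o g (M + 1))) :=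
  (fun t : ℝ => stdPt o g M (t, 1)) '' Icc ((if o then 2 else 1 : ℕ) : ℝ) ((if o then 5 else 3 : ℕ) : ℝ)

theorem genusLength_ge {o : Bool} {g : ℕ} (hg : 0 < g) : (if o then 4 else 2) ≤ genusLength o g := by
  cases o <;> simp [genusLength] <;> omega

/-- In a handle the end `2` of arc `0` is glued to the beginning `5` of arc `2`, and gap `2` lies in
between. In a crosscap the beginnings `1` and `3` of the two arcs are glued, with gap `1` in
between. -/
theorem not_hasRootOn_turnLoop {o : Bool} {g M : ℕ} (hg : 0 < g) :
    ¬ HasRootOn (turnLoop o g M) (gapFun o g M {turnGap o}) := by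
  have hb := genusLength_ge (o := o) hg
  refine not_hasRootOn_gapFun_segment (a := if o then 2 else 1) (b := if o then 5 else 3)
    (n := turnGap o) ?_ ?_ ?_ (fun t ht => mem_image_of_mem _ ht) ?_ ?_ fun t _ => rfl
  · split_ifs <;> omega
  · split_ifs at * <;> omega
  · cases o
    · simp only [Bool.false_eq_true, if_false] at hb ⊢
      have := (stdPt_glue (o := false) (g := g) (M := M) (i := 0) (by omega)).1
      rw [stdPartner, if_neg (by simp), stdDir, decide_eq_true ⟨rfl, by omega⟩] at this
      exact this
    · simp only [if_true] at hb ⊢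
      have := (stdPt_glue (o := true) (g := g) (M := M) (i := 0) (by omega)).2
      rw [stdPartner, if_pos ⟨rfl, by omega⟩, stdDir, decide_eq_false (by simp)] at this
      exact this
  · cases o <;> simp [turnGap]
  · cases o <;> simp [turnGap]

theorem gapFun_turnLoop {o : Bool} {g M : ℕ} (hg : 0 < g) {x : ArcSurface (surfaceWord o g (M + 1))}
    (hx : x ∈ turnLoop o g M) : gapFun o g M {genusLength o g + 1} x = 1 := by
  have hb := genusLength_ge (o := o) hg
  obtain ⟨t, ⟨h1, h2⟩, rfl⟩ := hx
  have h3 : t ≤ 2 * (genusLength o g : ℝ) := by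
    refine h2.trans ?_
    norm_cast
    split_ifs at * <;> omega
  have h0 : (0 : ℝ) ≤ t := le_trans (by positivity) h1
  have hM : (0 : ℝ) ≤ M := by positivity
  dsimp only
  rw [gapFun_stdPt (mem_arcRect_top ⟨h0, by push_cast; linarith⟩),
    gapExp_singleton_of_le (by push_cast; linarith)]

/-- The root on the outer boundary component of the function that winds along the first handle or
crosscap. -/
noncomputable def turnRoot (o : Bool) (g M : ℕ) : ArcSurface (surfaceWord o g (M + 1)) → ℂ :=
  surfaceFun (if o then handleRoot else crosscapRoot)

theorem continuous_turnRoot {o : Bool} {g M : ℕ} (hg : 0 < g) : Continuous (turnRoot o g M) := by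
  cases o
  · exact continuous_surfaceFun_std continuous_crosscapRoot (crosscapRoot_glued hg)
  · exact continuous_surfaceFun_std continuous_handleRoot (handleRoot_glued hg)

theorem turnRoot_true {g M : ℕ} (hg : 0 < g) {q : ℝ × ℝ}
    (hq : q ∈ arcRect (genusLength true g + 2 * M)) :
    turnRoot true g M (stdPt true g M q) = handleRoot q :=
  surfaceFun_stdPt (handleRoot_glued hg) hq

theorem turnRoot_false {g M : ℕ} (hg : 0 < g) {q : ℝ × ℝ}
    (hq : q ∈ arcRect (genusLength false g + 2 * M)) :
    turnRoot false g M (stdPt false g M q) = crosscapRoot q :=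
  surfaceFun_stdPt (crosscapRoot_glued hg) hq

theorem turnRoot_sq {o : Bool} {g M : ℕ} (hg : 0 < g) {x : ArcSurface (surfaceWord o g (M + 1))}
    (hx : x ∈ outerCurve o g M) : turnRoot o g M x ^ 2 = gapFun o g M {turnGap o} x := by
  obtain ⟨q, hq, rfl⟩ := hx
  rw [gapFun_stdPt hq.1.1]
  cases o
  · rw [turnRoot_false hg hq.1.1, crosscapRoot_sq hg hq]; rfl
  · rw [turnRoot_true hg hq.1.1, handleRoot_sq hg hq]; rfl

/-! ### Twisted functions for a single boundary component -/

/-- The function on the double cover of a surface with handles that winds along one of the two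
lifts of the dual segment in the first handle. -/
noncomputable def handleTwist (g : ℕ) (p : ArcSurface (surfaceWord true g (0 + 1)) × ℂ) : ℂ :=
  1 + (gapFun true g 0 {3} p.1 - 1) * ((1 - p.2) / 2)

theorem continuous_handleTwist {g : ℕ} : Continuous (handleTwist g) := by
  have : Continuous (gapFun true g 0 {3}) := continuous_gapFun
  unfold handleTwist
  fun_prop

/-- For `q.1 ≤ 5` the factor `gapExp {3} q - 1` is zero. For `q.1 ≥ 5` the first cover splits into
`z = 1`, where the twist is `1`, and `z = -1`, where it is `gapExp {3} q`. Thus the interpolation in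
`z` never really takes place. -/
theorem handleTwist_ne_zero {g : ℕ} {p : ArcSurface (surfaceWord true g (0 + 1)) × ℂ}
    (hp : p ∈ rootCover univ (gapFun true g 0 {2})) : handleTwist g p ≠ 0 := by
  obtain ⟨x, z⟩ := p
  obtain ⟨q, hq, rfl⟩ := exists_surfacePt x
  rw [length_surfaceWord_succ] at hq
  have h2 : z ^ 2 = gapExp {2} q := hp.2.trans (gapFun_stdPt hq)
  have hG : gapFun true g 0 {3} (stdPt true g 0 q) = gapExp {3} q := gapFun_stdPt hq
  rw [handleTwist, hG]
  rcases le_total q.1 5 with h | h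
  · rw [gapExp_singleton_of_le (by push_cast; linarith)]
    simp
  · rw [gapExp_singleton_of_ge (by push_cast; linarith), sq, mul_self_eq_one_iff] at h2
    rcases h2 with rfl | rfl
    · simp
    · have := gapExp_ne_zero {3} q
      norm_num
      exact this

/-- The outer curve meets gap `3` and the part of the bottom side below it, where `handleRoot` is
`-1` and `1` respectively. On the lift of sign `ε` exactly one of these two lies on the sheet `z =
-1` that sees the turn: gap `3` if `ε` is `true`, the bottom otherwise. A root therefore changes
sign exactly once on the way around. -/
theorem not_hasRootOn_handleTwist {g : ℕ} (hg : 0 < g) (ε : Bool) :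
    ¬ HasRootOn (outerCurve true g 0)
      fun x => handleTwist g (x, boolSign ε * turnRoot true g 0 x) := by
  rintro ⟨v, hv, hv2⟩
  have hb : 4 ≤ genusLength true g := genusLength_ge (o := true) hg
  have hb' : (4 : ℝ) ≤ genusLength true g := by exact_mod_cast hb
  set k : ArcSurface (surfaceWord true g (0 + 1)) → ℂ :=
    fun x => handleTwist g (x, boolSign ε * turnRoot true g 0 x) with hk
  have hkq : ∀ q ∈ outerEdge (genusLength true g) 0, k (stdPt true g 0 q) =
      1 + (gapExp {3} q - 1) * ((1 - boolSign ε * handleRoot q) / 2) := by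
    intro q hq
    rw [hk]
    dsimp only
    rw [handleTwist, turnRoot_true hg hq.1.1, gapFun_stdPt hq.1.1]
  have hone : ∀ q ∈ outerEdge (genusLength true g) 0, gapExp {3} q = 1 →
      k (stdPt true g 0 q) = 1 := by
    intro q hq h
    rw [hkq q hq, h]
    simp
  set V : ℕ → ℂ := fun n => v (stdPt true g 0 ((n : ℝ), 1)) with hV
  have hpc : Continuous fun t : ℝ => stdPt true g 0 (t, 1) :=
    (continuous_surfacePt _).comp (by fun_prop)
  have hmem : ∀ n : ℕ, n ≤ 4 → ∀ t ∈ Icc (2 * (n : ℝ)) (2 * n + 1),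
      (t, (1 : ℝ)) ∈ outerEdge (genusLength true g) 0 := fun n hn t ht =>
    mem_outerEdge_top (n := n) (by omega) (fun k hk => by omega) rfl ht
  have hgap : ∀ n ≤ 2, V (2 * n) = V (2 * n + 1) := by
    intro n hn
    have := root_path_const (a := 2 * n) (b := 2 * n + 1) hv hv2 hpc (by linarith)
      (fun t ht => stdPt_mem_outerCurve (hmem n (by omega) t ht)) one_ne_zero fun t ht =>
        hone _ (hmem n (by omega) t ht) (gapExp_singleton_of_le (by
          have : (n : ℝ) ≤ 2 := by exact_mod_cast hn
          push_cast
          linarith [ht.2]))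
    simp only [hV]
    push_cast
    exact this.symm
  have hgap3 : V 7 = V 6 * -boolSign ε := by
    have := root_path_apply (a := 6) (b := 7) hv hv2 hpc (by norm_num)
      (fun t ht => stdPt_mem_outerCurve (hmem 3 (by omega) t (by norm_num; exact ht)))
      (φ := fun t => if ε then gapSum {3} t else 0)
      (by cases ε; exacts [continuous_const, continuous_gapSum _]) one_ne_zero fun t ht => by
        rw [hkq _ (hmem 3 (by omega) t (by norm_num; exact ht)), handleRoot_gap_three ht rfl]
        cases ε
        · simp [boolSign]
        · simp only [boolSign, if_true]
          rw [gapExp]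
          ring
    simp only [hV]
    push_cast
    rw [this]
    cases ε
    · simp [boolSign]
    · simp only [boolSign, if_true, gapSum_singleton]
      rw [unitClamp_of_ge (by norm_num), unitClamp_of_le (by norm_num)]
      simp
  have g0 := stdPt_glue (o := true) (g := g) (M := 0) (i := 0) (by omega)
  have g1 := stdPt_glue (o := true) (g := g) (M := 0) (i := 1) (by omega)
  rw [stdPartner, if_pos ⟨rfl, by omega⟩, stdDir, decide_eq_false (by simp)] at g0 g1
  have e16 : V 1 = V 6 := congrArg v g0.1
  have e25 : V 2 = V 5 := congrArg v g0.2
  have e38 : V 3 = V 8 := congrArg v g1.1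
  have e47 : V 4 = V 7 := congrArg v g1.2
  have hrightG : ∀ y : ℝ, gapExp {3} ((2 * (genusLength true g + 2 * 0 : ℕ) + 1 : ℝ), y) = 1 :=
    fun y => gapExp_singleton_of_ge (by push_cast; linarith)
  have htail := root_outerCurve_tail hv hv2 (s := 4) hb (by simp) one_ne_zero
    (fun n hn hn' hs x hx => hone _ (mem_outerEdge_top hn' hs rfl hx) (gapExp_singleton_of_ge (by
      have : (4 : ℝ) ≤ n := by exact_mod_cast hn
      push_cast
      linarith [hx.1])))
    fun y hy => hone _ (mem_outerEdge_right hy) (hrightG y)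
  have hleft := root_outerCurve_left hv hv2 one_ne_zero fun y hy =>
    hone _ (mem_outerEdge_left hy) (gapExp_singleton_of_le (by norm_num))
  have hbot := root_outerCurve_bottom hv hv2 one_ne_zero
    (φ := fun t => if ε then 0 else gapSum {3} t)
    (by cases ε; exacts [continuous_gapSum _, continuous_const]) fun x hx => by
      rw [hkq _ (mem_outerEdge_bottom hx), handleRoot_bottom rfl]
      rcases le_total x 6 with h | h
      · have h3 : gapExp {3} (x, 0) = 1 := gapExp_singleton_of_le (by push_cast; linarith)
        rw [h3]
        cases ε
        · rw [gapExp] at h3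
          simp [h3]
        · simp
      · rw [halfTurn_of_ge (by push_cast; linarith)]
        cases ε
        · simp only [boolSign, Bool.false_eq_true, if_false]
          rw [gapExp]
          ring
        · simp [boolSign]
  have hbot' : V 8 = V 0 * boolSign ε := by
    have h0 : v (stdPt true g 0 (0, 1)) = V 0 := by simp [hV]
    rw [htail, hleft, h0] at hbot
    refine hbot.trans ?_
    cases ε
    · simp only [boolSign, Bool.false_eq_true, if_false, gapSum_singleton]
      rw [unitClamp_of_ge (by push_cast; linarith), unitClamp_of_le (by norm_num)]
      simp
    · simp [boolSign]
  have h01 : V 0 = V 1 := hgap 0 (by omega)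
  have h23 : V 2 = V 3 := hgap 1 (by omega)
  have h45 : V 4 = V 5 := hgap 2 (by omega)
  -- The boundary runs through the points 0, 1, 6, 7, 4, 5, 2, 3, 8 of the upper side and returns
  -- along the bottom; the factors `-boolSign ε` and `boolSign ε` differ by a sign.
  have hV0 : V 0 = 0 := by
    have h1 : V 0 * boolSign ε = -(V 0 * boolSign ε) := by
      calc V 0 * boolSign ε = V 7 := by rw [← hbot', ← e38, ← h23, e25, ← h45, e47]
        _ = _ := by rw [hgap3, ← e16, ← h01]; ring
    exact (mul_eq_zero.1 (self_eq_neg.1 h1)).resolve_right (boolSign_ne_zero ε)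
  have h0m : ((0 : ℝ), (1 : ℝ)) ∈ outerEdge (genusLength true g) 0 := mem_outerEdge_left (by simp)
  have := hv2 _ (stdPt_mem_outerCurve h0m)
  rw [hone _ h0m (gapExp_singleton_of_le (by norm_num))] at this
  simp only [hV, Nat.cast_zero] at hV0
  rw [hV0] at this
  norm_num at this

/-- The root of `F` makes half a turn on gap `1` and half a turn on the bottom side, and the
boundary curve passes both in the same sense. A further root picks up the factor `I` each time, and
`I * I = -1`. -/
theorem not_hasRootOn_crosscapTwist {g : ℕ} (hg : 0 < g) (ε : Bool) :
    ¬ HasRootOn (outerCurve false g 0) fun x => boolSign ε * turnRoot false g 0 x := by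
  rintro ⟨v, hv, hv2⟩
  have hb : 2 ≤ genusLength false g := genusLength_ge (o := false) hg
  have hb' : (2 : ℝ) ≤ genusLength false g := by exact_mod_cast hb
  have hε := boolSign_ne_zero ε
  set k : ArcSurface (surfaceWord false g (0 + 1)) → ℂ :=
    fun x => boolSign ε * turnRoot false g 0 x with hk
  have hkq : ∀ q ∈ outerEdge (genusLength false g) 0, k (stdPt false g 0 q) =
      boolSign ε * crosscapRoot q := by
    intro q hq
    rw [hk]
    dsimp only
    rw [turnRoot_false hg hq.1.1]
  have hhalf : ∀ t, halfTurn 1 t =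
      Complex.exp (2 * Real.pi * Complex.I * (gapSum {1} t / 2 : ℝ)) := by
    intro t
    rw [halfTurn]
    congr 1
    push_cast
    ring
  have hφ : Continuous fun t => gapSum {1} t / 2 := (continuous_gapSum _).div_const 2
  have hexp : Complex.exp (Real.pi * Complex.I * ((1 / 2 : ℝ) - (0 / 2 : ℝ))) = Complex.I := by
    refine Eq.trans (congrArg _ ?_) Complex.exp_pi_div_two_mul_I
    push_cast
    ring
  set V : ℕ → ℂ := fun n => v (stdPt false g 0 ((n : ℝ), 1)) with hV
  have hpc : Continuous fun t : ℝ => stdPt false g 0 (t, 1) :=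
    (continuous_surfacePt _).comp (by fun_prop)
  have hmem : ∀ n : ℕ, n ≤ 1 → ∀ t ∈ Icc (2 * (n : ℝ)) (2 * n + 1),
      (t, (1 : ℝ)) ∈ outerEdge (genusLength false g) 0 := fun n hn t ht =>
    mem_outerEdge_top (n := n) (by omega) (fun k hk => by omega) rfl ht
  have h01 : V 0 = V 1 := by
    have := root_path_const (a := 0) (b := 1) hv hv2 hpc (by linarith)
      (fun t ht => stdPt_mem_outerCurve (hmem 0 (by omega) t (by norm_num; exact ht)))
      (c := -boolSign ε) (neg_ne_zero.2 hε) fun t ht => by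
        rw [hkq _ (hmem 0 (by omega) t (by norm_num; exact ht)), crosscapRoot_of_le ht.2]
        ring
    simp only [hV]
    push_cast
    exact this.symm
  have h23 : V 3 = V 2 * Complex.I := by
    have := root_path_apply (a := 2) (b := 3) hv hv2 hpc (by norm_num)
      (fun t ht => stdPt_mem_outerCurve (hmem 1 (by omega) t (by norm_num; exact ht))) hφ hε
      fun t ht => by
        rw [hkq _ (hmem 1 (by omega) t (by norm_num; exact ht)), crosscapRoot_gap_one ht rfl]
        exact congrArg _ (hhalf t)
    rw [gapSum_singleton, gapSum_singleton, unitClamp_of_ge (by norm_num),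
      unitClamp_of_le (by norm_num), hexp] at this
    simp only [hV]
    push_cast
    exact this
  have g0 := stdPt_glue (o := false) (g := g) (M := 0) (i := 0) (by omega)
  rw [stdPartner, if_neg (by simp), stdDir, decide_eq_true ⟨rfl, by omega⟩] at g0
  have e13 : V 1 = V 3 := congrArg v g0.1
  have e24 : V 2 = V 4 := congrArg v g0.2
  have htail := root_outerCurve_tail hv hv2 (s := 2) hb (by simp) hε
    (fun n hn hn' hs x hx => by
      have : (2 : ℝ) ≤ n := by exact_mod_cast hn
      rw [hkq _ (mem_outerEdge_top hn' hs rfl hx), crosscapRoot_of_ge (by linarith [hx.1]),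
        mul_one])
    fun y hy => by
      rw [hkq _ (mem_outerEdge_right hy), crosscapRoot_of_ge (by push_cast; linarith), mul_one]
  have hleft := root_outerCurve_left hv hv2 (c := -boolSign ε) (neg_ne_zero.2 hε) fun y hy => by
    rw [hkq _ (mem_outerEdge_left hy), crosscapRoot_of_le (by norm_num)]
    ring
  have hbot := root_outerCurve_bottom hv hv2 (c := -boolSign ε) (neg_ne_zero.2 hε) hφ
    fun x hx => by
      rw [hkq _ (mem_outerEdge_bottom hx), crosscapRoot_bottom rfl, ← hhalf]
      ring
  have h04 : V 4 = V 0 * Complex.I := by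
    have h0 : v (stdPt false g 0 (0, 1)) = V 0 := by simp [hV]
    rw [htail, hleft, h0, gapSum_singleton, gapSum_singleton,
      unitClamp_of_ge (by push_cast; linarith), unitClamp_of_le (by norm_num), hexp] at hbot
    exact hbot
  have hV0 : V 0 = 0 := by
    refine self_eq_neg.1 ?_
    calc V 0 = V 2 * Complex.I := by rw [h01, e13, h23]
      _ = V 0 * (Complex.I * Complex.I) := by rw [e24, h04]; ring
      _ = _ := by rw [Complex.I_mul_I]; ring
  have h0m : ((0 : ℝ), (1 : ℝ)) ∈ outerEdge (genusLength false g) 0 := mem_outerEdge_left (by simp)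
  have := hv2 _ (stdPt_mem_outerCurve h0m)
  rw [hkq _ h0m, crosscapRoot_of_le (by norm_num)] at this
  simp only [hV, Nat.cast_zero] at hV0
  rw [hV0] at this
  simp [hε] at this

/-! ### The functions that define the coverings of the standard surfaces -/

section Section

variable {X : Type*} [TopologicalSpace X] {F : X → ℂ} {h : X × ℂ → ℂ} {γ : Set X}

/-- A lift of `γ` to the first cover on which `h` has no root shows that the second storey is
nontrivial; it serves to prove connectedness. -/
theorem not_hasRootOn_rootCover_of_section {s : X → ℂ} (hs : ContinuousOn s γ)
    (hs2 : ∀ x ∈ γ, s x ^ 2 = F x) (hh : ¬ HasRootOn γ fun x => h (x, s x)) :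
    ¬ HasRootOn (rootCover univ F) h := fun ⟨r, hr, hr2⟩ =>
  hh ⟨fun x => r (x, s x), hr.comp (continuousOn_id.prodMk hs) fun x hx => ⟨mem_univ _, hs2 x hx⟩,
    fun x hx => hr2 _ ⟨mem_univ _, hs2 x hx⟩⟩

theorem not_hasRootOn_rootCover_of_eq_one (hF : ∀ x ∈ γ, F x = 1) {k : X → ℂ}
    (hk : ¬ HasRootOn γ k) : ¬ HasRootOn (rootCover univ F) fun p => k p.1 :=
  not_hasRootOn_rootCover_of_section (s := fun _ => 1) continuousOn_const
    (fun x hx => by rw [hF x hx, one_pow]) hk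

theorem splitsOver_of_not_hasRootOn (hF : ¬ HasRootOn γ F) {k : X → ℂ} (hk : HasRootOn γ k) :
    SplitsOver F (fun p => k p.1) γ := by
  obtain ⟨r, hr, hr2⟩ := hk
  exact Or.inl ⟨hF, fun p => r p.1, hr.comp continuousOn_fst fun p hp => hp.1,
    fun p hp => hr2 _ hp.1⟩

/-- On the first cover the coordinate `z` is itself a root of `F`, hence of `k` over `γ`. -/
theorem splitsOver_of_eqOn (hF : ¬ HasRootOn γ F) {k : X → ℂ} (hk : ∀ x ∈ γ, k x = F x) :
    SplitsOver F (fun p => k p.1) γ :=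
  Or.inl ⟨hF, Prod.snd, continuousOn_snd, fun _ hp => hp.2.trans (hk _ hp.1).symm⟩

theorem splitsOver_of_eq_one (hF : ∀ x ∈ γ, F x = 1) {k : X → ℂ} (hk : ¬ HasRootOn γ k) :
    SplitsOver F (fun p => k p.1) γ :=
  Or.inr ⟨fun _ => 1, continuousOn_const, fun x hx => by rw [hF x hx, one_pow], fun _ => hk⟩

theorem hasRootOn_of_eq_one {k : X → ℂ} (hk : ∀ x ∈ γ, k x = 1) : HasRootOn γ k :=
  ⟨fun _ => 1, continuousOn_const, fun x hx => by rw [hk x hx, one_pow]⟩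

/-- There are functions that define a covering with four sheets in which the preimage of every
boundary component consists of two double covers; it is connected if `c` holds. -/
def HasSplitting (X : Type*) [TopologicalSpace X] (c : Prop) : Prop :=
  ∃ (F : X → ℂ) (h : X × ℂ → ℂ), Continuous F ∧ (∀ x, F x ≠ 0) ∧ Continuous h ∧
    (∀ p ∈ rootCover univ F, h p ≠ 0) ∧
    (c → ¬ HasRootOn univ F ∧ ¬ HasRootOn (rootCover univ F) h) ∧
    ∀ γ ∈ boundaryComponents X, SplitsOver F h γ

end Section

/-! ### The cases according to genus and number of holes. -/

variable {o : Bool} {g M : ℕ}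

theorem not_hasRootOn_outerCurve_one (hM : 0 < M) :
    ¬ HasRootOn (outerCurve o g M) (gapFun o g M {genusLength o g + 1}) :=
  not_hasRootOn_outerCurve (fun n hn => ⟨0, hM, Finset.mem_singleton.1 hn⟩) (by simp)

/-- `F` turns around hole `0` and the outer curve. `h` turns around the holes from `M % 2` on: these
are even in number, so `h` has a root on the outer curve, and they include every hole that `F` does
not see. Hole `0` is among them only if `M` is even, and there `h` agrees with `F`; if `M` is odd,
`h` is `1` on it. -/
theorem hasSplitting_of_two_le (hM : 2 ≤ M) (c : Prop) :
    HasSplitting (ArcSurface (surfaceWord o g (M + 1))) c := by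
  set b := genusLength o g with hb
  set J : Finset ℕ := (Finset.Ico (M % 2) M).image fun k => b + 2 * k + 1 with hJ
  have hinj : Function.Injective fun k => b + 2 * k + 1 := fun i j h => by
    dsimp only at h
    omega
  have hcard : J.card = M - M % 2 := by
    rw [hJ, Finset.card_image_of_injective _ hinj, Nat.card_Ico]
  have hmem : ∀ k < M, M % 2 ≤ k → b + 2 * k + 1 ∈ J := fun k h1 h2 =>
    Finset.mem_image_of_mem _ (Finset.mem_Ico.2 ⟨h2, h1⟩)
  have hsub : ∀ n ∈ J, ∃ k < M, n = b + 2 * k + 1 := by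
    intro n hn
    obtain ⟨k, hk, rfl⟩ := Finset.mem_image.1 hn
    exact ⟨k, (Finset.mem_Ico.1 hk).2, rfl⟩
  have hF1 : ∀ k < M, 0 < k → ∀ x ∈ smallCurve o g M k, gapFun o g M {b + 1} x = 1 :=
    fun k hk hk0 x hx => gapFun_smallCurve_of_notMem hk (by simp; omega) hx
  have hF0 : ¬ HasRootOn (smallCurve o g M 0) (gapFun o g M {b + 1}) :=
    not_hasRootOn_smallCurve (by omega) (by simp [hb])
  -- Hole `1` lies in `J` for either parity of `M` while `F` is `1` on it; this makes the second
  -- storey nontrivial.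
  refine ⟨gapFun o g M {b + 1}, fun p => gapFun o g M J p.1, continuous_gapFun, gapFun_ne_zero,
    continuous_gapFun.comp continuous_fst, fun p _ => gapFun_ne_zero _, fun _ => ⟨fun h =>
      hF0 (h.mono (subset_univ _)), not_hasRootOn_rootCover_of_eq_one (hF1 1 hM one_pos)
        (not_hasRootOn_smallCurve (by omega) (hmem 1 (by omega) (by omega)))⟩, fun γ hγ => ?_⟩
  rcases eq_of_mem_boundaryComponents hγ with rfl | ⟨k, hk, rfl⟩
  · refine splitsOver_of_not_hasRootOn (not_hasRootOn_outerCurve_one (by omega))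
      (hasRootOn_outerCurve hsub ?_)
    rw [hcard, Nat.even_iff]
    omega
  · rcases Nat.eq_zero_or_pos k with rfl | hk0
    · by_cases h : b + 2 * 0 + 1 ∈ J
      · exact splitsOver_of_eqOn hF0 fun x hx => gapFun_smallCurve_of_mem hk h hx
      · exact splitsOver_of_not_hasRootOn hF0
          (hasRootOn_of_eq_one fun x hx => gapFun_smallCurve_of_notMem hk h hx)
    · exact splitsOver_of_eq_one (hF1 k hk hk0)
        (not_hasRootOn_smallCurve hk (hmem k hk (by omega)))

/-- The first storey is already nontrivial on both boundary curves, and the second just takes two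
copies of it; connectedness is given up. -/
theorem hasSplitting_annulus (g : ℕ) :
    HasSplitting (ArcSurface (surfaceWord o g (1 + 1))) False := by
  refine ⟨gapFun o g 1 {genusLength o g + 1}, fun _ => 1, continuous_gapFun, gapFun_ne_zero,
    continuous_const, fun _ _ => one_ne_zero, False.elim, fun γ hγ =>
    splitsOver_of_not_hasRootOn (k := fun _ => 1) ?_ (hasRootOn_of_eq_one fun _ _ => rfl)⟩
  rcases eq_of_mem_boundaryComponents hγ with rfl | ⟨k, hk, rfl⟩
  · exact not_hasRootOn_outerCurve_one one_pos
  · obtain rfl : k = 0 := by omega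
    exact not_hasRootOn_smallCurve one_pos (by simp)

/-- Again `F` turns around both boundary curves. `h` turns in the first handle or crosscap: it has a
root on either boundary curve, but none on `turnLoop`, where `F` is `1`. -/
theorem hasSplitting_of_eq_one (hg : 0 < g) (c : Prop) :
    HasSplitting (ArcSurface (surfaceWord o g (1 + 1))) c := by
  have hb := genusLength_ge (o := o) hg
  have hF0 : ¬ HasRootOn (smallCurve o g 1 0) (gapFun o g 1 {genusLength o g + 1}) :=
    not_hasRootOn_smallCurve (by omega) (by simp)
  refine ⟨gapFun o g 1 {genusLength o g + 1}, fun p => gapFun o g 1 {turnGap o} p.1,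
    continuous_gapFun, gapFun_ne_zero, continuous_gapFun.comp continuous_fst,
    fun p _ => gapFun_ne_zero _, fun _ => ⟨fun h => hF0 (h.mono (subset_univ _)),
      not_hasRootOn_rootCover_of_eq_one (fun x hx => gapFun_turnLoop hg hx)
        (not_hasRootOn_turnLoop hg)⟩, fun γ hγ => ?_⟩
  rcases eq_of_mem_boundaryComponents hγ with rfl | ⟨k, hk, rfl⟩
  · exact splitsOver_of_not_hasRootOn (not_hasRootOn_outerCurve_one one_pos)
      ⟨turnRoot o g 1, (continuous_turnRoot hg).continuousOn, fun x hx => turnRoot_sq hg hx⟩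
  · obtain rfl : k = 0 := by omega
    refine splitsOver_of_not_hasRootOn hF0 (hasRootOn_of_eq_one fun x hx =>
      gapFun_smallCurve_of_notMem one_pos ?_ hx)
    rw [Finset.mem_singleton, turnGap]
    split_ifs at * <;> omega

/-- The only boundary curve has two lifts to the first cover, given by `turnRoot` and its negative,
so `h` has to be nontrivial on both. A crosscap allows `h = z`; a handle needs `handleTwist`, which
distinguishes the sheets. -/
theorem hasSplitting_of_eq_zero (hg : 0 < g) (c : Prop) :
    HasSplitting (ArcSurface (surfaceWord o g (0 + 1))) c := by
  have key : ∀ h : ArcSurface (surfaceWord o g (0 + 1)) × ℂ → ℂ, Continuous h →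
      (∀ p ∈ rootCover univ (gapFun o g 0 {turnGap o}), h p ≠ 0) →
      (∀ ε, ¬ HasRootOn (outerCurve o g 0) fun x => h (x, boolSign ε * turnRoot o g 0 x)) →
      HasSplitting (ArcSurface (surfaceWord o g (0 + 1))) c := by
    intro h hh hh0 hroot
    have hu := (continuous_turnRoot (o := o) (M := 0) hg).continuousOn (s := outerCurve o g 0)
    refine ⟨gapFun o g 0 {turnGap o}, h, continuous_gapFun, gapFun_ne_zero, hh, hh0,
      fun _ => ⟨fun hF => not_hasRootOn_turnLoop hg (hF.mono (subset_univ _)),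
        not_hasRootOn_rootCover_of_section hu (fun x hx => turnRoot_sq hg hx)
          (by simpa [boolSign] using hroot true)⟩, fun γ hγ => ?_⟩
    rcases eq_of_mem_boundaryComponents hγ with rfl | ⟨k, hk, rfl⟩
    · exact Or.inr ⟨turnRoot o g 0, hu, fun x hx => turnRoot_sq hg hx, hroot⟩
    · omega
  cases o
  · refine key Prod.snd continuous_snd ?_ fun ε => not_hasRootOn_crosscapTwist hg ε
    rintro ⟨x, z⟩ ⟨-, hz⟩ h0
    dsimp only at hz h0
    exact gapFun_ne_zero x (by rw [← hz, h0]; simp)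
  · exact key (handleTwist g) continuous_handleTwist (fun p hp => handleTwist_ne_zero hp)
      fun ε => not_hasRootOn_handleTwist hg ε

theorem hasSplitting_standard (h : ¬ (g = 0 ∧ M = 0)) :
    HasSplitting (ArcSurface (surfaceWord o g (M + 1))) (¬ (g = 0 ∧ M = 1)) := by
  rcases Nat.eq_zero_or_pos g with rfl | hg
  · rcases lt_or_ge M 2 with hM | hM
    · obtain rfl : M = 1 := by omega
      simpa using hasSplitting_annulus (o := o) 0
    · exact hasSplitting_of_two_le hM _
  · rcases lt_or_ge M 2 with hM | hM
    · interval_cases M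
      · exact hasSplitting_of_eq_zero hg _
      · exact hasSplitting_of_eq_one hg _
    · exact hasSplitting_of_two_le hM _

/-! ### Transport along a homeomorphism -/

section Transport

variable {X Y : Type*} [TopologicalSpace X] [TopologicalSpace Y] (e : X ≃ₜ Y)
  {F : Y → ℂ} {h : Y × ℂ → ℂ}

theorem Homeomorph.hasRootOn_comp {B : Set Y} {A : Set X} (hAB : e '' A = B) {k : Y → ℂ} :
    HasRootOn A (k ∘ e) ↔ HasRootOn B k := by
  subst hAB
  constructor
  · rintro ⟨r, hr, hr2⟩
    refine ⟨r ∘ e.symm, hr.comp e.symm.continuous.continuousOn ?_, ?_⟩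
    · rintro _ ⟨a, ha, rfl⟩
      simpa using ha
    · rintro _ ⟨a, ha, rfl⟩
      simpa using hr2 a ha
  · rintro ⟨r, hr, hr2⟩
    exact ⟨r ∘ e, hr.comp e.continuous.continuousOn fun a ha => mem_image_of_mem _ ha,
      fun a ha => hr2 _ (mem_image_of_mem _ ha)⟩

theorem Homeomorph.image_rootCover (A : Set X) :
    e.prodCongr (Homeomorph.refl ℂ) '' rootCover A (F ∘ e) = rootCover (e '' A) F := by
  ext ⟨y, z⟩
  constructor
  · rintro ⟨⟨x, w⟩, ⟨h1, h2⟩, he⟩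
    obtain ⟨rfl, rfl⟩ := Prod.mk.inj he
    exact ⟨mem_image_of_mem _ h1, h2⟩
  · rintro ⟨⟨x, hx, rfl⟩, h2⟩
    exact ⟨(x, z), ⟨hx, h2⟩, rfl⟩

theorem Homeomorph.splitsOver_comp {γ : Set X} (hs : SplitsOver F h (e '' γ)) :
    SplitsOver (F ∘ e) (h ∘ e.prodCongr (Homeomorph.refl ℂ)) γ := by
  rcases hs with ⟨h1, h2⟩ | ⟨u, h1, h2, h3⟩
  · exact Or.inl ⟨fun h => h1 ((e.hasRootOn_comp rfl).1 h),
      (Homeomorph.hasRootOn_comp _ (e.image_rootCover γ)).2 h2⟩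
  · refine Or.inr ⟨u ∘ e, h1.comp e.continuous.continuousOn fun a ha => mem_image_of_mem _ ha,
      fun x hx => h2 _ (mem_image_of_mem _ hx), fun b hb => h3 b ?_⟩
    exact (e.hasRootOn_comp rfl).1 hb

theorem Homeomorph.image_surfaceBoundary : e '' surfaceBoundary X = surfaceBoundary Y := by
  ext y
  obtain ⟨x, rfl⟩ := e.surjective y
  rw [e.injective.mem_set_image, e.isLocalHomeomorph.mem_surfaceBoundary_iff]

theorem Homeomorph.image_mem_boundaryComponents {γ : Set X} (hγ : γ ∈ boundaryComponents X) :
    e '' γ ∈ boundaryComponents Y := by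
  obtain ⟨x, hx, rfl⟩ := hγ
  refine ⟨e x, ?_, ?_⟩
  · rw [← e.image_surfaceBoundary]
    exact mem_image_of_mem _ hx
  · rw [e.image_connectedComponentIn hx, e.image_surfaceBoundary]

theorem HasSplitting.homeomorph (e : X ≃ₜ Y) {c : Prop} (H : HasSplitting Y c) : HasSplitting X c := by
  obtain ⟨F, h, hF, hF0, hh, hh0, hc, hs⟩ := H
  have hU : e '' univ = univ := image_univ_of_surjective e.surjective
  have hR := e.image_rootCover (F := F) univ
  rw [hU] at hR
  refine ⟨F ∘ e, h ∘ e.prodCongr (Homeomorph.refl ℂ), hF.comp e.continuous, fun x => hF0 _,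
    hh.comp (Homeomorph.continuous _), fun p hp => hh0 _ (hR ▸ mem_image_of_mem _ hp),
    fun hc' => ⟨fun h1 => (hc hc').1 ((e.hasRootOn_comp hU).1 h1), fun h1 =>
      (hc hc').2 ((Homeomorph.hasRootOn_comp _ hR).1 h1)⟩, fun γ hγ =>
    e.splitsOver_comp (hs _ (e.image_mem_boundaryComponents hγ))⟩

end Transport

/-! ### The disk and the annulus -/

theorem surfaceWord_zero_one (o : Bool) : surfaceWord o 0 1 = [] := by cases o <;> rfl

theorem surfaceWord_zero (o : Bool) (m : ℕ) : surfaceWord o 0 m = surfaceWord true 0 m := by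
  cases o
  · simp [surfaceWord]
  · rfl

theorem bijective_surfaceMk_nil : Function.Bijective (surfaceMk []) := by
  refine ⟨fun p q h => ?_, (isQuotientMap_surfaceMk []).surjective⟩
  have H : WordPairing [] (stdPartner true 0) (stdDir true 0) := wordPairing_surfaceWord true 0 1
  rw [surfaceMk_eq, surfaceMk_eq, H.surfacePt_eq_iff p.mem q.mem] at h
  rcases h with h | ⟨i, hi, -⟩
  · exact Subtype.ext h
  · exact absurd hi (Nat.not_lt_zero i)

/-- A bounded convex set with interior points can be carried to the unit ball by a homeomorphism of
the plane. -/
theorem nonempty_homeomorph_arcRectangle_closedBall :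
    Nonempty (ArcRectangle 0 ≃ₜ Metric.closedBall (0 : ℂ) 1) := by
  let L := Complex.equivRealProdCLM.symm
  have hcomp : IsCompact (arcRect 0) := isCompact_Icc.prod isCompact_Icc
  have hconv : Convex ℝ (L '' arcRect 0) :=
    ((convex_Icc _ _).prod (convex_Icc _ _)).linear_image L.toLinearEquiv.toLinearMap
  have hcompL : IsCompact (L '' arcRect 0) := hcomp.image L.continuous
  have hint : (interior (L '' arcRect 0)).Nonempty := by
    have : (interior (arcRect 0)).Nonempty :=
      ⟨(1 / 2, 1 / 2), by rw [arcRect, interior_prod_eq, interior_Icc, interior_Icc]; norm_num⟩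
    have h2 := L.toHomeomorph.image_interior (arcRect 0)
    exact (h2 ▸ this.image _ : (interior (L.toHomeomorph '' arcRect 0)).Nonempty)
  obtain ⟨f, -, hf, -⟩ :=
    exists_homeomorph_image_interior_closure_frontier_eq_unitBall hconv hint hcompL.isBounded
  rw [hcompL.isClosed.closure_eq] at hf
  exact ⟨(L.toHomeomorph.image (arcRect 0)).trans ((f.image _).trans (Homeomorph.setCongr hf))⟩

theorem nonempty_homeomorph_disk (o : Bool) :
    Nonempty (StandardSurface o 0 1 ≃ₜ Metric.closedBall (0 : ℂ) 1) := by
  obtain ⟨f⟩ := nonempty_homeomorph_arcRectangle_closedBall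
  have H : WordPairing [] (stdPartner true 0) (stdDir true 0) := wordPairing_surfaceWord true 0 1
  have : T2Space (ArcSurface []) := H.t2Space
  have e : ArcRectangle 0 ≃ₜ ArcSurface [] :=
    Continuous.homeoOfEquivCompactToT2 (f := Equiv.ofBijective _ bijective_surfaceMk_nil)
      (isQuotientMap_surfaceMk []).continuous
  change Nonempty (ArcSurface (surfaceWord o 0 1) ≃ₜ _)
  rw [surfaceWord_zero_one]
  exact ⟨e.symm.trans f⟩

/-! ### The theorem for arbitrary orbifolds. -/

theorem mainTheorem7 (S : BorderedOrbifold.{u}) (hS : ¬ S.IsDisk) :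
    ∃ C : S.Covering 4,
      (¬ S.IsAnnulus → ConnectedSpace C.total) ∧
      ∀ γ ∈ boundaryComponents S.carrier,
        ∃ γ₀ ∈ boundaryComponents C.total, ∃ γ₁ ∈ boundaryComponents C.total,
          γ₀ ≠ γ₁ ∧ C.proj ⁻¹' γ = γ₀ ∪ γ₁ ∧
          IsDoubleCoverOn C.proj γ₀ γ ∧ IsDoubleCoverOn C.proj γ₁ γ := by
  obtain ⟨o, g, m, hm, ⟨e⟩⟩ := S.exists_homeo
  obtain ⟨M, rfl⟩ : ∃ M, m = M + 1 := ⟨m - 1, by omega⟩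
  have H := wordPairing_surfaceWord o g (M + 1)
  have hT2 : T2Space (ArcSurface (surfaceWord o g (M + 1))) := H.t2Space
  let e' : S.carrier ≃ₜ ArcSurface (surfaceWord o g (M + 1)) := e
  have : T2Space S.carrier := e'.symm.t2Space
  have : CompactSpace S.carrier := e'.symm.compactSpace
  have hconn : ConnectedSpace S.carrier := e'.symm.surjective.connectedSpace e'.symm.continuous
  -- Genus zero and one hole give the empty word: nothing is glued, and the rectangle is a disk.
  have hdisk : ¬ (g = 0 ∧ M = 0) := by
    rintro ⟨rfl, rfl⟩
    obtain ⟨f⟩ := nonempty_homeomorph_disk o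
    exact hS ⟨e.trans f⟩
  -- In genus zero the words for both values of `o` coincide, so `IsAnnulus` also covers a sphere
  -- with no crosscaps and two holes.
  have hannulus : ¬ S.IsAnnulus → ¬ (g = 0 ∧ M = 1) := by
    rintro h ⟨rfl, rfl⟩
    have e₂ := e'
    rw [surfaceWord_zero] at e₂
    exact h ⟨e₂⟩
  obtain ⟨F, h, hF, hF0, hh, hh0, hc, hs⟩ := (hasSplitting_standard hdisk).homeomorph e'
  obtain ⟨C, hC, hCγ⟩ := S.exists_covering_four hF hF0 hh hh0
  exact ⟨C, fun h => hC hconn (hc (hannulus h)).1 (hc (hannulus h)).2,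
    fun γ hγ => hCγ γ hγ (hs γ hγ)⟩
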